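/- Let $\alpha>0$ and $K=[-\alpha,\alpha]^2$. Consider $u\in C^2(K)$ of the form $u(x,y)=f(x)+g(y)$, where $f,g:[-\alpha,\alpha]\to\mathbb R$ satisfy $$f(0)=g(0)=0,\qquad f'(0)=g'(0)=0,\qquad f''(0)\,g''(0)<0,\tag{1}$$ $$f'(x)>0>g'(x)\ \text{ for } x\in(0,\alpha],\qquad f'(x)<0<g'(x)\ \text{ for } x\in[-\alpha,0).\tag{2}$$ Put $\Gamma^s=\{0\}\times[-\alpha,\alpha]$, $\Gamma^u=[-\alpha,\alpha]\times\{0\}$ and $\Gamma=\Gamma^s\cup\Gamma^u$. Define $F,G$ on $[-\alpha,\alpha]\setminus\{0\}$ by $F(x)=\int_{\alpha}^{x}\frac{dt}{f'(t)}$, $G(x)=\int_{\alpha}^{x}\frac{dt}{g'(t)}$ for $x\in(0,\alpha]$, and by the same formulas with lower limit $-\alpha$ for $x\in[-\alpha,0)$; $F^{-1},G^{-1}$ denote the inverses of $F,G$ restricted to $(0,\alpha]$ or to $[-\alpha,0)$. Let $Q$ be the set of the points $(x,y)$ in the interior of $K$ such that $$f(\pm\alpha)+g\big(G^{-1}(-F(x)+G(y))\big)>0\quad\text{and}\quad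 g(\pm\alpha)+f\big(F^{-1}(-G(y)+F(x))\big)<0,$$ where the sign in $f(\pm\alpha)$ and the branch of $F^{-1}$ are given by the sign of $x$, the sign in $g(\pm\alpha)$ and the branch of $G^{-1}$ by the sign of $y$, with the conventions $F(0)=-\infty$, $G(0)=\infty$, $F^{-1}(-\infty)=G^{-1}(\infty)=0$ (so all the points of $\Gamma$ interior to $K$ belong to $Q$). For an open set $\Omega\subset K$, $\nabla u$ is said to be isotropically realizable in $\Omega$ with the conductivity $\sigma$ if $\sigma>0$ a.e. in $\Omega$ and $\mathrm{div}(\sigma\nabla u)=0$ in the sense of distributions in $\Omega$. Then $Q$ is an open neighborhood of $(0,0)$, and for each $p\in Q\setminus\Gamma$ the solution $X(\cdot,p)$ of $\partial_tX(t,p)=\nabla u(X(t,p))$, $X(0,p)=p$, reaches the set $\{u=0\}$, while staying in the interior of $K$, at a unique time $\tau(p)\in\mathbb R$. The function $$w(p)=\int_0^{\tau(p)}\Delta u\big(X(s,p)\big)\,ds$$ belongs to $C^1(Q\setminus\Gamma)$. Moreover: (i) If $\nabla u$ is isotropically realizable in $Q$ with a conductivity $\sigma$ such that $\sigma,\sigma^{-1}\in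 L^\infty_{\rm loc}(Q)\cap C^1(Q\setminus\Gamma)$, then $\Delta u(0,0)=0$. (ii) If $\Delta u(0,0)=0$ and the functions $F-\dfrac{\ln|\cdot|}{f''(0)}$ and $G-\dfrac{\ln|\cdot|}{g''(0)}$ are bounded in a neighborhood of $0$, then $\nabla u$ is isotropically realizable in $Q$ with a conductivity $\sigma$ such that $\sigma,\sigma^{-1}\in L^\infty_{\rm loc}(Q)\cap C^1(Q\setminus\Gamma)$. (iii) For every $\alpha>0$ there exists a function $u\in C^2(K)$ of the form $u(x,y)=f(x)+g(y)$ satisfying (1), (2) and $\Delta u(0,0)=0$ such that, for any open neighborhood $V\subset K$ of $(0,0)$, $\nabla u$ is not isotropically realizable in $V$ with any conductivity $\sigma$ such that $\sigma,\sigma^{-1}\in L^\infty(V)\cap C^1(V\setminus\Gamma)$. -/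

import Mathlib

open Set Filter Topology MeasureTheory
open scoped ContDiff

noncomputable section

/-- First partial derivative of a function on the plane. -/
def partialX (u : ℝ × ℝ → ℝ) (p : ℝ × ℝ) : ℝ := deriv (fun x => u (x, p.2)) p.1

/-- Second partial derivative of a function on the plane. -/
def partialY (u : ℝ × ℝ → ℝ) (p : ℝ × ℝ) : ℝ := deriv (fun y => u (p.1, y)) p.2

/-- The gradient in the plane. -/
def planeGrad (u : ℝ × ℝ → ℝ) (p : ℝ × ℝ) : ℝ × ℝ := (partialX u p, partialY u p)

/-- The Laplacian in the plane. -/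
def planeLaplacian (u : ℝ × ℝ → ℝ) (p : ℝ × ℝ) : ℝ :=
  partialX (partialX u) p + partialY (partialY u) p

/-- `K = [-α, α]²`. -/
def squareK (α : ℝ) : Set (ℝ × ℝ) := Icc (-α) α ×ˢ Icc (-α) α

/-- The stable curve `{0} × [-α, α]`. -/
def stableCurve (α : ℝ) : Set (ℝ × ℝ) := {0} ×ˢ Icc (-α) α

/-- The unstable curve `[-α, α] × {0}`. -/
def unstableCurve (α : ℝ) : Set (ℝ × ℝ) := Icc (-α) α ×ˢ {0}

/-- The potential `u(x, y) = f(x) + g(y)`. -/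
def sepPotential (f g : ℝ → ℝ) (p : ℝ × ℝ) : ℝ := f p.1 + g p.2

/-- First derivative of a function on `[-α, α]` (one-sided at the end points). -/
def der1 (α : ℝ) (h : ℝ → ℝ) : ℝ → ℝ := derivWithin h (Icc (-α) α)

/-- Second derivative of a function on `[-α, α]` (one-sided at the end points). -/
def der2 (α : ℝ) (h : ℝ → ℝ) : ℝ → ℝ := derivWithin (der1 α h) (Icc (-α) α)

/-- `u(x, y) = f(x) + g(y)` is of class `C²` on `[-α, α]²`, and `f`, `g` satisfy the normalization,
the saddle condition at the origin and the sign conditions on `f'`, `g'`. Only the values of `f` and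
`g` on `[-α, α]` matter. -/
structure IsSaddlePair (α : ℝ) (f g : ℝ → ℝ) : Prop where
  contDiffOn : ContDiffOn ℝ 2 (sepPotential f g) (squareK α)
  f_zero : f 0 = 0
  g_zero : g 0 = 0
  f_der_zero : der1 α f 0 = 0
  g_der_zero : der1 α g 0 = 0
  saddle : der2 α f 0 * der2 α g 0 < 0
  right : ∀ x ∈ Ioc 0 α, 0 < der1 α f x ∧ der1 α g x < 0
  left : ∀ x ∈ Ico (-α) 0, der1 α f x < 0 ∧ 0 < der1 α g x

/-- The function `F` (for `h = f`) or `G` (for `h = g`) on `[-α, α] \ {0}`: the primitive of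
`1 / h'` that vanishes at `α` on `(0, α]`, and at `-α` on `[-α, 0)`. -/
def timePrimitive (α : ℝ) (h : ℝ → ℝ) (x : ℝ) : ℝ :=
  if 0 < x then ∫ t in α..x, 1 / der1 α h t else ∫ t in (-α)..x, 1 / der1 α h t

/-- The end point `α` or `-α` lying on the same side of `0` as `x`. -/
def sideEnd (α x : ℝ) : ℝ := if 0 < x then α else -α

/-- The one of the two intervals `(0, α]`, `[-α, 0)` lying on the same side of `0` as `x`. -/
def sideInterval (α x : ℝ) : Set ℝ := if 0 < x then Ioc 0 α else Ico (-α) 0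

/-- The reciprocal function of `F` (or `G`) restricted to the one of the intervals `(0, α]`,
`[-α, 0)` that contains `x`. -/
def sideInverse (α : ℝ) (h : ℝ → ℝ) (x : ℝ) : ℝ → ℝ :=
  Function.invFunOn (timePrimitive α h) (sideInterval α x)

/-- The set `Q`: the points `(x, y)` interior to `K` with
`f(±α) + g(G⁻¹(-F(x) + G(y))) > 0` and `g(±α) + f(F⁻¹(-G(y) + F(x))) < 0`, where the signs and the
branches are those of `x` for `f, F` and of `y` for `g, G`. On the axes the conventions `F(0) = -∞`,
`G(0) = ∞`, `F⁻¹(-∞) = G⁻¹(∞) = 0` reduce the two conditions to `f(±α) > 0` and `g(±α) < 0`, which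
always hold, so that all the points of the axes interior to `K` belong to `Q`. -/
def regionQ (α : ℝ) (f g : ℝ → ℝ) : Set (ℝ × ℝ) :=
  {p | p ∈ interior (squareK α) ∧
    (p.1 = 0 ∨ p.2 = 0 ∨
      (0 < f (sideEnd α p.1)
          + g (sideInverse α g p.2 (-timePrimitive α f p.1 + timePrimitive α g p.2)) ∧
        g (sideEnd α p.2)
          + f (sideInverse α f p.1 (-timePrimitive α g p.2 + timePrimitive α f p.1)) < 0))}

/-- `X` solves the gradient system `X' = ∇u(X)`, `X(0) = p`, on the time interval between `0` and
`T` (`T` may be negative), stays in `S` during that interval, and reaches `{u = 0}` at time `T`. -/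
structure IsHittingArc (u : ℝ × ℝ → ℝ) (S : Set (ℝ × ℝ)) (p : ℝ × ℝ) (T : ℝ)
    (X : ℝ → ℝ × ℝ) : Prop where
  init : X 0 = p
  mem : ∀ t ∈ uIcc 0 T, X t ∈ S
  ode : ∀ t ∈ uIcc 0 T, HasDerivWithinAt X (planeGrad u (X t)) (uIcc 0 T) t
  hit : u (X T) = 0

/-- For each point `p` of `D`, the gradient trajectory issued from `p` reaches the equipotential
`{u = 0}` inside `S`, at the unique time `τ p`, and `w p` is the integral of `Δu` along it from time
`0` to time `τ p`. -/
def IsHittingIntegral (u : ℝ × ℝ → ℝ) (S D : Set (ℝ × ℝ)) (τ w : ℝ × ℝ → ℝ) : Prop :=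
  ∀ p ∈ D, (∃ X, IsHittingArc u S p (τ p) X) ∧
    ∀ T X, IsHittingArc u S p T X →
      T = τ p ∧ w p = ∫ s in (0 : ℝ)..T, planeLaplacian u (X s)

/-- `∇u` is isotropically realizable in the open set `Ω` with the conductivity `σ`: `σ > 0` a.e. in
`Ω` and `div (σ ∇u) = 0` in the sense of distributions in `Ω`. -/
def IsRealizableWith (u : ℝ × ℝ → ℝ) (Ω : Set (ℝ × ℝ)) (σ : ℝ × ℝ → ℝ) : Prop :=
  (∀ᵐ p ∂(volume.restrict Ω), 0 < σ p) ∧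
    LocallyIntegrableOn σ Ω ∧
    ∀ φ : ℝ × ℝ → ℝ, ContDiff ℝ ∞ φ → HasCompactSupport φ → tsupport φ ⊆ Ω →
      ∫ p in Ω, σ p * (partialX u p * partialX φ p + partialY u p * partialY φ p) = 0

/-- `h ∈ L^∞(Ω)`. -/
def MemLinf (Ω : Set (ℝ × ℝ)) (h : ℝ × ℝ → ℝ) : Prop := MemLp h ⊤ (volume.restrict Ω)

/-- `h ∈ L^∞_loc(Ω)`. -/
def MemLinfLoc (Ω : Set (ℝ × ℝ)) (h : ℝ × ℝ → ℝ) : Prop :=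
  ∀ C : Set (ℝ × ℝ), IsCompact C → C ⊆ Ω → MemLinf C h

/-- `H - ln|·| / h''(0)` is bounded in a (punctured) neighborhood of `0`, where `H = F` for `h = f`
and `H = G` for `h = g`. -/
def LogBounded (α : ℝ) (h : ℝ → ℝ) : Prop :=
  ∃ C : ℝ, ∀ᶠ x in 𝓝[≠] (0 : ℝ), |timePrimitive α h x - Real.log |x| / der2 α h 0| ≤ C

end

open Set Filter Topology MeasureTheory
open scoped ContDiff

noncomputable section

/-! Write `g = -k`. Then `f` and `k` are of the same kind: each vanishes to first order at `0`, has
positive second derivative there and no other critical point. The gradient system decouples into `x'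
= f'(x)`, `y' = -k'(y)`. With `F` and `K` the time primitives of `f` and `k` (so `G = -K`), `F(x)`
grows at unit speed along a trajectory and `K(y)` decreases at unit speed. Hence `F + K` is a first
integral, and the trajectories are explicit through the inverse branches of `F` and `K`.

In an open quadrant `u = f - k` and `F + K` are local `C¹` coordinates that separate points, since
their gradients are orthogonal and nonzero. The region `Q` is the set where the level curve of `F +
K` through the point carries both signs of `u`. It therefore meets `{u = 0}` in exactly one point,
which is a `C¹` function of the starting point (`exists_isHitPoint`, `contDiffAt_hitPoint`). Since
`ln |f'(x)|` and `ln |k'(y)|` have derivatives `f''(x)` and `-k''(y)` along the flow, `w` is the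
difference of `ln |f' k'|` between the hitting point and the starting point. So `∇w · ∇u = -Δu` off
the axes, that is, `div (e^w ∇u) = 0` there.

For (ii), the logarithmic bounds give `ln |f'| = f''(0) F + O(1)` and the same for `k`. When the two
rates agree, conservation of `F + K` makes `w` bounded (`exists_abs_hitWeight_le`). The weak
equation for `e^w` crosses the axes by means of cutoffs in `x` and `y`: their derivatives blow up
like `1/|x|`, `1/|y|`, which is compensated by `|f'(x)| ≤ M |x|`, `|k'(y)| ≤ M' |y|`
(`exists_isRealizableWith`).

For (i) and (iii), a `C¹` conductivity makes `σ f' k'` constant along trajectories. Compare a point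
`(ε, r₀)` with the point `(r₀, δ)` on the same trajectory in the positive quadrant: bounds on `σ`
and `1/σ` force `ln ε - ln δ` to stay bounded (`timeComparable_of_conductivity`). This is impossible
if `f''(0) ≠ k''(0)`, because `F` and `K` then have different logarithmic rates
(`der2_le_of_timeComparable`). It is also impossible for `k = y²/2` and `f' = x (1 - 1/(2 + ln
(α/|x|)))`, where the rates agree but `F` differs from `ln x` by an unbounded iterated logarithm
(`not_timeComparable_slowProfile`). -/

/-- A `C²` function on `[-α, α]` vanishing to first order at `0`, with positive second derivative at
`0` and no other critical point. -/
structure IsProfile (α : ℝ) (h : ℝ → ℝ) : Prop where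
  contDiffOn : ContDiffOn ℝ 2 h (Icc (-α) α)
  zero : h 0 = 0
  der_zero : der1 α h 0 = 0
  der2_pos : 0 < der2 α h 0
  right : ∀ x ∈ Ioc 0 α, 0 < der1 α h x
  left : ∀ x ∈ Ico (-α) 0, der1 α h x < 0

/-! ### Effect of the symmetries `h ↦ -h` and `x ↦ -x` -/

lemma der1_neg (α : ℝ) (h : ℝ → ℝ) (x : ℝ) : der1 α (fun t => -h t) x = -der1 α h x := by
  simp only [der1]
  rw [derivWithin.fun_neg]

lemma der2_neg (α : ℝ) (h : ℝ → ℝ) (x : ℝ) : der2 α (fun t => -h t) x = -der2 α h x := by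
  have : der1 α (fun t => -h t) = fun t => -der1 α h t := funext (der1_neg α h)
  simp only [der2, this]
  rw [derivWithin.fun_neg]

lemma der1_comp_neg (α : ℝ) (h : ℝ → ℝ) (x : ℝ) : der1 α (fun t => h (-t)) x = -der1 α h (-x) := by
  simp only [der1]
  rw [derivWithin_comp_neg]
  simp

lemma der2_comp_neg (α : ℝ) (h : ℝ → ℝ) (x : ℝ) : der2 α (fun t => h (-t)) x = der2 α h (-x) := by
  have : der1 α (fun t => h (-t)) = fun t => -der1 α h (-t) := funext (der1_comp_neg α h)
  simp only [der2, this]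
  rw [derivWithin.fun_neg, derivWithin_comp_neg]
  simp

lemma timePrimitive_neg (α : ℝ) (h : ℝ → ℝ) (x : ℝ) :
    timePrimitive α (fun t => -h t) x = -timePrimitive α h x := by
  simp only [timePrimitive, der1_neg, one_div, inv_neg, intervalIntegral.integral_neg]
  split_ifs <;> rfl

/-- Reflection exchanges the base points `α` and `-α`. At `x = 0` the definition selects the left
base point on both sides, so the swap fails there. -/
lemma timePrimitive_comp_neg (α : ℝ) (h : ℝ → ℝ) {x : ℝ} (hx : x ≠ 0) :
    timePrimitive α (fun t => h (-t)) x = timePrimitive α h (-x) := by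
  simp only [timePrimitive, der1_comp_neg, one_div, inv_neg, intervalIntegral.integral_neg]
  rw [intervalIntegral.integral_comp_neg (fun t => (der1 α h t)⁻¹),
    intervalIntegral.integral_comp_neg (fun t => (der1 α h t)⁻¹)]
  rcases lt_or_gt_of_ne hx with h1 | h1
  · rw [if_neg (by linarith), if_pos (by linarith), intervalIntegral.integral_symm]
    simp [intervalIntegral.integral_symm (-x) α]
  · rw [if_pos (by linarith), if_neg (by linarith)]
    rw [← intervalIntegral.integral_symm]

/-! ### One profile: comparison of `h'` with `x`, the time primitive and its range -/

namespace IsProfile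

variable {α : ℝ} {h : ℝ → ℝ}

lemma comp_neg (P : IsProfile α h) : IsProfile α (fun t => h (-t)) where
  contDiffOn := by
    refine P.contDiffOn.comp contDiff_neg.contDiffOn ?_
    intro x hx
    simp only [mem_Icc] at hx ⊢
    constructor <;> linarith [hx.1, hx.2]
  zero := by simpa using P.zero
  der_zero := by simpa [der1_comp_neg] using P.der_zero
  der2_pos := by simpa [der2_comp_neg] using P.der2_pos
  right := by
    intro x hx
    rw [der1_comp_neg]
    have := P.left (-x) ⟨by linarith [hx.2], by linarith [hx.1]⟩
    linarith
  left := by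
    intro x hx
    rw [der1_comp_neg]
    have := P.right (-x) ⟨by linarith [hx.2], by linarith [hx.1]⟩
    linarith

lemma contDiffOn_der1 (hα : 0 < α) (P : IsProfile α h) :
    ContDiffOn ℝ 1 (der1 α h) (Icc (-α) α) :=
  P.contDiffOn.derivWithin (uniqueDiffOn_Icc (by linarith)) (by norm_num)

lemma continuousOn_der2 (hα : 0 < α) (P : IsProfile α h) :
    ContinuousOn (der2 α h) (Icc (-α) α) :=
  (P.contDiffOn_der1 hα).continuousOn_derivWithin (uniqueDiffOn_Icc (by linarith)) le_rfl

lemma hasDerivAt (P : IsProfile α h) {x : ℝ} (hx : x ∈ Ioo (-α) α) :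
    HasDerivAt h (der1 α h x) x :=
  ((P.contDiffOn.differentiableOn (by norm_num) x (Ioo_subset_Icc_self hx)).hasDerivWithinAt).hasDerivAt
    (Icc_mem_nhds hx.1 hx.2)

lemma hasDerivAt_der1 (hα : 0 < α) (P : IsProfile α h) {x : ℝ} (hx : x ∈ Ioo (-α) α) :
    HasDerivAt (der1 α h) (der2 α h x) x :=
  (((P.contDiffOn_der1 hα).differentiableOn (by norm_num) x
    (Ioo_subset_Icc_self hx)).hasDerivWithinAt).hasDerivAt (Icc_mem_nhds hx.1 hx.2)

lemma contDiffAt_der1 (hα : 0 < α) (P : IsProfile α h) {x : ℝ} (hx : x ∈ Ioo (-α) α) :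
    ContDiffAt ℝ 1 (der1 α h) x :=
  (P.contDiffOn_der1 hα).contDiffAt (Icc_mem_nhds hx.1 hx.2)

lemma der1_mul_pos (P : IsProfile α h) {x : ℝ} (hx : x ∈ Icc (-α) α) (h0 : x ≠ 0) :
    0 < der1 α h x * x := by
  rcases lt_or_gt_of_ne h0 with h1 | h1
  · exact mul_pos_of_neg_of_neg (P.left x ⟨hx.1, h1⟩) h1
  · exact mul_pos (P.right x ⟨h1, hx.2⟩) h1

lemma der1_ne_zero (P : IsProfile α h) {x : ℝ} (hx : x ∈ Icc (-α) α) (h0 : x ≠ 0) :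
    der1 α h x ≠ 0 := fun h1 => by
  have := P.der1_mul_pos hx h0
  simp [h1] at this

/-- The derivative of a profile is comparable to the distance to the origin. -/
lemma exists_der1_bounds (hα : 0 < α) (P : IsProfile α h) :
    ∃ m M : ℝ, 0 < m ∧ 0 < M ∧ ∀ x ∈ Icc (-α) α, m * |x| ≤ |der1 α h x| ∧ |der1 α h x| ≤ M * |x| := by
  have h0 : (0 : ℝ) ∈ Ioo (-α) α := ⟨by linarith, hα⟩
  -- `dslope` extends `h'(x)/x` by `h''(0)` at `0`. It is continuous and positive on the compact
  -- interval, so its extrema serve as `m` and `M`.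
  have hq : ContinuousOn (dslope (der1 α h) 0) (Icc (-α) α) :=
    (continuousOn_dslope (Icc_mem_nhds h0.1 h0.2)).2
      ⟨(P.contDiffOn_der1 hα).continuousOn, (P.hasDerivAt_der1 hα h0).differentiableAt⟩
  have hqx : ∀ x, x ≠ 0 → dslope (der1 α h) 0 x = der1 α h x / x := by
    intro x hx
    rw [dslope_of_ne _ hx, slope_def_field, P.der_zero]
    simp
  have hpos : ∀ x ∈ Icc (-α) α, 0 < dslope (der1 α h) 0 x := by
    intro x hx
    by_cases hx0 : x = 0
    · rw [hx0, dslope_same, (P.hasDerivAt_der1 hα h0).deriv]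
      exact P.der2_pos
    · rw [hqx x hx0]
      have := P.der1_mul_pos hx hx0
      have h2 : der1 α h x / x = der1 α h x * x / (x * x) := by field_simp
      rw [h2]
      exact div_pos this (mul_self_pos.2 hx0)
  have hne : (Icc (-α) α).Nonempty := ⟨0, Ioo_subset_Icc_self h0⟩
  obtain ⟨a, ha, hmin⟩ := isCompact_Icc.exists_isMinOn hne hq
  obtain ⟨b, hb, hmax⟩ := isCompact_Icc.exists_isMaxOn hne hq
  refine ⟨_, _, hpos a ha, hpos b hb, ?_⟩
  intro x hx
  by_cases hx0 : x = 0
  · simp [hx0, P.der_zero]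
  · have e : |der1 α h x| = dslope (der1 α h) 0 x * |x| := by
      rw [← abs_of_pos (hpos x hx), ← abs_mul, hqx x hx0, div_mul_cancel₀ _ hx0]
    rw [e]
    exact ⟨mul_le_mul_of_nonneg_right (hmin hx) (abs_nonneg x),
      mul_le_mul_of_nonneg_right (hmax hx) (abs_nonneg x)⟩

lemma hasDerivAt_timePrimitive_of_pos (hα : 0 < α) (P : IsProfile α h) {x : ℝ} (hx : x ∈ Ioo 0 α) :
    HasDerivAt (timePrimitive α h) (1 / der1 α h x) x := by
  have hc : ContinuousOn (fun t => 1 / der1 α h t) (Ioc 0 α) := by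
    refine continuousOn_const.div ((P.contDiffOn_der1 hα).continuousOn.mono ?_) ?_
    · intro t ht
      exact ⟨by linarith [ht.1], ht.2⟩
    · intro t ht
      exact (P.right t ht).ne'
  have hca : ContinuousAt (fun t => 1 / der1 α h t) x := hc.continuousAt (Ioc_mem_nhds hx.1 hx.2)
  have h1 : HasDerivAt (fun u => ∫ t in α..u, 1 / der1 α h t) (1 / der1 α h x) x := by
    refine intervalIntegral.integral_hasDerivAt_right ?_ ?_ hca
    · refine (hc.mono ?_).intervalIntegrable
      rw [uIcc_of_ge hx.2.le]
      intro t ht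
      exact ⟨by linarith [ht.1, hx.1], ht.2⟩
    · exact (hc.mono Ioo_subset_Ioc_self).stronglyMeasurableAtFilter isOpen_Ioo x hx
  refine h1.congr_of_eventuallyEq ?_
  filter_upwards [lt_mem_nhds hx.1] with t ht
  simp [timePrimitive, ht]

lemma hasDerivAt_timePrimitive (hα : 0 < α) (P : IsProfile α h) {x : ℝ} (hx : x ∈ Ioo (-α) α)
    (h0 : x ≠ 0) : HasDerivAt (timePrimitive α h) (1 / der1 α h x) x := by
  rcases lt_or_gt_of_ne h0 with h1 | h1
  · have h2 := P.comp_neg.hasDerivAt_timePrimitive_of_pos hα (x := -x)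
      ⟨by linarith, by linarith [hx.1]⟩
    rw [der1_comp_neg, neg_neg] at h2
    have h3 := h2.comp x (hasDerivAt_neg x)
    have h4 : 1 / -der1 α h x * -1 = 1 / der1 α h x := by
      rw [div_neg]; ring
    rw [h4] at h3
    refine h3.congr_of_eventuallyEq ?_
    filter_upwards [gt_mem_nhds h1] with t ht
    simp only [Function.comp]
    rw [timePrimitive_comp_neg α h (by linarith : (-t) ≠ 0), neg_neg]
  · exact P.hasDerivAt_timePrimitive_of_pos hα ⟨h1, hx.2⟩

lemma continuousOn_timePrimitive_of_pos (hα : 0 < α) (P : IsProfile α h) :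
    ContinuousOn (timePrimitive α h) (Ioc 0 α) := by
  intro x hx
  have hc : ContinuousOn (fun t => 1 / der1 α h t) (Icc (x / 2) α) := by
    refine continuousOn_const.div ((P.contDiffOn_der1 hα).continuousOn.mono ?_) ?_
    · intro t ht
      exact ⟨by linarith [ht.1, hx.1], ht.2⟩
    · intro t ht
      exact (P.right t ⟨by linarith [ht.1, hx.1], ht.2⟩).ne'
  have hx2 : x / 2 ≤ α := by linarith [hx.1, hx.2]
  have hi : IntegrableOn (fun t => 1 / der1 α h t) (uIcc (x / 2) α) := by
    rw [uIcc_of_le hx2]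
    exact hc.integrableOn_Icc
  have h1 : ContinuousOn (fun u => ∫ t in α..u, 1 / der1 α h t) (uIcc (x / 2) α) :=
    intervalIntegral.continuousOn_primitive_interval' hi.intervalIntegrable right_mem_uIcc
  rw [uIcc_of_le hx2] at h1
  have h2 := h1 x ⟨by linarith [hx.1], hx.2⟩
  have h3 : ContinuousWithinAt (fun u => ∫ t in α..u, 1 / der1 α h t) (Ioc 0 α) x := by
    refine h2.mono_of_mem_nhdsWithin ?_
    have : Ioi (x / 2) ∈ 𝓝 x := Ioi_mem_nhds (by linarith [hx.1])
    filter_upwards [mem_nhdsWithin_of_mem_nhds this, self_mem_nhdsWithin] with t ht ht'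
    exact ⟨le_of_lt ht, ht'.2⟩
  refine h3.congr (fun t ht => by simp [timePrimitive, ht.1]) (by simp [timePrimitive, hx.1])

lemma strictMonoOn_timePrimitive (hα : 0 < α) (P : IsProfile α h) :
    StrictMonoOn (timePrimitive α h) (Ioc 0 α) := by
  refine strictMonoOn_of_deriv_pos (convex_Ioc 0 α) (P.continuousOn_timePrimitive_of_pos hα) ?_
  intro x hx
  rw [interior_Ioc] at hx
  rw [(P.hasDerivAt_timePrimitive_of_pos hα hx).deriv]
  exact one_div_pos.2 (P.right x ⟨hx.1, hx.2.le⟩)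

lemma strictMonoOn (hα : 0 < α) (P : IsProfile α h) : StrictMonoOn h (Icc 0 α) := by
  refine strictMonoOn_of_deriv_pos (convex_Icc 0 α)
    (P.contDiffOn.continuousOn.mono (Icc_subset_Icc (by linarith) le_rfl)) ?_
  intro x hx
  rw [interior_Icc] at hx
  rw [(P.hasDerivAt ⟨by linarith [hx.1], hx.2⟩).deriv]
  exact P.right x ⟨hx.1, hx.2.le⟩

lemma timePrimitive_end (α : ℝ) (h : ℝ → ℝ) (hα : 0 < α) : timePrimitive α h α = 0 := by
  simp [timePrimitive, hα]

/-- Near the origin the time primitive lies below a multiple of the logarithm. -/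
lemma exists_timePrimitive_le (hα : 0 < α) (P : IsProfile α h) :
    ∃ M : ℝ, 0 < M ∧ ∀ x ∈ Ioc 0 α, timePrimitive α h x ≤ (Real.log x - Real.log α) / M := by
  obtain ⟨m, M, hm, hM, hb⟩ := P.exists_der1_bounds hα
  refine ⟨M, hM, ?_⟩
  -- Since `1/h'(x) ≥ 1/(M x)`, the difference with `ln x / M` increases up to its value at `α`.
  have hmono : MonotoneOn (fun x => timePrimitive α h x - Real.log x / M) (Ioc 0 α) := by
    refine monotoneOn_of_deriv_nonneg (convex_Ioc 0 α) ?_ ?_ ?_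
    · exact (P.continuousOn_timePrimitive_of_pos hα).sub
        ((Real.continuousOn_log.mono (fun x hx => hx.1.ne')).div_const _)
    · intro x hx
      rw [interior_Ioc] at hx
      exact ((P.hasDerivAt_timePrimitive_of_pos hα hx).sub
        ((Real.hasDerivAt_log hx.1.ne').div_const M)).differentiableAt.differentiableWithinAt
    · intro x hx
      rw [interior_Ioc] at hx
      have e := ((P.hasDerivAt_timePrimitive_of_pos hα hx).sub
        ((Real.hasDerivAt_log hx.1.ne').div_const M)).deriv
      rw [show deriv (fun x => timePrimitive α h x - Real.log x / M) x = _ from e]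
      have hr := P.right x ⟨hx.1, hx.2.le⟩
      have h2 := (hb x ⟨by linarith [hx.1], hx.2.le⟩).2
      rw [abs_of_pos hr, abs_of_pos hx.1] at h2
      have : x⁻¹ / M = 1 / (M * x) := by field_simp
      rw [this, sub_nonneg]
      exact one_div_le_one_div_of_le hr h2
  intro x hx
  have := hmono hx ⟨hα, le_rfl⟩ hx.2
  simp only [timePrimitive_end α h hα] at this
  rw [sub_div]
  linarith

/-- For two nonzero points of the same sign, `F` and `h` induce the same ordering. -/
lemma timePrimitive_lt_iff (hα : 0 < α) (P : IsProfile α h) {x y : ℝ} (hx : x ∈ Icc (-α) α)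
    (hy : y ∈ Icc (-α) α) (hxy : 0 < x * y) :
    timePrimitive α h x < timePrimitive α h y ↔ h x < h y := by
  have key : ∀ {h : ℝ → ℝ}, IsProfile α h → ∀ {x y : ℝ}, 0 < x → 0 < y → x ≤ α → y ≤ α →
      (timePrimitive α h x < timePrimitive α h y ↔ h x < h y) := by
    intro h P x y hx hy hx' hy'
    rw [(P.strictMonoOn_timePrimitive hα).lt_iff_lt ⟨hx, hx'⟩ ⟨hy, hy'⟩,
      (P.strictMonoOn hα).lt_iff_lt ⟨hx.le, hx'⟩ ⟨hy.le, hy'⟩]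
  -- On the right both functions increase; the left half, where both decrease, follows by
  -- reflection.
  rcases pos_and_pos_or_neg_and_neg_of_mul_pos hxy with ⟨h1, h2⟩ | ⟨h1, h2⟩
  · exact key P h1 h2 hx.2 hy.2
  · have := key P.comp_neg (x := -x) (y := -y) (by linarith) (by linarith) (by linarith [hx.1])
      (by linarith [hy.1])
    rw [timePrimitive_comp_neg _ _ (by linarith : (-x) ≠ 0),
      timePrimitive_comp_neg _ _ (by linarith : (-y) ≠ 0)] at this
    simpa using this

lemma injOn_of_mul_pos (hα : 0 < α) (P : IsProfile α h) {x y : ℝ} (hx : x ∈ Icc (-α) α)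
    (hy : y ∈ Icc (-α) α) (hxy : 0 < x * y) (e : h x = h y) : x = y := by
  rcases pos_and_pos_or_neg_and_neg_of_mul_pos hxy with ⟨h1, h2⟩ | ⟨h1, h2⟩
  · exact (P.strictMonoOn hα).injOn ⟨h1.le, hx.2⟩ ⟨h2.le, hy.2⟩ e
  · have := (P.comp_neg.strictMonoOn hα).injOn (x₁ := -x) (x₂ := -y)
      ⟨by linarith, by linarith [hx.1]⟩ ⟨by linarith, by linarith [hy.1]⟩ (by simpa using e)
    linarith

lemma timePrimitive_eq_iff (hα : 0 < α) (P : IsProfile α h) {x y : ℝ} (hx : x ∈ Icc (-α) α)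
    (hy : y ∈ Icc (-α) α) (hxy : 0 < x * y) :
    timePrimitive α h x = timePrimitive α h y ↔ x = y := by
  refine ⟨fun e => P.injOn_of_mul_pos hα hx hy hxy ?_, fun e => by rw [e]⟩
  have h1 := P.timePrimitive_lt_iff hα hx hy hxy
  have h2 := P.timePrimitive_lt_iff hα hy hx (by linarith [mul_comm x y])
  rw [e] at h1 h2
  exact le_antisymm (not_lt.1 fun h3 => lt_irrefl _ (h2.2 h3))
    (not_lt.1 fun h3 => lt_irrefl _ (h1.2 h3))

lemma pos (hα : 0 < α) (P : IsProfile α h) {x : ℝ} (hx : x ∈ Icc (-α) α) (h0 : x ≠ 0) :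
    0 < h x := by
  rcases lt_or_gt_of_ne h0 with h1 | h1
  · have := P.comp_neg.strictMonoOn hα ⟨le_rfl, hα.le⟩ (b := -x)
      ⟨by linarith, by linarith [hx.1]⟩ (by linarith)
    simpa [P.zero] using this
  · have := P.strictMonoOn hα ⟨le_rfl, hα.le⟩ (b := x) ⟨h1.le, hx.2⟩ h1
    simpa [P.zero] using this

lemma timePrimitive_sideEnd (α : ℝ) (h : ℝ → ℝ) (hα : 0 < α) (x : ℝ) :
    timePrimitive α h (sideEnd α x) = 0 := by
  unfold sideEnd
  split_ifs
  · exact timePrimitive_end α h hα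
  · simp [timePrimitive, not_lt.2 hα.le]

lemma timePrimitive_neg_of_mem (hα : 0 < α) (P : IsProfile α h) {x : ℝ} (hx : x ∈ Ioo (-α) α)
    (h0 : x ≠ 0) : timePrimitive α h x < 0 := by
  have key : ∀ {h : ℝ → ℝ}, IsProfile α h → ∀ {x : ℝ}, 0 < x → x < α → timePrimitive α h x < 0 := by
    intro h P x hx hx'
    have := P.strictMonoOn_timePrimitive hα ⟨hx, hx'.le⟩ ⟨hα, le_rfl⟩ hx'
    rwa [timePrimitive_end α h hα] at this
  rcases lt_or_gt_of_ne h0 with h1 | h1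
  · have := key P.comp_neg (x := -x) (by linarith) (by linarith [hx.1])
    rwa [timePrimitive_comp_neg _ _ (by linarith : (-x) ≠ 0), neg_neg] at this
  · exact key P h1 hx.2

lemma timePrimitive_nonpos (hα : 0 < α) (P : IsProfile α h) {x : ℝ} (hx : x ∈ Icc (-α) α)
    (h0 : x ≠ 0) : timePrimitive α h x ≤ 0 := by
  by_cases h1 : x ∈ Ioo (-α) α
  · exact (P.timePrimitive_neg_of_mem hα h1 h0).le
  · have : x = sideEnd α x := by
      unfold sideEnd
      simp only [mem_Ioo, not_and_or, not_lt] at h1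
      rcases h1 with h1 | h1
      · rw [if_neg (by linarith)]; linarith [hx.1]
      · rw [if_pos (by linarith)]; linarith [hx.2]
    rw [this, timePrimitive_sideEnd α h hα]

/-- The time primitive tends to `-∞` at the origin. -/
lemma exists_timePrimitive_lt (hα : 0 < α) (P : IsProfile α h) (N : ℝ) :
    ∃ δ, 0 < δ ∧ ∀ x, x ≠ 0 → |x| < δ → timePrimitive α h x < N := by
  have key : ∀ {h : ℝ → ℝ}, IsProfile α h → ∃ δ, 0 < δ ∧ δ ≤ α ∧ ∀ x, 0 < x → x < δ →
      timePrimitive α h x < N := by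
    intro h P
    obtain ⟨M, hM, hb⟩ := P.exists_timePrimitive_le hα
    refine ⟨min α (Real.exp (M * N + Real.log α)), lt_min hα (Real.exp_pos _), min_le_left _ _, ?_⟩
    intro x hx hx'
    refine (hb x ⟨hx, (hx'.trans_le (min_le_left _ _)).le⟩).trans_lt ?_
    rw [div_lt_iff₀ hM]
    have := (Real.lt_log_iff_exp_lt (Real.exp_pos _)).2 (Real.exp_lt_exp.2
      ((Real.log_lt_iff_lt_exp hx).2 (hx'.trans_le (min_le_right _ _))))
    simp only [Real.log_exp] at this
    linarith
  obtain ⟨δ, hδ, hδα, h1⟩ := key P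
  obtain ⟨δ', hδ', hδα', h2⟩ := key P.comp_neg
  refine ⟨min δ δ', lt_min hδ hδ', fun x hx0 hx => ?_⟩
  rcases lt_or_gt_of_ne hx0 with h3 | h3
  · rw [abs_of_neg h3] at hx
    have := h2 (-x) (by linarith) (hx.trans_le (min_le_right _ _))
    rwa [timePrimitive_comp_neg _ _ (by linarith : (-x) ≠ 0), neg_neg] at this
  · rw [abs_of_pos h3] at hx
    exact h1 x h3 (hx.trans_le (min_le_left _ _))

lemma mem_sideInterval_iff {α x z : ℝ} (hx : x ≠ 0) :
    z ∈ sideInterval α x ↔ z ∈ Icc (-α) α ∧ 0 < z * x := by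
  unfold sideInterval
  rcases lt_or_gt_of_ne hx with h1 | h1
  · rw [if_neg (by linarith)]
    constructor
    · intro hz
      exact ⟨⟨hz.1, by linarith [hz.1, hz.2]⟩, mul_pos_of_neg_of_neg hz.2 h1⟩
    · rintro ⟨hz, h2⟩
      exact ⟨hz.1, by nlinarith⟩
  · rw [if_pos h1]
    constructor
    · intro hz
      exact ⟨⟨by linarith [hz.1, hz.2], hz.2⟩, mul_pos hz.1 h1⟩
    · rintro ⟨hz, h2⟩
      exact ⟨pos_of_mul_pos_left h2 h1.le, hz.2⟩

/-- The time primitive is continuous on each side, vanishes at the end point and tends to `-∞` at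
the origin, so the intermediate value theorem applies. -/
lemma surjOn_timePrimitive (hα : 0 < α) (P : IsProfile α h) {x : ℝ} (hx : x ≠ 0) :
    SurjOn (timePrimitive α h) (sideInterval α x) (Iic 0) := by
  have key : ∀ {h : ℝ → ℝ}, IsProfile α h → ∀ s ≤ 0, ∃ z ∈ Ioc 0 α, timePrimitive α h z = s := by
    intro h P s hs
    obtain ⟨δ, hδ, hb⟩ := P.exists_timePrimitive_lt hα s
    have hz0 : 0 < min α (δ / 2) := lt_min hα (by linarith)
    have h1 := hb (min α (δ / 2)) hz0.ne' (by
      rw [abs_of_pos hz0]; exact (min_le_right _ _).trans_lt (by linarith))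
    have h2 := intermediate_value_Icc (min_le_left α (δ / 2))
      ((P.continuousOn_timePrimitive_of_pos hα).mono (fun t ht => ⟨hz0.trans_le ht.1, ht.2⟩))
    rw [timePrimitive_end α h hα] at h2
    obtain ⟨z, hz, e⟩ := h2 ⟨h1.le, hs⟩
    exact ⟨z, ⟨hz0.trans_le hz.1, hz.2⟩, e⟩
  intro s hs
  rcases lt_or_gt_of_ne hx with h1 | h1
  · obtain ⟨z, hz, e⟩ := key P.comp_neg s hs
    rw [timePrimitive_comp_neg _ _ hz.1.ne'] at e
    refine ⟨-z, ?_, e⟩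
    unfold sideInterval
    rw [if_neg (by linarith)]
    exact ⟨by linarith [hz.2], by linarith [hz.1]⟩
  · obtain ⟨z, hz, e⟩ := key P s hs
    refine ⟨z, ?_, e⟩
    unfold sideInterval
    rwa [if_pos h1]

lemma sideInverse_spec (hα : 0 < α) (P : IsProfile α h) {x s : ℝ} (hx : x ≠ 0) (hs : s ≤ 0) :
    sideInverse α h x s ∈ Icc (-α) α ∧ 0 < sideInverse α h x s * x ∧
      timePrimitive α h (sideInverse α h x s) = s := by
  have h1 : s ∈ timePrimitive α h '' sideInterval α x := P.surjOn_timePrimitive hα hx hs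
  have h2 := Function.invFunOn_mem h1
  have h3 := Function.invFunOn_eq h1
  rw [mem_sideInterval_iff hx] at h2
  exact ⟨h2.1, h2.2, h3⟩

/-- The primitive for `-h` is the opposite of the one for `h`. As `invFunOn` is a choice of
preimage, injectivity on the side interval is what identifies the two choices. -/
lemma sideInverse_neg_apply (hα : 0 < α) (P : IsProfile α h) {x s : ℝ} (hx : x ≠ 0) (hs : s ≤ 0) :
    sideInverse α (fun t => -h t) x (-s) = sideInverse α h x s := by
  obtain ⟨h1, h2, h3⟩ := P.sideInverse_spec hα hx hs
  have h4 : -s ∈ timePrimitive α (fun t => -h t) '' sideInterval α x := by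
    refine ⟨_, (mem_sideInterval_iff hx).2 ⟨h1, h2⟩, ?_⟩
    rw [timePrimitive_neg, h3]
  have h5 := Function.invFunOn_mem h4
  have h6 := Function.invFunOn_eq h4
  rw [timePrimitive_neg, neg_inj] at h6
  rw [mem_sideInterval_iff hx] at h5
  refine (P.timePrimitive_eq_iff hα h5.1 h1 ?_).1 (h6.trans h3.symm)
  have := mul_pos h5.2 h2
  have hx2 : 0 < x * x := mul_self_pos.2 hx
  unfold sideInverse at this ⊢
  refine pos_of_mul_pos_left (b := x * x) ?_ hx2.le
  linarith

end IsProfile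

/-! ### Regularity of the time primitive and of its inverse branches -/

/-- A map `e` with `f ∘ e = c` near `p` is as smooth as `f` and `c`, if `f` is injective near `e p`
with invertible derivative there. -/
lemma contDiffAt_of_comp_eventuallyEq {E F G : Type*} [NormedAddCommGroup E] [NormedSpace ℝ E]
    [CompleteSpace E] [NormedAddCommGroup F] [NormedSpace ℝ F] [NormedAddCommGroup G]
    [NormedSpace ℝ G] {n : ℕ∞ω} {f : E → F} {f' : E ≃L[ℝ] F} {e : G → E} {c : G → F} {p : G}
    {s : Set E} (hf : ContDiffAt ℝ n f (e p)) (hf' : HasFDerivAt f (f' : E →L[ℝ] F) (e p))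
    (hn : n ≠ 0) (hc : ContDiffAt ℝ n c p) (hs : s ∈ 𝓝 (e p)) (hinj : InjOn f s)
    (he : ∀ᶠ q in 𝓝 p, e q ∈ s ∧ f (e q) = c q) : ContDiffAt ℝ n e p := by
  have hp : f (e p) = c p := he.self_of_nhds.2
  have hst := hf.hasStrictFDerivAt' hf' hn
  have h1 : ContDiffAt ℝ n (hf.localInverse hf' hn) (c p) := hp ▸ hf.to_localInverse hf' hn
  have h2 : ContDiffAt ℝ n (fun q => hf.localInverse hf' hn (c q)) p := h1.comp p hc
  have ht : Tendsto c (𝓝 p) (𝓝 (f (e p))) := hp ▸ hc.continuousAt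
  -- Continuity of `e` is not assumed: near `p`, `e` and the local inverse applied to `c` both solve
  -- `f = c` in `s`, where `f` is injective, so they coincide.
  have h3 : ∀ᶠ q in 𝓝 p, f (hf.localInverse hf' hn (c q)) = c q :=
    ht.eventually hst.eventually_right_inverse
  have h4 : ∀ᶠ q in 𝓝 p, hf.localInverse hf' hn (c q) ∈ s :=
    ht.eventually (hst.localInverse_tendsto hs)
  refine h2.congr_of_eventuallyEq ?_
  filter_upwards [h3, h4, he] with q q3 q4 q5
  exact hinj q5.1 q4 (q5.2.trans q3.symm)

lemma mul_pos_of_mul_pos_of_mul_pos {a b x : ℝ} (ha : 0 < a * x) (hb : 0 < b * x) : 0 < a * b := by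
  have h1 : 0 < (a * b) * (x * x) := by nlinarith [mul_pos ha hb]
  exact pos_of_mul_pos_left h1 (mul_self_nonneg x)

lemma ne_zero_of_mul_pos_left {a x : ℝ} (h : 0 < a * x) : a ≠ 0 := by
  rintro rfl
  simp at h

lemma mem_interior_squareK {α : ℝ} {p : ℝ × ℝ} :
    p ∈ interior (squareK α) ↔ p.1 ∈ Ioo (-α) α ∧ p.2 ∈ Ioo (-α) α := by
  rw [squareK, interior_prod_eq, interior_Icc, mem_prod]

lemma sideEnd_congr {α x y : ℝ} (h : 0 < x * y) : sideEnd α x = sideEnd α y := by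
  unfold sideEnd
  rcases pos_and_pos_or_neg_and_neg_of_mul_pos h with ⟨h1, h2⟩ | ⟨h1, h2⟩
  · rw [if_pos h1, if_pos h2]
  · rw [if_neg (by linarith), if_neg (by linarith)]

lemma sideEnd_mem {α : ℝ} (hα : 0 < α) (x : ℝ) : sideEnd α x ∈ Icc (-α) α := by
  unfold sideEnd
  split_ifs <;> constructor <;> linarith

lemma sideEnd_mul_pos {α x : ℝ} (hα : 0 < α) (hx : x ≠ 0) : 0 < sideEnd α x * x := by
  unfold sideEnd
  rcases lt_or_gt_of_ne hx with h1 | h1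
  · rw [if_neg (by linarith)]; exact mul_pos_of_neg_of_neg (by linarith) h1
  · rw [if_pos h1]; exact mul_pos hα h1

namespace IsProfile

variable {α : ℝ} {h : ℝ → ℝ}

lemma contDiffAt (P : IsProfile α h) {x : ℝ} (hx : x ∈ Ioo (-α) α) : ContDiffAt ℝ 2 h x :=
  P.contDiffOn.contDiffAt (Icc_mem_nhds hx.1 hx.2)

lemma contDiffAt_timePrimitive (hα : 0 < α) (P : IsProfile α h) {x : ℝ} (hx : x ∈ Ioo (-α) α)
    (h0 : x ≠ 0) : ContDiffAt ℝ 1 (timePrimitive α h) x := by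
  rw [contDiffAt_one_iff]
  refine ⟨fun t => (1 / der1 α h t) • (1 : ℝ →L[ℝ] ℝ), Ioo (-α) α ∩ {0}ᶜ,
    (isOpen_Ioo.inter isOpen_compl_singleton).mem_nhds ⟨hx, h0⟩, ?_, ?_⟩
  · refine ContinuousOn.smul (continuousOn_const.div ((P.contDiffOn_der1 hα).continuousOn.mono
      (inter_subset_left.trans Ioo_subset_Icc_self)) ?_) continuousOn_const
    intro t ht
    exact P.der1_ne_zero (Ioo_subset_Icc_self ht.1) ht.2
  · intro t ht
    exact (P.hasDerivAt_timePrimitive hα ht.1 ht.2).hasFDerivAt.congr_fderiv (by ext; simp)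

lemma sideInverse_mem_Ioo (hα : 0 < α) (P : IsProfile α h) {x s : ℝ} (hx : x ≠ 0) (hs : s < 0) :
    sideInverse α h x s ∈ Ioo (-α) α := by
  obtain ⟨h1, h2, h3⟩ := P.sideInverse_spec hα hx hs.le
  have hne : ∀ y, sideInverse α h x s ≠ sideEnd α y := by
    intro y e
    rw [e, timePrimitive_sideEnd α h hα] at h3
    linarith
  refine ⟨lt_of_le_of_ne h1.1 fun e => ?_, lt_of_le_of_ne h1.2 fun e => ?_⟩
  · exact hne (-1) (by rw [← e]; simp [sideEnd])
  · exact hne 1 (by rw [e]; simp [sideEnd])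

lemma sideInverse_ne_zero (hα : 0 < α) (P : IsProfile α h) {x s : ℝ} (hx : x ≠ 0) (hs : s ≤ 0) :
    sideInverse α h x s ≠ 0 :=
  ne_zero_of_mul_pos_left (P.sideInverse_spec hα hx hs).2.1

lemma sideInverse_timePrimitive (hα : 0 < α) (P : IsProfile α h) {x y : ℝ} (hy : y ∈ Icc (-α) α)
    (hxy : 0 < y * x) : sideInverse α h x (timePrimitive α h y) = y := by
  have hx : x ≠ 0 := ne_zero_of_mul_pos_left (by rwa [mul_comm])
  obtain ⟨h1, h2, h3⟩ := P.sideInverse_spec hα hx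
    (P.timePrimitive_nonpos hα hy (ne_zero_of_mul_pos_left hxy))
  exact (P.timePrimitive_eq_iff hα h1 hy (mul_pos_of_mul_pos_of_mul_pos h2 hxy)).1 h3

/-- Differentiating `F(F⁻¹(s)) = s` with `F' = 1/h'` shows that the inverse branch solves `z' =
h'(z)`: it is the trajectory itself. The condition `s < 0` keeps it away from the end points of the
interval. -/
lemma hasDerivAt_sideInverse (hα : 0 < α) (P : IsProfile α h) {x s : ℝ} (hx : x ≠ 0) (hs : s < 0) :
    HasDerivAt (sideInverse α h x) (der1 α h (sideInverse α h x s)) s := by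
  obtain ⟨h1, h2, h3⟩ := P.sideInverse_spec hα hx hs.le
  have hz := P.sideInverse_mem_Ioo hα hx hs
  have hz0 := P.sideInverse_ne_zero hα hx hs.le
  have hF := P.hasDerivAt_timePrimitive hα hz hz0
  have hr := P.der1_ne_zero h1 hz0
  have hd : ContDiffAt ℝ 1 (sideInverse α h x) s := by
    refine contDiffAt_of_comp_eventuallyEq (f := timePrimitive α h) (c := id)
      (f' := ContinuousLinearEquiv.unitsEquivAut ℝ (Units.mk0 _ (one_div_ne_zero hr)))
      (s := {z | z ∈ Ioo (-α) α ∧ 0 < z * x}) (P.contDiffAt_timePrimitive hα hz hz0) ?_ one_ne_zero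
      contDiffAt_id ?_ ?_ ?_
    · exact hF.hasFDerivAt_equiv _
    · exact (isOpen_Ioo.inter (isOpen_lt continuous_const
        (continuous_id.mul continuous_const))).mem_nhds ⟨hz, h2⟩
    · intro a ha b hb e
      exact (P.timePrimitive_eq_iff hα (Ioo_subset_Icc_self ha.1) (Ioo_subset_Icc_self hb.1)
        (mul_pos_of_mul_pos_of_mul_pos ha.2 hb.2)).1 e
    · filter_upwards [gt_mem_nhds hs] with t ht
      have := P.sideInverse_spec hα hx (le_of_lt ht)
      exact ⟨⟨P.sideInverse_mem_Ioo hα hx ht, this.2.1⟩, this.2.2⟩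
  have hd' := (hd.differentiableAt one_ne_zero).hasDerivAt
  have hcomp := hF.comp s hd'
  have hid : HasDerivAt (timePrimitive α h ∘ sideInverse α h x) 1 s := by
    refine (hasDerivAt_id s).congr_of_eventuallyEq ?_
    filter_upwards [gt_mem_nhds hs] with t ht
    exact (P.sideInverse_spec hα hx (le_of_lt ht)).2.2
  have e := hcomp.unique hid
  have : deriv (sideInverse α h x) s = der1 α h (sideInverse α h x s) := by
    field_simp at e
    exact e
  rwa [this] at hd'

end IsProfile

/-! ### The region `Q` is an open neighborhood of the origin -/

section Region

variable {α : ℝ} {f k : ℝ → ℝ}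

/-- With `G = -K`, the two arguments in the definition of `Q` are, up to sign, the single quantity
`F(x) + K(y)`, conserved by the flow. -/
lemma mem_regionQ_iff (hα : 0 < α) (Pf : IsProfile α f) (Pk : IsProfile α k) {p : ℝ × ℝ}
    (hp : p ∈ interior (squareK α)) (h1 : p.1 ≠ 0) (h2 : p.2 ≠ 0) :
    p ∈ regionQ α f (fun t => -k t) ↔
      k (sideInverse α k p.2 (timePrimitive α f p.1 + timePrimitive α k p.2))
          < f (sideEnd α p.1) ∧
        f (sideInverse α f p.1 (timePrimitive α f p.1 + timePrimitive α k p.2))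
          < k (sideEnd α p.2) := by
  rw [mem_interior_squareK] at hp
  have hd : timePrimitive α f p.1 + timePrimitive α k p.2 ≤ 0 :=
    add_nonpos (Pf.timePrimitive_neg_of_mem hα hp.1 h1).le
      (Pk.timePrimitive_neg_of_mem hα hp.2 h2).le
  have e1 : -timePrimitive α f p.1 + timePrimitive α (fun t => -k t) p.2
      = -(timePrimitive α f p.1 + timePrimitive α k p.2) := by
    rw [timePrimitive_neg]; ring
  have e2 : -timePrimitive α (fun t => -k t) p.2 + timePrimitive α f p.1
      = timePrimitive α f p.1 + timePrimitive α k p.2 := by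
    rw [timePrimitive_neg]; ring
  simp only [regionQ, mem_ofPred_eq, mem_interior_squareK, hp, h1, h2, e1, e2, true_and, false_or,
    Pk.sideInverse_neg_apply hα h2 hd]
  constructor <;> rintro ⟨h3, h4⟩ <;> constructor <;> linarith

/-- The description of the region by open conditions. -/
lemma mem_regionQ_iff_exists (hα : 0 < α) (Pf : IsProfile α f) (Pk : IsProfile α k) {p : ℝ × ℝ}
    (hp : p ∈ interior (squareK α)) (h1 : p.1 ≠ 0) (h2 : p.2 ≠ 0) :
    p ∈ regionQ α f (fun t => -k t) ↔ ∃ x ∈ Ioo (-α) α, ∃ y ∈ Ioo (-α) α, 0 < x * p.1 ∧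
      0 < y * p.2 ∧ k y < f (sideEnd α p.1) ∧ f x < k (sideEnd α p.2) ∧
      timePrimitive α f p.1 + timePrimitive α k p.2 < timePrimitive α k y ∧
      timePrimitive α f p.1 + timePrimitive α k p.2 < timePrimitive α f x := by
  rw [mem_regionQ_iff hα Pf Pk hp h1 h2]
  rw [mem_interior_squareK] at hp
  have hd : timePrimitive α f p.1 + timePrimitive α k p.2 < 0 :=
    add_neg (Pf.timePrimitive_neg_of_mem hα hp.1 h1) (Pk.timePrimitive_neg_of_mem hα hp.2 h2)
  set d := timePrimitive α f p.1 + timePrimitive α k p.2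
  -- By continuity the strict inequality survives at some `s` slightly above `d`, and the witness is
  -- the inverse branch at `s`. The converse is monotonicity.
  have key : ∀ {h : ℝ → ℝ}, IsProfile α h → ∀ {x c : ℝ}, x ≠ 0 →
      (h (sideInverse α h x d) < c ↔ ∃ z ∈ Ioo (-α) α, 0 < z * x ∧ h z < c ∧
        d < timePrimitive α h z) := by
    intro h P x c hx
    obtain ⟨i1, i2, i3⟩ := P.sideInverse_spec hα hx hd.le
    constructor
    · intro hc
      have hcont : ContinuousAt (fun s => h (sideInverse α h x s)) d :=
        ContinuousAt.comp (P.hasDerivAt (P.sideInverse_mem_Ioo hα hx hd)).continuousAt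
          (P.hasDerivAt_sideInverse hα hx hd).continuousAt
      have h3 : ∀ᶠ s in 𝓝[>] d, h (sideInverse α h x s) < c ∧ s < 0 := by
        refine mem_nhdsWithin_of_mem_nhds ?_
        filter_upwards [hcont.eventually (gt_mem_nhds hc), gt_mem_nhds hd] with s a b
        exact ⟨a, b⟩
      obtain ⟨s, ⟨hs, hs0⟩, hs'⟩ := (h3.and self_mem_nhdsWithin).exists
      obtain ⟨j1, j2, j3⟩ := P.sideInverse_spec hα hx hs0.le
      exact ⟨_, P.sideInverse_mem_Ioo hα hx hs0, j2, hs, by rw [j3]; exact hs'⟩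
    · rintro ⟨z, hz, hzx, hzc, hdz⟩
      refine lt_trans ?_ hzc
      rw [← P.timePrimitive_lt_iff hα i1 (Ioo_subset_Icc_self hz)
        (mul_pos_of_mul_pos_of_mul_pos i2 hzx), i3]
      exact hdz
  rw [key Pf h1, key Pk h2]
  constructor
  · rintro ⟨⟨y, hy, a, b, c⟩, x, hx, a', b', c'⟩
    exact ⟨x, hx, y, hy, a', a, b, b', c, c'⟩
  · rintro ⟨x, hx, y, hy, a', a, b, b', c, c'⟩
    exact ⟨⟨y, hy, a, b, c⟩, x, hx, a', b', c'⟩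

/-- The points off the axes with very negative `F(x) - G(y)` belong to the region. -/
lemma exists_mem_regionQ_of_lt (hα : 0 < α) (Pf : IsProfile α f) (Pk : IsProfile α k) :
    ∃ N : ℝ, ∀ p ∈ interior (squareK α), p.1 ≠ 0 → p.2 ≠ 0 →
      timePrimitive α f p.1 + timePrimitive α k p.2 < N → p ∈ regionQ α f (fun t => -k t) := by
  have h0 : (0 : ℝ) ∈ Ioo (-α) α := ⟨by linarith, hα⟩
  -- On each side there is a point so near `0` that `h < c`; `N` is the smaller of the two time
  -- values.
  have key : ∀ {h : ℝ → ℝ}, IsProfile α h → ∀ {c : ℝ}, 0 < c → ∃ N : ℝ,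
      ∀ x, x ≠ 0 → ∃ z ∈ Ioo (-α) α, 0 < z * x ∧ h z < c ∧ N ≤ timePrimitive α h z := by
    intro h P c hc
    have h1 : ∀ᶠ t in 𝓝 (0 : ℝ), h t < c :=
      (P.hasDerivAt h0).continuousAt.eventually (gt_mem_nhds (by rwa [P.zero]))
    obtain ⟨ε, hε, hb⟩ := Metric.eventually_nhds_iff.1 h1
    have hz : 0 < min (α / 2) (ε / 2) := lt_min (by linarith) (by linarith)
    set z := min (α / 2) (ε / 2) with hzdef
    have hz1 : z < α := (min_le_left _ _).trans_lt (by linarith)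
    have hz2 : z < ε := (min_le_right _ _).trans_lt (by linarith)
    refine ⟨min (timePrimitive α h z) (timePrimitive α h (-z)), fun x hx => ?_⟩
    rcases lt_or_gt_of_ne hx with h2 | h2
    · exact ⟨-z, ⟨by linarith, by linarith⟩, mul_pos_of_neg_of_neg (by linarith) h2,
        hb (by rw [Real.dist_eq, sub_zero, abs_neg, abs_of_pos hz]; exact hz2), min_le_right _ _⟩
    · exact ⟨z, ⟨by linarith, by linarith⟩, mul_pos hz h2,
        hb (by rw [Real.dist_eq, sub_zero, abs_of_pos hz]; exact hz2), min_le_left _ _⟩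
  have hpos : ∀ {h : ℝ → ℝ}, IsProfile α h → ∃ c, 0 < c ∧ ∀ x, c ≤ h (sideEnd α x) := by
    intro h P
    refine ⟨min (h α) (h (-α)), lt_min (P.pos hα ⟨by linarith, le_rfl⟩ hα.ne')
      (P.pos hα ⟨le_rfl, by linarith⟩ (by linarith)), fun x => ?_⟩
    unfold sideEnd
    split_ifs
    · exact min_le_left _ _
    · exact min_le_right _ _
  obtain ⟨cf, hcf, hf⟩ := hpos Pf
  obtain ⟨ck, hck, hk⟩ := hpos Pk
  obtain ⟨N1, hN1⟩ := key Pf hck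
  obtain ⟨N2, hN2⟩ := key Pk hcf
  refine ⟨min N1 N2, fun p hp h1 h2 hlt => ?_⟩
  rw [mem_regionQ_iff_exists hα Pf Pk hp h1 h2]
  obtain ⟨x, hx, hxp, hx1, hx2⟩ := hN1 p.1 h1
  obtain ⟨y, hy, hyp, hy1, hy2⟩ := hN2 p.2 h2
  exact ⟨x, hx, y, hy, hxp, hyp, hy1.trans_le (hf _), hx1.trans_le (hk _),
    hlt.trans_le ((min_le_right _ _).trans hy2), hlt.trans_le ((min_le_left _ _).trans hx2)⟩

lemma mem_nhds_mul_pos {x : ℝ} (hx : x ≠ 0) : {t : ℝ | 0 < t * x} ∈ 𝓝 x :=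
  (isOpen_lt continuous_const (continuous_id.mul continuous_const)).mem_nhds (mul_self_pos.2 hx)

/-- Near an axis one of `F`, `K` tends to `-∞` and the other stays negative, so nearby points off
the axes satisfy `exists_mem_regionQ_of_lt`. Off the axes, the witnesses of `mem_regionQ_iff_exists`
at `p` still serve at nearby points, since the conditions are strict and continuous. -/
lemma isOpen_regionQ (hα : 0 < α) (Pf : IsProfile α f) (Pk : IsProfile α k) :
    IsOpen (regionQ α f (fun t => -k t)) := by
  rw [isOpen_iff_mem_nhds]
  intro p hp
  have hpK : p ∈ interior (squareK α) := hp.1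
  have hK : interior (squareK α) ∈ 𝓝 p := isOpen_interior.mem_nhds hpK
  have hpI := mem_interior_squareK.1 hpK
  by_cases hax : p.1 = 0 ∨ p.2 = 0
  · obtain ⟨N, hN⟩ := exists_mem_regionQ_of_lt hα Pf Pk
    rcases hax with h0 | h0
    · obtain ⟨δ, hδ, hb⟩ := Pf.exists_timePrimitive_lt hα N
      have h1 : ∀ᶠ q : ℝ × ℝ in 𝓝 p, |q.1| < δ :=
        (continuous_fst.abs.tendsto p).eventually (gt_mem_nhds (by simpa [h0] using hδ))
      filter_upwards [hK, h1] with q hq hq1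
      by_cases q1 : q.1 = 0
      · exact ⟨hq, Or.inl q1⟩
      by_cases q2 : q.2 = 0
      · exact ⟨hq, Or.inr (Or.inl q2)⟩
      refine hN q hq q1 q2 ?_
      have := hb q.1 q1 hq1
      have := Pk.timePrimitive_neg_of_mem hα (mem_interior_squareK.1 hq).2 q2
      linarith
    · obtain ⟨δ, hδ, hb⟩ := Pk.exists_timePrimitive_lt hα N
      have h1 : ∀ᶠ q : ℝ × ℝ in 𝓝 p, |q.2| < δ :=
        (continuous_snd.abs.tendsto p).eventually (gt_mem_nhds (by simpa [h0] using hδ))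
      filter_upwards [hK, h1] with q hq hq1
      by_cases q1 : q.1 = 0
      · exact ⟨hq, Or.inl q1⟩
      by_cases q2 : q.2 = 0
      · exact ⟨hq, Or.inr (Or.inl q2)⟩
      refine hN q hq q1 q2 ?_
      have := hb q.2 q2 hq1
      have := Pf.timePrimitive_neg_of_mem hα (mem_interior_squareK.1 hq).1 q1
      linarith
  · rw [not_or] at hax
    obtain ⟨h1, h2⟩ := hax
    obtain ⟨x, hx, y, hy, hxp, hyp, hky, hfx, hdy, hdx⟩ :=
      (mem_regionQ_iff_exists hα Pf Pk hpK h1 h2).1 hp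
    have hc : ContinuousAt (fun q : ℝ × ℝ => timePrimitive α f q.1 + timePrimitive α k q.2) p :=
      (ContinuousAt.comp (f := Prod.fst)
        (Pf.hasDerivAt_timePrimitive hα hpI.1 h1).continuousAt continuousAt_fst).add
      (ContinuousAt.comp (f := Prod.snd)
        (Pk.hasDerivAt_timePrimitive hα hpI.2 h2).continuousAt continuousAt_snd)
    filter_upwards [hK, continuousAt_fst.eventually (mem_nhds_mul_pos h1),
      continuousAt_snd.eventually (mem_nhds_mul_pos h2), hc.eventually (gt_mem_nhds hdy),
      hc.eventually (gt_mem_nhds hdx)] with q hq s1 s2 q3 q4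
    have q1 : q.1 ≠ 0 := ne_zero_of_mul_pos_left s1
    have q2 : q.2 ≠ 0 := ne_zero_of_mul_pos_left s2
    rw [mem_regionQ_iff_exists hα Pf Pk hq q1 q2]
    refine ⟨x, hx, y, hy, mul_pos_of_mul_pos_of_mul_pos hxp s1,
      mul_pos_of_mul_pos_of_mul_pos hyp s2, ?_, ?_, q3, q4⟩
    · rwa [sideEnd_congr s1]
    · rwa [sideEnd_congr s2]

lemma zero_mem_regionQ (hα : 0 < α) (f g : ℝ → ℝ) : (0, 0) ∈ regionQ α f g :=
  ⟨mem_interior_squareK.2 ⟨⟨by linarith, hα⟩, ⟨by linarith, hα⟩⟩, Or.inl rfl⟩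

lemma regionQ_subset (α : ℝ) (f g : ℝ → ℝ) : regionQ α f g ⊆ interior (squareK α) :=
  fun _ hp => hp.1

lemma mem_diff_axes_iff {α : ℝ} {S : Set (ℝ × ℝ)} (hS : S ⊆ squareK α) {p : ℝ × ℝ} :
    p ∈ S \ (stableCurve α ∪ unstableCurve α) ↔ p ∈ S ∧ p.1 ≠ 0 ∧ p.2 ≠ 0 := by
  constructor
  · rintro ⟨h1, h2⟩
    have hK := hS h1
    simp only [stableCurve, unstableCurve, mem_union, mem_prod, mem_singleton_iff, not_or,
      not_and_or] at h2
    refine ⟨h1, fun h => ?_, fun h => ?_⟩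
    · rcases h2.1 with h3 | h3
      · exact h3 h
      · exact h3 hK.2
    · rcases h2.2 with h3 | h3
      · exact h3 hK.1
      · exact h3 h
  · rintro ⟨h1, h2, h3⟩
    refine ⟨h1, ?_⟩
    rintro (h4 | h4)
    · exact h2 h4.1
    · exact h3 h4.2

lemma isOpen_diff_axes {α : ℝ} {S : Set (ℝ × ℝ)} (hS : S ⊆ squareK α) (ho : IsOpen S) :
    IsOpen (S \ (stableCurve α ∪ unstableCurve α)) := by
  have : S \ (stableCurve α ∪ unstableCurve α) = S ∩ ({p | p.1 ≠ 0} ∩ {p | p.2 ≠ 0}) := by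
    ext p
    rw [mem_diff_axes_iff hS]
    rfl
  rw [this]
  exact ho.inter ((isOpen_ne_fun continuous_fst continuous_const).inter
    (isOpen_ne_fun continuous_snd continuous_const))

end Region

/-! ### Sign preservation for scalar differential inequalities -/

section Calculus

lemma HasDerivWithinAt.hasDerivAt_of_mem_uIoo {x : ℝ → ℝ} {v a b t : ℝ}
    (h : HasDerivWithinAt x v (uIcc a b) t) (ht : t ∈ Ioo (min a b) (max a b)) :
    HasDerivAt x v t :=
  h.hasDerivAt (Icc_mem_nhds ht.1 ht.2)

lemma monotoneOn_uIcc_of_hasDerivWithinAt {x v : ℝ → ℝ} {a b : ℝ}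
    (h : ∀ t ∈ uIcc a b, HasDerivWithinAt x (v t) (uIcc a b) t) (hv : ∀ t ∈ uIcc a b, 0 ≤ v t) :
    MonotoneOn x (uIcc a b) := by
  refine monotoneOn_of_hasDerivWithinAt_nonneg (convex_uIcc a b)
    (fun t ht => (h t ht).continuousWithinAt) (f' := v) ?_ ?_
  · intro t ht
    exact (h t (interior_subset ht)).mono interior_subset
  · intro t ht
    exact hv t (interior_subset ht)

/-- A solution of `|x'| ≤ L |x|` which does not vanish at time `0` keeps its sign. -/
lemma mul_pos_of_abs_deriv_le {x v : ℝ → ℝ} {L T : ℝ}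
    (h : ∀ t ∈ uIcc 0 T, HasDerivWithinAt x (v t) (uIcc 0 T) t)
    (hv : ∀ t ∈ uIcc 0 T, |v t| ≤ L * |x t|) (h0 : x 0 ≠ 0) :
    ∀ t ∈ uIcc 0 T, 0 < x t * x 0 := by
  have hsq : ∀ t ∈ uIcc 0 T, |v t * x t| ≤ L * x t ^ 2 := by
    intro t ht
    rw [abs_mul, ← sq_abs (x t), sq, ← mul_assoc]
    exact mul_le_mul_of_nonneg_right (hv t ht) (abs_nonneg _)
  -- The function `x² e^{cs}` increases for `c = 2L` and decreases for `c = -2L`; a zero at a time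
  -- after or before `0` would then force `x 0 = 0`.
  have hder : ∀ c : ℝ, ∀ t ∈ uIcc 0 T, HasDerivWithinAt (fun s => x s ^ 2 * Real.exp (c * s))
      ((2 * (v t * x t) + c * x t ^ 2) * Real.exp (c * t)) (uIcc 0 T) t := by
    intro c t ht
    have h1 := ((h t ht).pow 2).mul (((hasDerivAt_id t).const_mul c).exp.hasDerivWithinAt
      (s := uIcc 0 T))
    refine h1.congr_deriv ?_
    simp
    ring
  have hne : ∀ t ∈ uIcc 0 T, x t ≠ 0 := by
    intro t ht e
    have hx0 : 0 < x 0 ^ 2 := by positivity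
    rcases le_total 0 t with h1 | h1
    · have hm := monotoneOn_uIcc_of_hasDerivWithinAt (hder (2 * L)) (fun s hs => by
        have := (abs_le.1 (hsq s hs)).1
        exact mul_nonneg (by linarith) (Real.exp_pos _).le)
      have := hm left_mem_uIcc ht h1
      simp [e] at this
      exact h0 this
    · have hm := monotoneOn_uIcc_of_hasDerivWithinAt
        (fun s hs => (hder (-(2 * L)) s hs).neg) (fun s hs => by
        have := (abs_le.1 (hsq s hs)).2
        have h3 : 0 ≤ (2 * L * x s ^ 2 - 2 * (v s * x s)) * Real.exp (-(2 * L) * s) :=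
          mul_nonneg (by linarith) (Real.exp_pos _).le
        linarith)
      have := hm ht left_mem_uIcc h1
      simp [e] at this
      nlinarith
  intro t ht
  by_contra hcon
  have hcont : ContinuousOn (fun s => x s * x 0) (uIcc 0 T) :=
    fun s hs => ((h s hs).continuousWithinAt).mul continuousWithinAt_const
  obtain ⟨s, hs, e⟩ := isPreconnected_uIcc.intermediate_value ht left_mem_uIcc hcont
    ⟨not_lt.1 hcon, (mul_self_nonneg (x 0))⟩
  exact mul_ne_zero (hne s hs) h0 e

end Calculus

/-! ### The one-dimensional flow `x' = c h'(x)` -/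

namespace IsProfile

variable {α : ℝ} {h : ℝ → ℝ} {x : ℝ → ℝ} {c T : ℝ}

/-- Along a solution of `x' = c h'(x)` that does not start at the origin, the sign is kept and the
time primitive is affine. -/
lemma flow_sign_and_time (hα : 0 < α) (P : IsProfile α h) (hmem : ∀ t ∈ uIcc 0 T, x t ∈ Ioo (-α) α)
    (hx : ∀ t ∈ uIcc 0 T, HasDerivWithinAt x (c * der1 α h (x t)) (uIcc 0 T) t) (h0 : x 0 ≠ 0) :
    ∀ t ∈ uIcc 0 T, 0 < x t * x 0 ∧
      timePrimitive α h (x t) = timePrimitive α h (x 0) + c * t := by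
  obtain ⟨m, M, hm, hM, hb⟩ := P.exists_der1_bounds hα
  -- The bound `|h'(x)| ≤ M |x|` prevents the solution from reaching the origin in finite time, so
  -- the time primitive is differentiable along it.
  have hs := mul_pos_of_abs_deriv_le (L := |c| * M) hx (fun t ht => by
    rw [abs_mul, mul_assoc]
    exact mul_le_mul_of_nonneg_left (hb _ (Ioo_subset_Icc_self (hmem t ht))).2 (abs_nonneg c)) h0
  intro t ht
  refine ⟨hs t ht, ?_⟩
  have hd : ∀ s ∈ uIcc 0 T, HasDerivWithinAt (fun s => timePrimitive α h (x s) - c * s) 0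
      (uIcc 0 T) s := by
    intro s hs'
    have hne : x s ≠ 0 := ne_zero_of_mul_pos_left (hs s hs')
    have h1 := (P.hasDerivAt_timePrimitive hα (hmem s hs') hne).comp_hasDerivWithinAt s (hx s hs')
    refine (h1.sub (((hasDerivAt_id s).const_mul c).hasDerivWithinAt)).congr_deriv ?_
    have := P.der1_ne_zero (Ioo_subset_Icc_self (hmem s hs')) hne
    field_simp
    ring
  have := (convex_uIcc 0 T).norm_image_sub_le_of_norm_hasDerivWithin_le (C := 0) hd
    (fun _ _ => by simp) left_mem_uIcc ht
  simp only [zero_mul, norm_le_zero_iff, mul_zero, sub_zero] at this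
  linarith

/-- Along the flow `ln |h'(x)|` has derivative `h''(x) · c h'(x) / h'(x) = c h''(x)`. On the left
half `h' < 0`, and `Real.log` reads as the logarithm of the absolute value. -/
lemma integral_der2_flow (hα : 0 < α) (P : IsProfile α h) (hmem : ∀ t ∈ uIcc 0 T, x t ∈ Ioo (-α) α)
    (hx : ∀ t ∈ uIcc 0 T, HasDerivWithinAt x (c * der1 α h (x t)) (uIcc 0 T) t) (h0 : x 0 ≠ 0) :
    IntervalIntegrable (fun s => c * der2 α h (x s)) volume 0 T ∧
    ∫ s in (0 : ℝ)..T, c * der2 α h (x s)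
      = Real.log (der1 α h (x T)) - Real.log (der1 α h (x 0)) := by
  have hs := P.flow_sign_and_time hα hmem hx h0
  have hxc : ContinuousOn x (uIcc 0 T) := fun t ht => (hx t ht).continuousWithinAt
  have hd : ∀ s ∈ uIcc 0 T, HasDerivWithinAt (fun s => Real.log (der1 α h (x s)))
      (c * der2 α h (x s)) (uIcc 0 T) s := by
    intro s hs'
    have hne := P.der1_ne_zero (Ioo_subset_Icc_self (hmem s hs'))
      (ne_zero_of_mul_pos_left (hs s hs').1)
    have h1 := ((P.hasDerivAt_der1 hα (hmem s hs')).comp_hasDerivWithinAt s (hx s hs')).log hne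
    refine h1.congr_deriv ?_
    simp only [Function.comp]
    field_simp
  have hi : IntervalIntegrable (fun s => c * der2 α h (x s)) volume 0 T :=
    (continuousOn_const.mul ((P.continuousOn_der2 hα).comp hxc
      (fun t ht => Ioo_subset_Icc_self (hmem t ht)))).intervalIntegrable
  refine ⟨hi, intervalIntegral.integral_eq_sub_of_hasDeriv_right
    (fun s hs' => (hd s hs').continuousWithinAt) ?_ hi⟩
  intro s hs'
  exact ((hd s (Ioo_subset_Icc_self hs')).hasDerivAt_of_mem_uIoo hs').hasDerivWithinAt

end IsProfile

/-! ### The hitting point on `{u = 0}` and its smooth dependence -/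

section Hit

variable {α : ℝ} {f k : ℝ → ℝ}

/-- `z` is the point of `{u = 0}` on the trajectory through `p`, in the open quadrant of `p`. -/
structure IsHitPoint (α : ℝ) (f k : ℝ → ℝ) (p z : ℝ × ℝ) : Prop where
  mem_fst : z.1 ∈ Ioo (-α) α
  mem_snd : z.2 ∈ Ioo (-α) α
  side_fst : 0 < z.1 * p.1
  side_snd : 0 < z.2 * p.2
  zero : f z.1 = k z.2
  time : timePrimitive α f z.1 + timePrimitive α k z.2
    = timePrimitive α f p.1 + timePrimitive α k p.2

/-- The potential and the first integral of the flow separate the points of a quadrant. -/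
lemma eq_of_potential_eq_of_time_eq (hα : 0 < α) (Pf : IsProfile α f) (Pk : IsProfile α k)
    {z z' : ℝ × ℝ} (h1 : z.1 ∈ Ioo (-α) α) (h2 : z.2 ∈ Ioo (-α) α) (h1' : z'.1 ∈ Ioo (-α) α)
    (h2' : z'.2 ∈ Ioo (-α) α) (s1 : 0 < z.1 * z'.1) (s2 : 0 < z.2 * z'.2)
    (e : f z.1 - k z.2 = f z'.1 - k z'.2)
    (e' : timePrimitive α f z.1 + timePrimitive α k z.2
      = timePrimitive α f z'.1 + timePrimitive α k z'.2) : z = z' := by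
  replace h1 := Ioo_subset_Icc_self h1
  replace h2 := Ioo_subset_Icc_self h2
  replace h1' := Ioo_subset_Icc_self h1'
  replace h2' := Ioo_subset_Icc_self h2'
  have s1' : 0 < z'.1 * z.1 := by linarith [mul_comm z.1 z'.1]
  have s2' : 0 < z'.2 * z.2 := by linarith [mul_comm z.2 z'.2]
  -- On a level of `F + K`, increasing `F` decreases `K`, hence raises `f`, lowers `k` and strictly
  -- raises `f - k`.
  rcases lt_trichotomy (timePrimitive α f z.1) (timePrimitive α f z'.1) with h | h | h
  · have a := (Pf.timePrimitive_lt_iff hα h1 h1' s1).1 h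
    have b := (Pk.timePrimitive_lt_iff hα h2' h2 s2').1 (by linarith)
    linarith
  · have b : timePrimitive α k z.2 = timePrimitive α k z'.2 := by linarith
    exact Prod.ext ((Pf.timePrimitive_eq_iff hα h1 h1' s1).1 h)
      ((Pk.timePrimitive_eq_iff hα h2 h2' s2).1 b)
  · have a := (Pf.timePrimitive_lt_iff hα h1' h1 s1').1 h
    have b := (Pk.timePrimitive_lt_iff hα h2 h2' s2).1 (by linarith)
    linarith

lemma IsHitPoint.eq (hα : 0 < α) (Pf : IsProfile α f) (Pk : IsProfile α k) {p z z' : ℝ × ℝ}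
    (h : IsHitPoint α f k p z) (h' : IsHitPoint α f k p z') : z = z' :=
  eq_of_potential_eq_of_time_eq hα Pf Pk h.mem_fst h.mem_snd h'.mem_fst h'.mem_snd
    (mul_pos_of_mul_pos_of_mul_pos h.side_fst h'.side_fst)
    (mul_pos_of_mul_pos_of_mul_pos h.side_snd h'.side_snd)
    (by rw [h.zero, h'.zero]; ring) (h.time.trans h'.time.symm)

lemma IsProfile.exists_lt_of_lt_sideEnd (hα : 0 < α) (Pf : IsProfile α f) {x c : ℝ} (hx : x ≠ 0)
    (hc : c < f (sideEnd α x)) : ∃ z ∈ Ioo (-α) α, 0 < z * x ∧ c < f z := by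
  have habs : |sideEnd α x| = α := by
    unfold sideEnd
    split_ifs
    · exact abs_of_pos hα
    · rw [abs_neg, abs_of_pos hα]
  have hmem : ∀ t ∈ Ioo (0 : ℝ) 1, t * sideEnd α x ∈ Ioo (-α) α := by
    intro t ht
    rw [mem_Ioo, ← abs_lt, abs_mul, habs, abs_of_pos ht.1]
    nlinarith [ht.2]
  have hcont : ContinuousWithinAt (fun t : ℝ => f (t * sideEnd α x)) (Ioo 0 1) 1 := by
    refine ContinuousWithinAt.comp (t := Icc (-α) α) ?_ (by fun_prop)
      (fun t ht => Ioo_subset_Icc_self (hmem t ht))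
    rw [one_mul]
    exact Pf.contDiffOn.continuousOn _ (sideEnd_mem hα x)
  have hev : ∀ᶠ t in 𝓝[Ioo (0 : ℝ) 1] 1, c < f (t * sideEnd α x) :=
    hcont.eventually (lt_mem_nhds (by simpa using hc))
  have : (𝓝[Ioo (0 : ℝ) 1] 1).NeBot := right_nhdsWithin_Ioo_neBot one_pos
  obtain ⟨t, h1, ht⟩ := (hev.and self_mem_nhdsWithin).exists
  refine ⟨_, hmem t ht, ?_, h1⟩
  rw [mul_assoc]
  exact mul_pos ht.1 (sideEnd_mul_pos hα hx)

/-- The level curve `F + K = d` is parametrized by `s ∈ (d, 0)` through `F = s`, `K = d - s`. As `s`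
tends to `0`, `f` approaches its value at the end point while `k` stays below `k y₁`, so `u` becomes
positive. -/
lemma exists_sideInverse_lt (hα : 0 < α) (Pf : IsProfile α f) (Pk : IsProfile α k) {x y d y₁ : ℝ}
    (hx : x ≠ 0) (hy : y ≠ 0) (hy₁ : y₁ ∈ Ioo (-α) α) (hs : 0 < y₁ * y)
    (hlt : k y₁ < f (sideEnd α x)) (hd : d < timePrimitive α k y₁) :
    ∃ s ∈ Ioo d 0, k (sideInverse α k y (d - s)) < f (sideInverse α f x s) := by
  obtain ⟨z, hz, hzx, hzlt⟩ := Pf.exists_lt_of_lt_sideEnd hα hx hlt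
  have hFz := Pf.timePrimitive_neg_of_mem hα hz (ne_zero_of_mul_pos_left hzx)
  have hKy := Pk.timePrimitive_neg_of_mem hα hy₁ (ne_zero_of_mul_pos_left hs)
  set s := max (timePrimitive α f z) (d - timePrimitive α k y₁) / 2 with hsdef
  have hmax : max (timePrimitive α f z) (d - timePrimitive α k y₁) < 0 :=
    max_lt hFz (by linarith)
  have hs0 : s < 0 := by linarith
  have hs1 : timePrimitive α f z < s := (le_max_left _ _).trans_lt (by linarith)
  have hs2 : d - timePrimitive α k y₁ < s := (le_max_right _ _).trans_lt (by linarith)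
  refine ⟨s, ⟨by linarith, hs0⟩, ?_⟩
  obtain ⟨a1, a2, a3⟩ := Pf.sideInverse_spec hα hx hs0.le
  obtain ⟨b1, b2, b3⟩ := Pk.sideInverse_spec hα hy (s := d - s) (by linarith)
  have h1 : f z < f (sideInverse α f x s) := by
    rw [← Pf.timePrimitive_lt_iff hα (Ioo_subset_Icc_self hz) a1
      (mul_pos_of_mul_pos_of_mul_pos hzx a2), a3]
    exact hs1
  have h2 : k (sideInverse α k y (d - s)) < k y₁ := by
    rw [← Pk.timePrimitive_lt_iff hα b1 (Ioo_subset_Icc_self hy₁)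
      (mul_pos_of_mul_pos_of_mul_pos b2 hs), b3]
    linarith
  linarith

/-- The two conditions defining `Q` give `u > 0` near one end of the level curve and `u < 0` near
the other; the intermediate value theorem does the rest. -/
lemma exists_isHitPoint (hα : 0 < α) (Pf : IsProfile α f) (Pk : IsProfile α k) {p : ℝ × ℝ}
    (hp : p ∈ regionQ α f (fun t => -k t)) (h1 : p.1 ≠ 0) (h2 : p.2 ≠ 0) :
    ∃ z, IsHitPoint α f k p z := by
  obtain ⟨x, hx, y, hy, hxp, hyp, hky, hfx, hdy, hdx⟩ :=
    (mem_regionQ_iff_exists hα Pf Pk hp.1 h1 h2).1 hp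
  set d := timePrimitive α f p.1 + timePrimitive α k p.2 with hd
  obtain ⟨s₀, hs₀, hlt₀⟩ := exists_sideInverse_lt hα Pf Pk h1 h2 hy hyp hky hdy
  obtain ⟨t, ht, hlt₁⟩ := exists_sideInverse_lt hα Pk Pf h2 h1 hx hxp hfx hdx
  have hcont : ContinuousOn (fun s => f (sideInverse α f p.1 s) - k (sideInverse α k p.2 (d - s)))
      (Ioo d 0) := by
    intro s hs
    refine ContinuousAt.continuousWithinAt (ContinuousAt.sub ?_ ?_)
    · exact ContinuousAt.comp (Pf.hasDerivAt (Pf.sideInverse_mem_Ioo hα h1 hs.2)).continuousAt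
        (Pf.hasDerivAt_sideInverse hα h1 hs.2).continuousAt
    · have hs' : d - s < 0 := by linarith [hs.1]
      exact ContinuousAt.comp (f := fun s => sideInverse α k p.2 (d - s))
        (Pk.hasDerivAt (Pk.sideInverse_mem_Ioo hα h2 hs')).continuousAt
        (ContinuousAt.comp (f := fun s => d - s)
          (Pk.hasDerivAt_sideInverse hα h2 hs').continuousAt (by fun_prop))
  -- The second application exchanged `f` and `k`, so `t` is the value of `K`; the matching value of
  -- `F` is `d - t`.
  have ht' : d - t ∈ Ioo d 0 := ⟨by linarith [ht.2], by linarith [ht.1]⟩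
  obtain ⟨s, hs, e⟩ := isPreconnected_Ioo.intermediate_value ht' hs₀ hcont
    (show (0 : ℝ) ∈ Icc _ _ from ⟨by simp only [sub_sub_cancel]; linarith, by linarith⟩)
  have hs' : d - s < 0 := by linarith [hs.1]
  obtain ⟨a1, a2, a3⟩ := Pf.sideInverse_spec hα h1 hs.2.le
  obtain ⟨b1, b2, b3⟩ := Pk.sideInverse_spec hα h2 hs'.le
  exact ⟨(sideInverse α f p.1 s, sideInverse α k p.2 (d - s)),
    Pf.sideInverse_mem_Ioo hα h1 hs.2, Pk.sideInverse_mem_Ioo hα h2 hs', a2, b2,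
    by simpa using sub_eq_zero.1 e, by simp only [a3, b3]; linarith⟩

/-- The point where the trajectory through `p` meets `{u = 0}`. -/
def hitPoint (α : ℝ) (f k : ℝ → ℝ) (p : ℝ × ℝ) : ℝ × ℝ := Classical.epsilon (IsHitPoint α f k p)

lemma isHitPoint_hitPoint (hα : 0 < α) (Pf : IsProfile α f) (Pk : IsProfile α k) {p : ℝ × ℝ}
    (hp : p ∈ regionQ α f (fun t => -k t)) (h1 : p.1 ≠ 0) (h2 : p.2 ≠ 0) :
    IsHitPoint α f k p (hitPoint α f k p) :=
  Classical.epsilon_spec (exists_isHitPoint hα Pf Pk hp h1 h2)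

/-- This is the differential of `(f - k, F + K)` for `a = f'`, `b = k'`. Its determinant `(a² +
b²)/(ab)` cannot vanish; `B` is the explicit inverse. -/
lemma exists_continuousLinearEquiv_saddle {a b : ℝ} (ha : a ≠ 0) (hb : b ≠ 0) :
    ∃ e : (ℝ × ℝ) ≃L[ℝ] (ℝ × ℝ), (e : (ℝ × ℝ) →L[ℝ] (ℝ × ℝ)) =
      (a • ContinuousLinearMap.fst ℝ ℝ ℝ - b • ContinuousLinearMap.snd ℝ ℝ ℝ).prod
      ((1 / a) • ContinuousLinearMap.fst ℝ ℝ ℝ + (1 / b) • ContinuousLinearMap.snd ℝ ℝ ℝ) := by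
  have hD : a ^ 2 + b ^ 2 ≠ 0 := by positivity
  set A : (ℝ × ℝ) →L[ℝ] (ℝ × ℝ) :=
    (a • ContinuousLinearMap.fst ℝ ℝ ℝ - b • ContinuousLinearMap.snd ℝ ℝ ℝ).prod
      ((1 / a) • ContinuousLinearMap.fst ℝ ℝ ℝ + (1 / b) • ContinuousLinearMap.snd ℝ ℝ ℝ) with hA
  set B : (ℝ × ℝ) →L[ℝ] (ℝ × ℝ) :=
    ((a / (a ^ 2 + b ^ 2)) • ContinuousLinearMap.fst ℝ ℝ ℝ
      + (a * b ^ 2 / (a ^ 2 + b ^ 2)) • ContinuousLinearMap.snd ℝ ℝ ℝ).prod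
    ((-(b / (a ^ 2 + b ^ 2))) • ContinuousLinearMap.fst ℝ ℝ ℝ
      + (a ^ 2 * b / (a ^ 2 + b ^ 2)) • ContinuousLinearMap.snd ℝ ℝ ℝ) with hB
  have h1 : Function.LeftInverse B A := by
    rintro ⟨v, w⟩
    simp [hA, hB]
    constructor <;> field_simp <;> ring
  have h2 : Function.RightInverse B A := by
    rintro ⟨v, w⟩
    simp [hA, hB]
    constructor <;> field_simp <;> ring
  exact ⟨ContinuousLinearEquiv.equivOfInverse A B h1 h2, rfl⟩

/-- The hitting point solves `(u, F + K)(z) = (0, (F + K)(p))`, where the map on the left is `C¹`,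
injective on the quadrant, with invertible differential. Openness of `Q` makes the equation hold
near `p`. -/
lemma contDiffAt_hitPoint (hα : 0 < α) (Pf : IsProfile α f) (Pk : IsProfile α k) {p : ℝ × ℝ}
    (hp : p ∈ regionQ α f (fun t => -k t)) (h1 : p.1 ≠ 0) (h2 : p.2 ≠ 0) :
    ContDiffAt ℝ 1 (hitPoint α f k) p := by
  have hpI := mem_interior_squareK.1 hp.1
  have hz := isHitPoint_hitPoint hα Pf Pk hp h1 h2
  have hz1 := ne_zero_of_mul_pos_left hz.side_fst
  have hz2 := ne_zero_of_mul_pos_left hz.side_snd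
  obtain ⟨e, he⟩ := exists_continuousLinearEquiv_saddle
    (Pf.der1_ne_zero (Ioo_subset_Icc_self hz.mem_fst) hz1)
    (Pk.der1_ne_zero (Ioo_subset_Icc_self hz.mem_snd) hz2)
  refine contDiffAt_of_comp_eventuallyEq
    (f := fun z => (f z.1 - k z.2, timePrimitive α f z.1 + timePrimitive α k z.2)) (f' := e)
    (c := fun q => (0, timePrimitive α f q.1 + timePrimitive α k q.2))
    (s := {z | (z.1 ∈ Ioo (-α) α ∧ z.2 ∈ Ioo (-α) α) ∧ 0 < z.1 * p.1 ∧ 0 < z.2 * p.2})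
    ?_ ?_ one_ne_zero ?_ ?_ ?_ ?_
  · refine ContDiffAt.prodMk (ContDiffAt.sub ?_ ?_) (ContDiffAt.add ?_ ?_)
    · exact ((Pf.contDiffAt hz.mem_fst).of_le (by norm_num)).comp _ contDiffAt_fst
    · exact ((Pk.contDiffAt hz.mem_snd).of_le (by norm_num)).comp _ contDiffAt_snd
    · exact (Pf.contDiffAt_timePrimitive hα hz.mem_fst hz1).comp _ contDiffAt_fst
    · exact (Pk.contDiffAt_timePrimitive hα hz.mem_snd hz2).comp _ contDiffAt_snd
  · rw [he]
    exact (((Pf.hasDerivAt hz.mem_fst).comp_hasFDerivAt _ hasFDerivAt_fst).sub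
      ((Pk.hasDerivAt hz.mem_snd).comp_hasFDerivAt _ hasFDerivAt_snd)).prodMk
      (((Pf.hasDerivAt_timePrimitive hα hz.mem_fst hz1).comp_hasFDerivAt _ hasFDerivAt_fst).add
      ((Pk.hasDerivAt_timePrimitive hα hz.mem_snd hz2).comp_hasFDerivAt _ hasFDerivAt_snd))
  · refine contDiffAt_const.prodMk (ContDiffAt.add ?_ ?_)
    · exact (Pf.contDiffAt_timePrimitive hα hpI.1 h1).comp _ contDiffAt_fst
    · exact (Pk.contDiffAt_timePrimitive hα hpI.2 h2).comp _ contDiffAt_snd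
  · have ho : IsOpen {z : ℝ × ℝ | (z.1 ∈ Ioo (-α) α ∧ z.2 ∈ Ioo (-α) α) ∧ 0 < z.1 * p.1 ∧
        0 < z.2 * p.2} :=
      ((isOpen_Ioo.preimage continuous_fst).inter (isOpen_Ioo.preimage continuous_snd)).inter
        ((isOpen_lt continuous_const (continuous_fst.mul continuous_const)).inter
          (isOpen_lt continuous_const (continuous_snd.mul continuous_const)))
    exact ho.mem_nhds ⟨⟨hz.mem_fst, hz.mem_snd⟩, hz.side_fst, hz.side_snd⟩
  · rintro a ⟨⟨a1, a2⟩, a3, a4⟩ b ⟨⟨b1, b2⟩, b3, b4⟩ hab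
    simp only [Prod.mk.injEq] at hab
    exact eq_of_potential_eq_of_time_eq hα Pf Pk a1 a2 b1 b2 (mul_pos_of_mul_pos_of_mul_pos a3 b3)
      (mul_pos_of_mul_pos_of_mul_pos a4 b4) hab.1 hab.2
  · filter_upwards [(isOpen_regionQ hα Pf Pk).mem_nhds hp,
      continuousAt_fst.eventually (mem_nhds_mul_pos h1),
      continuousAt_snd.eventually (mem_nhds_mul_pos h2)] with q hq s1 s2
    have hq' := isHitPoint_hitPoint hα Pf Pk hq (ne_zero_of_mul_pos_left s1)
      (ne_zero_of_mul_pos_left s2)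
    refine ⟨⟨⟨hq'.mem_fst, hq'.mem_snd⟩, ?_, ?_⟩, ?_⟩
    · exact mul_pos_of_mul_pos_of_mul_pos hq'.side_fst (by linarith [mul_comm q.1 p.1])
    · exact mul_pos_of_mul_pos_of_mul_pos hq'.side_snd (by linarith [mul_comm q.2 p.2])
    · rw [hq'.time, hq'.zero, sub_self]

/-- The logarithm of the weight `f' g'` at the hitting point: a first integral of the flow. -/
def hitLog (α : ℝ) (f k : ℝ → ℝ) (p : ℝ × ℝ) : ℝ :=
  Real.log (der1 α f (hitPoint α f k p).1) + Real.log (der1 α k (hitPoint α f k p).2)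

/-- The integral of the Laplacian along the trajectory up to `{u = 0}`. -/
def hitWeight (α : ℝ) (f k : ℝ → ℝ) (p : ℝ × ℝ) : ℝ :=
  hitLog α f k p - (Real.log (der1 α f p.1) + Real.log (der1 α k p.2))

/-- The time at which the trajectory meets `{u = 0}`. -/
def hitTime (α : ℝ) (f k : ℝ → ℝ) (p : ℝ × ℝ) : ℝ :=
  timePrimitive α f (hitPoint α f k p).1 - timePrimitive α f p.1

lemma contDiffAt_hitLog (hα : 0 < α) (Pf : IsProfile α f) (Pk : IsProfile α k) {p : ℝ × ℝ}
    (hp : p ∈ regionQ α f (fun t => -k t)) (h1 : p.1 ≠ 0) (h2 : p.2 ≠ 0) :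
    ContDiffAt ℝ 1 (hitLog α f k) p := by
  have hz := isHitPoint_hitPoint hα Pf Pk hp h1 h2
  have hc := contDiffAt_hitPoint hα Pf Pk hp h1 h2
  refine ContDiffAt.add ?_ ?_
  · exact ((Pf.contDiffAt_der1 hα hz.mem_fst).comp p (contDiffAt_fst.comp p hc)).log
      (Pf.der1_ne_zero (Ioo_subset_Icc_self hz.mem_fst) (ne_zero_of_mul_pos_left hz.side_fst))
  · exact ((Pk.contDiffAt_der1 hα hz.mem_snd).comp p (contDiffAt_snd.comp p hc)).log
      (Pk.der1_ne_zero (Ioo_subset_Icc_self hz.mem_snd) (ne_zero_of_mul_pos_left hz.side_snd))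

lemma contDiffAt_hitWeight (hα : 0 < α) (Pf : IsProfile α f) (Pk : IsProfile α k) {p : ℝ × ℝ}
    (hp : p ∈ regionQ α f (fun t => -k t)) (h1 : p.1 ≠ 0) (h2 : p.2 ≠ 0) :
    ContDiffAt ℝ 1 (hitWeight α f k) p := by
  have hpI := mem_interior_squareK.1 hp.1
  refine (contDiffAt_hitLog hα Pf Pk hp h1 h2).sub (ContDiffAt.add ?_ ?_)
  · exact ((Pf.contDiffAt_der1 hα hpI.1).comp p contDiffAt_fst).log
      (Pf.der1_ne_zero (Ioo_subset_Icc_self hpI.1) h1)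
  · exact ((Pk.contDiffAt_der1 hα hpI.2).comp p contDiffAt_snd).log
      (Pk.der1_ne_zero (Ioo_subset_Icc_self hpI.2) h2)

end Hit

/-! ### The gradient and Laplacian of `u`, and the hitting integral -/

section Potential

variable {α : ℝ} {f k : ℝ → ℝ}

lemma partialX_sepPotential (Pf : IsProfile α f) (g : ℝ → ℝ) {p : ℝ × ℝ}
    (hp : p.1 ∈ Ioo (-α) α) : partialX (sepPotential f g) p = der1 α f p.1 := by
  simp only [partialX, sepPotential]
  exact ((Pf.hasDerivAt hp).add_const _).deriv

lemma partialY_sepPotential (Pk : IsProfile α k) (f : ℝ → ℝ) {p : ℝ × ℝ}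
    (hp : p.2 ∈ Ioo (-α) α) :
    partialY (sepPotential f (fun t => -k t)) p = -der1 α k p.2 := by
  simp only [partialY, sepPotential]
  exact (((Pk.hasDerivAt hp).neg).const_add _).deriv

lemma planeLaplacian_sepPotential (hα : 0 < α) (Pf : IsProfile α f) (Pk : IsProfile α k)
    {p : ℝ × ℝ} (hp : p ∈ interior (squareK α)) :
    planeLaplacian (sepPotential f (fun t => -k t)) p = der2 α f p.1 - der2 α k p.2 := by
  rw [mem_interior_squareK] at hp
  unfold planeLaplacian
  have h1 : partialX (partialX (sepPotential f (fun t => -k t))) p = der2 α f p.1 := by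
    refine ((Pf.hasDerivAt_der1 hα hp.1).congr_of_eventuallyEq ?_).deriv
    filter_upwards [Ioo_mem_nhds hp.1.1 hp.1.2] with t ht
    exact partialX_sepPotential Pf _ (p := (t, p.2)) ht
  have h2 : partialY (partialY (sepPotential f (fun t => -k t))) p = -der2 α k p.2 := by
    refine ((Pk.hasDerivAt_der1 hα hp.2).neg.congr_of_eventuallyEq ?_).deriv
    filter_upwards [Ioo_mem_nhds hp.2.1 hp.2.2] with t ht
    exact partialY_sepPotential Pk _ (p := (p.1, t)) ht
  rw [h1, h2]
  ring

/-- Existence comes from the explicit trajectory given by the inverse branches. For uniqueness,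
every hitting arc keeps its quadrant and conserves `F + K`, so it ends at the hitting point; its
duration is then the increment of `F`. -/
lemma isHittingIntegral_hitTime (hα : 0 < α) (Pf : IsProfile α f) (Pk : IsProfile α k) :
    IsHittingIntegral (sepPotential f (fun t => -k t)) (interior (squareK α))
      (regionQ α f (fun t => -k t) \ (stableCurve α ∪ unstableCurve α))
      (hitTime α f k) (hitWeight α f k) := by
  intro p hp
  rw [mem_diff_axes_iff ((regionQ_subset α _ _).trans interior_subset)] at hp
  obtain ⟨hpQ, h1, h2⟩ := hp
  have hpI := mem_interior_squareK.1 hpQ.1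
  have hz := isHitPoint_hitPoint hα Pf Pk hpQ h1 h2
  have hF := Pf.timePrimitive_neg_of_mem hα hpI.1 h1
  have hK := Pk.timePrimitive_neg_of_mem hα hpI.2 h2
  have hF' := Pf.timePrimitive_neg_of_mem hα hz.mem_fst (ne_zero_of_mul_pos_left hz.side_fst)
  have hK' := Pk.timePrimitive_neg_of_mem hα hz.mem_snd (ne_zero_of_mul_pos_left hz.side_snd)
  have ht := hz.time
  constructor
  · have hs : ∀ t ∈ uIcc 0 (hitTime α f k p),
        timePrimitive α f p.1 + t < 0 ∧ timePrimitive α k p.2 - t < 0 := by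
      intro t ht'
      unfold hitTime at ht'
      rcases mem_uIcc.1 ht' with h | h <;> constructor <;> linarith [h.1, h.2]
    refine ⟨fun t => (sideInverse α f p.1 (timePrimitive α f p.1 + t),
      sideInverse α k p.2 (timePrimitive α k p.2 - t)), ?_, ?_, ?_, ?_⟩
    · simp only [add_zero, sub_zero]
      rw [Pf.sideInverse_timePrimitive hα (Ioo_subset_Icc_self hpI.1) (mul_self_pos.2 h1),
        Pk.sideInverse_timePrimitive hα (Ioo_subset_Icc_self hpI.2) (mul_self_pos.2 h2)]
    · intro t ht'
      exact mem_interior_squareK.2 ⟨Pf.sideInverse_mem_Ioo hα h1 (hs t ht').1,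
        Pk.sideInverse_mem_Ioo hα h2 (hs t ht').2⟩
    · intro t ht'
      have m1 := Pf.sideInverse_mem_Ioo hα h1 (hs t ht').1
      have m2 := Pk.sideInverse_mem_Ioo hα h2 (hs t ht').2
      refine HasDerivAt.hasDerivWithinAt (HasDerivAt.prodMk ?_ ?_)
      · rw [partialX_sepPotential Pf _ m1]
        exact ((Pf.hasDerivAt_sideInverse hα h1 (hs t ht').1).comp t
          ((hasDerivAt_id t).const_add _)).congr_deriv (by simp)
      · rw [partialY_sepPotential Pk _ m2]
        exact ((Pk.hasDerivAt_sideInverse hα h2 (hs t ht').2).comp t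
          ((hasDerivAt_id t).const_sub _)).congr_deriv (by simp)
    · have e1 : timePrimitive α f p.1 + hitTime α f k p
          = timePrimitive α f (hitPoint α f k p).1 := by unfold hitTime; ring
      have e2 : timePrimitive α k p.2 - hitTime α f k p
          = timePrimitive α k (hitPoint α f k p).2 := by unfold hitTime; linarith
      simp only [sepPotential, e1, e2]
      rw [Pf.sideInverse_timePrimitive hα (Ioo_subset_Icc_self hz.mem_fst) hz.side_fst,
        Pk.sideInverse_timePrimitive hα (Ioo_subset_Icc_self hz.mem_snd) hz.side_snd, hz.zero]
      ring
  · rintro T X ⟨hinit, hmem, hode, hhit⟩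
    have hmem' := fun t ht' => mem_interior_squareK.1 (hmem t ht')
    have hx : ∀ t ∈ uIcc 0 T,
        HasDerivWithinAt (fun s => (X s).1) (1 * der1 α f (X t).1) (uIcc 0 T) t := by
      intro t ht'
      have := (hode t ht').fst
      rw [one_mul, ← partialX_sepPotential Pf (fun t => -k t) (hmem' t ht').1]
      exact this
    have hy : ∀ t ∈ uIcc 0 T,
        HasDerivWithinAt (fun s => (X s).2) (-1 * der1 α k (X t).2) (uIcc 0 T) t := by
      intro t ht'
      have := (hode t ht').snd
      rw [neg_one_mul, ← partialY_sepPotential Pk f (hmem' t ht').2]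
      exact this
    have hx0 : (X 0).1 ≠ 0 := by rwa [hinit]
    have hy0 : (X 0).2 ≠ 0 := by rwa [hinit]
    have fx := Pf.flow_sign_and_time hα (fun t ht' => (hmem' t ht').1) hx hx0 T right_mem_uIcc
    have fy := Pk.flow_sign_and_time hα (fun t ht' => (hmem' t ht').2) hy hy0 T right_mem_uIcc
    have ix := Pf.integral_der2_flow hα (fun t ht' => (hmem' t ht').1) hx hx0
    have iy := Pk.integral_der2_flow hα (fun t ht' => (hmem' t ht').2) hy hy0
    rw [hinit] at fx fy ix iy
    have hXT : IsHitPoint α f k p (X T) :=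
      ⟨(hmem' T right_mem_uIcc).1, (hmem' T right_mem_uIcc).2, fx.1, fy.1,
        by simp only [sepPotential] at hhit; linarith, by rw [fx.2, fy.2]; ring⟩
    have e := hXT.eq hα Pf Pk hz
    constructor
    · unfold hitTime
      rw [← e, fx.2]
      ring
    · rw [intervalIntegral.integral_congr (g := fun s => 1 * der2 α f (X s).1 + -1 * der2 α k (X s).2)
        (fun s hs => by
          simp only
          rw [planeLaplacian_sepPotential hα Pf Pk (hmem s hs)]; ring),
        intervalIntegral.integral_add ix.1 iy.1, ix.2, iy.2]
      unfold hitWeight hitLog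
      rw [← e]
      ring

end Potential

/-! ### Weak divergence and integration by parts -/

section Weak

lemma hasDerivAt_partialX {φ : ℝ × ℝ → ℝ} {p : ℝ × ℝ} (h : DifferentiableAt ℝ φ p) :
    HasDerivAt (fun x => φ (x, p.2)) (partialX φ p) p.1 :=
  DifferentiableAt.hasDerivAt (DifferentiableAt.comp (f := fun x => (x, p.2)) p.1 h (by fun_prop))

lemma hasDerivAt_partialY {φ : ℝ × ℝ → ℝ} {p : ℝ × ℝ} (h : DifferentiableAt ℝ φ p) :
    HasDerivAt (fun y => φ (p.1, y)) (partialY φ p) p.2 :=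
  DifferentiableAt.hasDerivAt (DifferentiableAt.comp (f := fun y => (p.1, y)) p.2 h (by fun_prop))

lemma partialX_eq_fderiv {φ : ℝ × ℝ → ℝ} {p : ℝ × ℝ} (h : DifferentiableAt ℝ φ p) :
    partialX φ p = fderiv ℝ φ p (1, 0) :=
  (HasFDerivAt.comp_hasDerivAt (f := fun x => (x, p.2)) p.1 h.hasFDerivAt
    ((hasDerivAt_id p.1).prodMk (hasDerivAt_const p.1 p.2))).deriv

lemma partialY_eq_fderiv {φ : ℝ × ℝ → ℝ} {p : ℝ × ℝ} (h : DifferentiableAt ℝ φ p) :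
    partialY φ p = fderiv ℝ φ p (0, 1) :=
  (HasFDerivAt.comp_hasDerivAt (f := fun y => (p.1, y)) p.2 h.hasFDerivAt
    ((hasDerivAt_const p.2 p.1).prodMk (hasDerivAt_id p.2))).deriv

/-- The factor `a` is controlled only on `U`, but the product is supported in a compact subset of
`U` and so is continuous on the whole plane. -/
lemma integrable_mul_of_tsupport_subset {U : Set (ℝ × ℝ)} (hU : IsOpen U) {a b : ℝ × ℝ → ℝ}
    (ha : ContinuousOn a U) (hb : Continuous b) (hc : HasCompactSupport b) (hs : tsupport b ⊆ U) :
    Integrable (fun p => a p * b p) := by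
  have h1 : Continuous (fun p => a p * b p) :=
    (ha.mul hb.continuousOn).continuous_of_tsupport_subset hU
      ((tsupport_mul_subset_right (f := a) (g := b)).trans hs)
  exact h1.integrable_of_hasCompactSupport hc.mul_left

/-- Integration by parts against a compactly supported `C¹` function. -/
lemma integral_mul_fderiv_eq_neg {U : Set (ℝ × ℝ)} (hU : IsOpen U) {A φ : ℝ × ℝ → ℝ}
    (hA : ContDiffOn ℝ 1 A U) (hφ : ContDiff ℝ 1 φ) (hc : HasCompactSupport φ)
    (hs : tsupport φ ⊆ U) (v : ℝ × ℝ) :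
    Integrable (fun p => A p * fderiv ℝ φ p v) ∧ Integrable (fun p => fderiv ℝ A p v * φ p) ∧
    ∫ p, A p * fderiv ℝ φ p v = -∫ p, fderiv ℝ A p v * φ p := by
  have hsub : tsupport (fun p => fderiv ℝ φ p v) ⊆ tsupport φ := tsupport_fderiv_apply_subset ℝ v
  have i1 : Integrable (fun p => A p * fderiv ℝ φ p v) :=
    integrable_mul_of_tsupport_subset hU hA.continuousOn
      ((hφ.continuous_fderiv one_ne_zero).clm_apply continuous_const)
      (hc.of_isClosed_subset (isClosed_tsupport _) hsub) (hsub.trans hs)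
  have i2 : Integrable (fun p => fderiv ℝ A p v * φ p) :=
    integrable_mul_of_tsupport_subset hU
      ((hA.continuousOn_fderiv_of_isOpen hU le_rfl).clm_apply continuousOn_const)
      hφ.continuous hc hs
  refine ⟨i1, i2, ?_⟩
  refine integral_bilinear_hasLineDerivAt_right_eq_neg_left_of_integrable (f := A) (g := φ)
    (f' := fun p => fderiv ℝ A p v) (g' := fun p => fderiv ℝ φ p v) (v := v)
    (B := ContinuousLinearMap.mul ℝ ℝ) i2 i1
    (integrable_mul_of_tsupport_subset hU hA.continuousOn hφ.continuous hc hs) ?_ ?_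
  · intro p hp
    exact ((hA.contDiffAt (hU.mem_nhds (hs hp))).differentiableAt
      one_ne_zero).hasFDerivAt.hasLineDerivAt v
  · intro p _
    exact (hφ.differentiable one_ne_zero p).hasFDerivAt.hasLineDerivAt v

/-- The weak formulation of `div (σ ∇u) = 0` tested in an open set where the flux is `C¹`. -/
lemma setIntegral_flux_eq {U Ω : Set (ℝ × ℝ)} (hU : IsOpen U) (hUΩ : U ⊆ Ω)
    {u σ φ A B : ℝ × ℝ → ℝ} (hA : ContDiffOn ℝ 1 A U) (hB : ContDiffOn ℝ 1 B U)
    (eA : ∀ p ∈ U, A p = σ p * partialX u p) (eB : ∀ p ∈ U, B p = σ p * partialY u p)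
    (hφ : ContDiff ℝ 1 φ) (hc : HasCompactSupport φ) (hs : tsupport φ ⊆ U) :
    ∫ p in Ω, σ p * (partialX u p * partialX φ p + partialY u p * partialY φ p)
      = -∫ p, φ p * (fderiv ℝ A p (1, 0) + fderiv ℝ B p (0, 1)) := by
  obtain ⟨a1, a2, a3⟩ := integral_mul_fderiv_eq_neg hU hA hφ hc hs (1, 0)
  obtain ⟨b1, b2, b3⟩ := integral_mul_fderiv_eq_neg hU hB hφ hc hs (0, 1)
  have hd : Differentiable ℝ φ := hφ.differentiable one_ne_zero
  have hz : ∀ p ∉ U, fderiv ℝ φ p = 0 := fun p hp =>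
    fderiv_of_notMem_tsupport ℝ (fun h => hp (hs h))
  have e1 : ∀ p, σ p * (partialX u p * partialX φ p + partialY u p * partialY φ p)
      = A p * fderiv ℝ φ p (1, 0) + B p * fderiv ℝ φ p (0, 1) := by
    intro p
    rw [partialX_eq_fderiv (hd p), partialY_eq_fderiv (hd p)]
    by_cases hp : p ∈ U
    · rw [eA p hp, eB p hp]; ring
    · simp [hz p hp]
  simp only [e1]
  rw [setIntegral_eq_integral_of_forall_compl_eq_zero
    (fun p hp => by simp [hz p (fun h => hp (hUΩ h))]), integral_add a1 b1, a3, b3, ← neg_add,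
    ← integral_add a2 b2]
  congr 2
  ext p
  ring

end Weak

/-! ### Transport equation for the weight -/

section Invariance

variable {α : ℝ} {f k : ℝ → ℝ}

/-- The predicate `IsHitPoint` sees `p` only through its quadrant and the value of `F + K`. Equal
predicates have equal `Classical.epsilon`, so no existence is needed. -/
lemma hitPoint_congr {p q : ℝ × ℝ} (s1 : 0 < p.1 * q.1) (s2 : 0 < p.2 * q.2)
    (e : timePrimitive α f p.1 + timePrimitive α k p.2
      = timePrimitive α f q.1 + timePrimitive α k q.2) :
    hitPoint α f k p = hitPoint α f k q := by
  unfold hitPoint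
  congr 1
  ext z
  constructor
  · rintro ⟨a1, a2, a3, a4, a5, a6⟩
    exact ⟨a1, a2, mul_pos_of_mul_pos_of_mul_pos a3 (by linarith [mul_comm p.1 q.1]),
      mul_pos_of_mul_pos_of_mul_pos a4 (by linarith [mul_comm p.2 q.2]), a5, a6.trans e⟩
  · rintro ⟨a1, a2, a3, a4, a5, a6⟩
    exact ⟨a1, a2, mul_pos_of_mul_pos_of_mul_pos a3 s1, mul_pos_of_mul_pos_of_mul_pos a4 s2, a5,
      a6.trans e.symm⟩

/-- The trajectory of the gradient flow through a point off the axes. -/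
lemma hasDerivAt_flow (hα : 0 < α) (Pf : IsProfile α f) (Pk : IsProfile α k) {x y d s : ℝ}
    (hx : x ≠ 0) (hy : y ≠ 0) (hs : s < 0) (hs' : d - s < 0) :
    HasDerivAt (fun s => (sideInverse α f x s, sideInverse α k y (d - s)))
      (der1 α f (sideInverse α f x s), -der1 α k (sideInverse α k y (d - s))) s :=
  (Pf.hasDerivAt_sideInverse hα hx hs).prodMk
    (((Pk.hasDerivAt_sideInverse hα hy hs').comp s ((hasDerivAt_id s).const_sub d)).congr_deriv
      (by simp))

/-- The trajectory through `p`, parametrized by the value `s` of `F`, has velocity `∇u`, and the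
hitting point does not change along it. -/
lemma fderiv_hitLog (hα : 0 < α) (Pf : IsProfile α f) (Pk : IsProfile α k) {p : ℝ × ℝ}
    (hp : p ∈ regionQ α f (fun t => -k t)) (h1 : p.1 ≠ 0) (h2 : p.2 ≠ 0) :
    fderiv ℝ (hitLog α f k) p (der1 α f p.1, -der1 α k p.2) = 0 := by
  have hpI := mem_interior_squareK.1 hp.1
  have hF := Pf.timePrimitive_neg_of_mem hα hpI.1 h1
  have hK := Pk.timePrimitive_neg_of_mem hα hpI.2 h2
  set d := timePrimitive α f p.1 + timePrimitive α k p.2 with hd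
  have e1 := Pf.sideInverse_timePrimitive hα (Ioo_subset_Icc_self hpI.1) (mul_self_pos.2 h1)
  have e2 : sideInverse α k p.2 (d - timePrimitive α f p.1) = p.2 := by
    rw [hd, add_sub_cancel_left]
    exact Pk.sideInverse_timePrimitive hα (Ioo_subset_Icc_self hpI.2) (mul_self_pos.2 h2)
  have hg := hasDerivAt_flow hα Pf Pk (d := d) h1 h2 hF (by rw [hd]; linarith)
  have hd1 := ((contDiffAt_hitLog hα Pf Pk hp h1 h2).differentiableAt one_ne_zero).hasFDerivAt
  have hcomp := HasFDerivAt.comp_hasDerivAt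
    (f := fun s => (sideInverse α f p.1 s, sideInverse α k p.2 (d - s)))
    (l := hitLog α f k) (timePrimitive α f p.1) (by simpa only [e1, e2] using hd1) hg
  rw [e1, e2] at hcomp
  refine hcomp.unique ((hasDerivAt_const _ (hitLog α f k p)).congr_of_eventuallyEq ?_)
  filter_upwards [gt_mem_nhds hF, lt_mem_nhds (show d < timePrimitive α f p.1 by rw [hd]; linarith)]
    with s hs hs'
  obtain ⟨_, a2, a3⟩ := Pf.sideInverse_spec hα h1 (le_of_lt hs)
  obtain ⟨_, b2, b3⟩ := Pk.sideInverse_spec hα h2 (s := d - s) (by linarith)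
  simp only [Function.comp, hitLog]
  rw [hitPoint_congr (q := p) a2 b2 (by rw [a3, b3, hd]; ring)]

/-- This is `∇w · ∇u = -Δu`: the hitting term is invariant, and the derivatives of `ln |f'|` and `ln
|k'|` along `∇u` are `f''` and `-k''`. -/
lemma fderiv_hitWeight (hα : 0 < α) (Pf : IsProfile α f) (Pk : IsProfile α k) {p : ℝ × ℝ}
    (hp : p ∈ regionQ α f (fun t => -k t)) (h1 : p.1 ≠ 0) (h2 : p.2 ≠ 0) :
    fderiv ℝ (hitWeight α f k) p (der1 α f p.1, -der1 α k p.2)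
      = der2 α k p.2 - der2 α f p.1 := by
  have hpI := mem_interior_squareK.1 hp.1
  have hd1 := ((contDiffAt_hitLog hα Pf Pk hp h1 h2).differentiableAt one_ne_zero).hasFDerivAt
  have n1 := Pf.der1_ne_zero (Ioo_subset_Icc_self hpI.1) h1
  have n2 := Pk.der1_ne_zero (Ioo_subset_Icc_self hpI.2) h2
  have d1 := ((Pf.hasDerivAt_der1 hα hpI.1).log n1).comp_hasFDerivAt p
    (hasFDerivAt_fst (𝕜 := ℝ) (E := ℝ) (F := ℝ))
  have d2 := ((Pk.hasDerivAt_der1 hα hpI.2).log n2).comp_hasFDerivAt p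
    (hasFDerivAt_snd (𝕜 := ℝ) (E := ℝ) (F := ℝ))
  have hw := hd1.sub (d1.add d2)
  rw [show fderiv ℝ (hitWeight α f k) p = _ from hw.fderiv]
  simp only [sub_apply, add_apply,
    smul_apply, ContinuousLinearMap.coe_fst', ContinuousLinearMap.coe_snd',
    fderiv_hitLog hα Pf Pk hp h1 h2, smul_eq_mul]
  field_simp
  ring

end Invariance

/-! ### Boundedness of the weight under the logarithmic hypothesis -/

section Bounds

variable {α : ℝ} {f k h : ℝ → ℝ}

lemma IsProfile.exists_abs_timePrimitive_le (hα : 0 < α) (P : IsProfile α h) {ε : ℝ} (hε : 0 < ε) :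
    ∃ C, ∀ x ∈ Ioo (-α) α, ε ≤ |x| → |timePrimitive α h x| ≤ C := by
  have key : ∀ {h : ℝ → ℝ}, IsProfile α h → ∀ x ∈ Ioo 0 α, ε ≤ x →
      |timePrimitive α h x| ≤ |timePrimitive α h (min ε α)| := by
    intro h P x hx hεx
    have h0 : 0 < min ε α := lt_min hε hα
    have h1 := (P.strictMonoOn_timePrimitive hα).monotoneOn ⟨h0, min_le_right _ _⟩
      ⟨hx.1, hx.2.le⟩ ((min_le_left _ _).trans hεx)
    have h2 := P.timePrimitive_neg_of_mem hα (x := x) ⟨by linarith [hx.1], hx.2⟩ hx.1.ne'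
    rw [abs_of_neg h2, abs_of_neg (h1.trans_lt h2)]
    linarith
  refine ⟨max |timePrimitive α h (min ε α)| |timePrimitive α (fun t => h (-t)) (min ε α)|, ?_⟩
  intro x hx hεx
  have hx0 : x ≠ 0 := by
    rintro rfl
    simp at hεx
    linarith
  rcases lt_or_gt_of_ne hx0 with h1 | h1
  · rw [abs_of_neg h1] at hεx
    have := key P.comp_neg (-x) ⟨by linarith, by linarith [hx.1]⟩ hεx
    rw [timePrimitive_comp_neg _ _ (by linarith : (-x) ≠ 0), neg_neg] at this
    exact this.trans (le_max_right _ _)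
  · rw [abs_of_pos h1] at hεx
    exact (key P x ⟨h1, hx.2⟩ hεx).trans (le_max_left _ _)

/-- Under the logarithmic bound, `ln |h'| - h''(0) H` is bounded on the whole interval. -/
lemma IsProfile.exists_abs_log_der1_sub_le (hα : 0 < α) (P : IsProfile α h)
    (hL : LogBounded α h) : ∃ C, ∀ x ∈ Ioo (-α) α, x ≠ 0 →
      |Real.log (der1 α h x) - der2 α h 0 * timePrimitive α h x| ≤ C := by
  obtain ⟨C₀, hC₀⟩ := hL
  obtain ⟨m, M, hm, hM, hb⟩ := P.exists_der1_bounds hα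
  obtain ⟨ε, hε, hball⟩ := Metric.eventually_nhds_iff.1 (eventually_nhdsWithin_iff.1 hC₀)
  obtain ⟨C₁, hC₁⟩ := P.exists_abs_timePrimitive_le hα hε
  have ha := P.der2_pos
  set a := der2 α h 0
  -- The hypothesis is local at `0`; away from `0` both terms are bounded separately.
  have hfar : ∀ x ∈ Ioo (-α) α, x ≠ 0 →
      |timePrimitive α h x - Real.log |x| / a| ≤ max C₀ (C₁ + (|Real.log ε| + |Real.log α|) / a) := by
    intro x hx hx0
    by_cases hxε : |x| < ε
    · exact (hball (by rwa [Real.dist_eq, sub_zero]) hx0).trans (le_max_left _ _)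
    · rw [not_lt] at hxε
      refine le_trans ?_ (le_max_right _ _)
      refine (abs_sub _ _).trans (add_le_add (hC₁ x hx hxε) ?_)
      rw [abs_div, abs_of_pos ha]
      refine div_le_div_of_nonneg_right ?_ ha.le
      have l1 := Real.log_le_log hε hxε
      have l2 := Real.log_le_log (abs_pos.2 hx0) (abs_lt.2 hx).le
      rw [abs_le]
      constructor
      · linarith [neg_abs_le (Real.log ε), abs_nonneg (Real.log α)]
      · linarith [le_abs_self (Real.log α), abs_nonneg (Real.log ε)]
  refine ⟨(|Real.log m| + |Real.log M|)
    + a * max C₀ (C₁ + (|Real.log ε| + |Real.log α|) / a), fun x hx hx0 => ?_⟩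
  have hx1 := abs_pos.2 hx0
  obtain ⟨b1, b2⟩ := hb x (Ioo_subset_Icc_self hx)
  have l1 := Real.log_le_log (mul_pos hm hx1) b1
  have l2 := Real.log_le_log ((mul_pos hm hx1).trans_le b1) b2
  rw [Real.log_mul hm.ne' hx1.ne', Real.log_abs (der1 α h x)] at l1
  rw [Real.log_mul hM.ne' hx1.ne', Real.log_abs (der1 α h x)] at l2
  -- The first bracket is bounded because `h'` is comparable to `x`, the second by `hfar`.
  have e : Real.log (der1 α h x) - a * timePrimitive α h x
      = (Real.log (der1 α h x) - Real.log |x|) - a * (timePrimitive α h x - Real.log |x| / a) := by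
    field_simp
    ring
  rw [e]
  refine (abs_sub _ _).trans (add_le_add ?_ ?_)
  · rw [abs_le]
    constructor
    · linarith [neg_abs_le (Real.log m), abs_nonneg (Real.log M)]
    · linarith [le_abs_self (Real.log M), abs_nonneg (Real.log m)]
  · rw [abs_mul, abs_of_pos ha]
    exact mul_le_mul_of_nonneg_left (hfar x hx hx0) ha.le

/-- Boundedness of the weight when the two logarithmic rates agree. -/
lemma exists_abs_hitWeight_le (hα : 0 < α) (Pf : IsProfile α f) (Pk : IsProfile α k)
    (hf : LogBounded α f) (hk : LogBounded α k) (hfk : der2 α f 0 = der2 α k 0) :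
    ∃ C, ∀ p ∈ regionQ α f (fun t => -k t), p.1 ≠ 0 → p.2 ≠ 0 → |hitWeight α f k p| ≤ C := by
  obtain ⟨C₁, h1⟩ := Pf.exists_abs_log_der1_sub_le hα hf
  obtain ⟨C₂, h2⟩ := Pk.exists_abs_log_der1_sub_le hα hk
  refine ⟨2 * C₁ + 2 * C₂, fun p hp p1 p2 => ?_⟩
  have hpI := mem_interior_squareK.1 hp.1
  have hz := isHitPoint_hitPoint hα Pf Pk hp p1 p2
  have a1 := abs_le.1 (h1 _ hz.mem_fst (ne_zero_of_mul_pos_left hz.side_fst))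
  have a2 := abs_le.1 (h2 _ hz.mem_snd (ne_zero_of_mul_pos_left hz.side_snd))
  have a3 := abs_le.1 (h1 _ hpI.1 p1)
  have a4 := abs_le.1 (h2 _ hpI.2 p2)
  -- At `p` and at the hitting point alike, `ln |f' k'|` is within a constant of the common rate
  -- times `F + K`, and `F + K` takes the same value at both.
  have ht := congrArg (der2 α k 0 * ·) hz.time
  simp only [mul_add] at ht
  rw [hfk] at a1 a3
  unfold hitWeight hitLog
  rw [abs_le]
  constructor <;> linarith [a1.1, a1.2, a2.1, a2.2, a3.1, a3.2, a4.1, a4.2]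

end Bounds

/-! ### Cutoffs near the axes -/

section Cutoff

/-- A smooth function equal to `0` where `n |t| ≤ 1` and to `1` where `n |t|` is large. -/
def axisCutoff (n : ℕ) (t : ℝ) : ℝ := Real.smoothTransition ((n : ℝ) ^ 2 * t ^ 2 - 1)

lemma contDiff_axisCutoff (n : ℕ) : ContDiff ℝ ∞ (axisCutoff n) :=
  Real.smoothTransition.contDiff.comp (by fun_prop)

lemma axisCutoff_mem_Icc (n : ℕ) (t : ℝ) : axisCutoff n t ∈ Icc (0 : ℝ) 1 :=
  ⟨Real.smoothTransition.nonneg _, Real.smoothTransition.le_one _⟩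

lemma hasDerivAt_axisCutoff (n : ℕ) (t : ℝ) :
    HasDerivAt (axisCutoff n)
      (deriv Real.smoothTransition ((n : ℝ) ^ 2 * t ^ 2 - 1) * ((n : ℝ) ^ 2 * (2 * t))) t := by
  have h1 : HasDerivAt (fun t : ℝ => (n : ℝ) ^ 2 * t ^ 2 - 1) ((n : ℝ) ^ 2 * (2 * t)) t := by
    simpa using ((hasDerivAt_pow 2 t).const_mul ((n : ℝ) ^ 2)).sub_const 1
  have h2 : HasDerivAt Real.smoothTransition (deriv Real.smoothTransition _)
      ((n : ℝ) ^ 2 * t ^ 2 - 1) :=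
    ((Real.smoothTransition.contDiff (n := 1)).differentiable (by norm_num) _).hasDerivAt
  exact h2.comp t h1

lemma deriv_smoothTransition_eq_zero {s : ℝ} (hs : s < 0 ∨ 1 < s) :
    deriv Real.smoothTransition s = 0 := by
  rcases hs with hs | hs
  · refine ((hasDerivAt_const s (0 : ℝ)).congr_of_eventuallyEq ?_).deriv
    filter_upwards [gt_mem_nhds hs] with t ht
    exact Real.smoothTransition.zero_of_nonpos (le_of_lt ht)
  · refine ((hasDerivAt_const s (1 : ℝ)).congr_of_eventuallyEq ?_).deriv
    filter_upwards [lt_mem_nhds hs] with t ht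
    exact Real.smoothTransition.one_of_one_le (le_of_lt ht)

/-- In the variable `s = n² t² - 1`, the product `t χₙ'(t)` of `t` with the derivative of the cutoff
is a function of `s` alone, free of `n`, continuous on `[0, 1]` and zero elsewhere. -/
lemma exists_abs_mul_deriv_axisCutoff_le :
    ∃ C, ∀ (n : ℕ) (t : ℝ), |t * deriv (axisCutoff n) t| ≤ C := by
  have hc : ContinuousOn (fun s => deriv Real.smoothTransition s * (2 * (s + 1))) (Icc 0 1) :=
    (((Real.smoothTransition.contDiff (n := 1)).continuous_deriv (by norm_num)).mul
      (by fun_prop)).continuousOn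
  obtain ⟨C, hC⟩ := isCompact_Icc.exists_bound_of_continuousOn hc
  refine ⟨max C 0, fun n t => ?_⟩
  rw [(hasDerivAt_axisCutoff n t).deriv]
  set s := (n : ℝ) ^ 2 * t ^ 2 - 1 with hs
  have e : t * (deriv Real.smoothTransition s * ((n : ℝ) ^ 2 * (2 * t)))
      = deriv Real.smoothTransition s * (2 * (s + 1)) := by rw [hs]; ring
  rw [e]
  by_cases hs' : s ∈ Icc (0 : ℝ) 1
  · exact (hC s hs').trans (le_max_left _ _)
  · rw [mem_Icc, not_and_or, not_le, not_le] at hs'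
    rw [deriv_smoothTransition_eq_zero hs']
    simp

lemma eventually_axisCutoff {t : ℝ} (ht : t ≠ 0) :
    ∀ᶠ n : ℕ in atTop, axisCutoff n t = 1 ∧ deriv (axisCutoff n) t = 0 := by
  have h1 : Tendsto (fun n : ℕ => (n : ℝ) ^ 2 * t ^ 2 - 1) atTop atTop :=
    tendsto_atTop_add_const_right _ _ (Tendsto.atTop_mul_const (by positivity)
      ((tendsto_pow_atTop two_ne_zero).comp tendsto_natCast_atTop_atTop))
  filter_upwards [h1.eventually_gt_atTop 1] with n hn
  refine ⟨Real.smoothTransition.one_of_one_le hn.le, ?_⟩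
  rw [(hasDerivAt_axisCutoff n t).deriv, deriv_smoothTransition_eq_zero (Or.inr hn), zero_mul]

end Cutoff

/-! ### A bounded weight gives a conductivity across the axes -/

section Realize

variable {α : ℝ} {f k : ℝ → ℝ}

lemma volume_axes (α : ℝ) :
    (volume : Measure (ℝ × ℝ)) (stableCurve α ∪ unstableCurve α) = 0 := by
  rw [measure_union_null_iff, stableCurve, unstableCurve, Measure.volume_eq_prod,
    Measure.prod_prod, Measure.prod_prod]
  simp

lemma restrict_diff_axes (α : ℝ) (S : Set (ℝ × ℝ)) :
    volume.restrict (S \ (stableCurve α ∪ unstableCurve α)) = volume.restrict S :=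
  Measure.restrict_congr_set (sdiff_null_ae_eq_self (volume_axes α))

lemma volume_regionQ_lt_top (α : ℝ) (f g : ℝ → ℝ) : volume (regionQ α f g) < ⊤ :=
  (measure_mono ((regionQ_subset α f g).trans interior_subset)).trans_lt
    (isCompact_Icc.prod isCompact_Icc).measure_lt_top

/-- The flux `e^w ∇u` is divergence free off the axes. -/
lemma fderiv_flux_hitWeight (hα : 0 < α) (Pf : IsProfile α f) (Pk : IsProfile α k) {p : ℝ × ℝ}
    (hp : p ∈ regionQ α f (fun t => -k t)) (h1 : p.1 ≠ 0) (h2 : p.2 ≠ 0) :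
    fderiv ℝ (fun q => Real.exp (hitWeight α f k q) * der1 α f q.1) p (1, 0)
      + fderiv ℝ (fun q => Real.exp (hitWeight α f k q) * -der1 α k q.2) p (0, 1) = 0 := by
  have hpI := mem_interior_squareK.1 hp.1
  have hw := ((contDiffAt_hitWeight hα Pf Pk hp h1 h2).differentiableAt
    one_ne_zero).hasFDerivAt.exp
  have d1 := (Pf.hasDerivAt_der1 hα hpI.1).comp_hasFDerivAt p
    (hasFDerivAt_fst (𝕜 := ℝ) (E := ℝ) (F := ℝ))
  have d2 := (Pk.hasDerivAt_der1 hα hpI.2).comp_hasFDerivAt p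
    (hasFDerivAt_snd (𝕜 := ℝ) (E := ℝ) (F := ℝ))
  have eA := (hw.mul d1).fderiv
  have eB := (hw.mul d2.neg).fderiv
  have key := fderiv_hitWeight hα Pf Pk hp h1 h2
  have hsplit : ((der1 α f p.1, -der1 α k p.2) : ℝ × ℝ)
      = der1 α f p.1 • (1, 0) + (-der1 α k p.2) • (0, 1) := by
    ext <;> simp
  rw [hsplit, map_add, map_smul, map_smul, smul_eq_mul, smul_eq_mul] at key
  rw [show fderiv ℝ (fun q => Real.exp (hitWeight α f k q) * der1 α f q.1) p = _ from eA,
    show fderiv ℝ (fun q => Real.exp (hitWeight α f k q) * -der1 α k q.2) p = _ from eB]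
  simp only [add_apply, smul_apply, neg_apply, ContinuousLinearMap.coe_fst',
    ContinuousLinearMap.coe_snd', smul_eq_mul, Pi.neg_apply, Function.comp, mul_one]
  linear_combination (Real.exp (hitWeight α f k p)) * key

lemma contDiffOn_hitWeight (hα : 0 < α) (Pf : IsProfile α f) (Pk : IsProfile α k) :
    ContDiffOn ℝ 1 (hitWeight α f k)
      (regionQ α f (fun t => -k t) \ (stableCurve α ∪ unstableCurve α)) := by
  intro p hp
  obtain ⟨h0, h1, h2⟩ := (mem_diff_axes_iff ((regionQ_subset α _ _).trans interior_subset)).1 hp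
  exact (contDiffAt_hitWeight hα Pf Pk h0 h1 h2).contDiffWithinAt

/-- Boundedness of the weight `w` implies that `e^w` is a conductivity. -/
lemma exists_isRealizableWith (hα : 0 < α) (Pf : IsProfile α f) (Pk : IsProfile α k) {C : ℝ}
    (hC : ∀ p ∈ regionQ α f (fun t => -k t), p.1 ≠ 0 → p.2 ≠ 0 → |hitWeight α f k p| ≤ C) :
    ∃ σ : ℝ × ℝ → ℝ,
      IsRealizableWith (sepPotential f (fun t => -k t)) (regionQ α f (fun t => -k t)) σ ∧
      MemLinfLoc (regionQ α f (fun t => -k t)) σ ∧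
      MemLinfLoc (regionQ α f (fun t => -k t)) (fun p => (σ p)⁻¹) ∧
      ContDiffOn ℝ 1 σ (regionQ α f (fun t => -k t) \ (stableCurve α ∪ unstableCurve α)) ∧
      ContDiffOn ℝ 1 (fun p => (σ p)⁻¹)
        (regionQ α f (fun t => -k t) \ (stableCurve α ∪ unstableCurve α)) := by
  set Q := regionQ α f (fun t => -k t) with hQ
  set U := Q \ (stableCurve α ∪ unstableCurve α) with hU
  have hQK : Q ⊆ squareK α := (regionQ_subset α _ _).trans interior_subset
  have hQo : IsOpen Q := isOpen_regionQ hα Pf Pk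
  have hUo : IsOpen U := isOpen_diff_axes hQK hQo
  have hUmem : ∀ p, p ∈ U ↔ p ∈ Q ∧ p.1 ≠ 0 ∧ p.2 ≠ 0 := fun p => mem_diff_axes_iff hQK
  have hres : volume.restrict U = volume.restrict Q := restrict_diff_axes α Q
  have hfin : IsFiniteMeasure (volume.restrict Q) :=
    isFiniteMeasure_restrict.2 (volume_regionQ_lt_top α _ _).ne
  have hw : ContDiffOn ℝ 1 (hitWeight α f k) U := contDiffOn_hitWeight hα Pf Pk
  have hσ1 : ContDiffOn ℝ 1 (fun p => Real.exp (hitWeight α f k p)) U := hw.exp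
  have hinv : (fun p => (Real.exp (hitWeight α f k p))⁻¹)
      = fun p => Real.exp (-hitWeight α f k p) := by
    ext p
    rw [Real.exp_neg]
  have hσ2 : ContDiffOn ℝ 1 (fun p => (Real.exp (hitWeight α f k p))⁻¹) U := by
    rw [hinv]
    exact hw.neg.exp
  have haeU : ∀ᵐ p ∂(volume.restrict Q), p ∈ U := by
    rw [← hres]
    exact ae_restrict_mem hUo.measurableSet
  have hwC : ∀ p ∈ U, |hitWeight α f k p| ≤ C := fun p hp =>
    hC p ((hUmem p).1 hp).1 ((hUmem p).1 hp).2.1 ((hUmem p).1 hp).2.2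
  have hL : MemLp (fun p => Real.exp (hitWeight α f k p)) ⊤ (volume.restrict Q) := by
    refine memLp_top_of_bound ?_ (Real.exp C) ?_
    · rw [← hres]
      exact hσ1.continuousOn.aestronglyMeasurable hUo.measurableSet
    · filter_upwards [haeU] with p hp
      rw [Real.norm_eq_abs, Real.abs_exp, Real.exp_le_exp]
      exact (abs_le.1 (hwC p hp)).2
  have hL' : MemLp (fun p => (Real.exp (hitWeight α f k p))⁻¹) ⊤ (volume.restrict Q) := by
    refine memLp_top_of_bound ?_ (Real.exp C) ?_
    · rw [← hres]
      exact hσ2.continuousOn.aestronglyMeasurable hUo.measurableSet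
    · filter_upwards [haeU] with p hp
      rw [← Real.exp_neg, Real.norm_eq_abs, Real.abs_exp, Real.exp_le_exp]
      linarith [(abs_le.1 (hwC p hp)).1]
  refine ⟨fun p => Real.exp (hitWeight α f k p), ⟨?_, ?_, ?_⟩, ?_, ?_, hσ1, hσ2⟩
  · exact Eventually.of_forall fun p => Real.exp_pos _
  · exact IntegrableOn.locallyIntegrableOn (hL.integrable le_top)
  · intro φ hφ hφc hφs
    obtain ⟨m, M, hm, hM, hbf⟩ := Pf.exists_der1_bounds hα
    obtain ⟨m', M', hm', hM', hbk⟩ := Pk.exists_der1_bounds hα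
    obtain ⟨D, hD⟩ := exists_abs_mul_deriv_axisCutoff_le
    have hφ1 : ContDiff ℝ 1 φ := hφ.of_le (by exact_mod_cast le_top)
    have hφd : Differentiable ℝ φ := hφ1.differentiable one_ne_zero
    have hpx : (fun p => partialX φ p) = fun p => fderiv ℝ φ p (1, 0) :=
      funext fun p => partialX_eq_fderiv (hφd p)
    have hpy : (fun p => partialY φ p) = fun p => fderiv ℝ φ p (0, 1) :=
      funext fun p => partialY_eq_fderiv (hφd p)
    have hpxc : Continuous (fun p => partialX φ p) := by
      rw [hpx]; exact (hφ1.continuous_fderiv one_ne_zero).clm_apply continuous_const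
    have hpyc : Continuous (fun p => partialY φ p) := by
      rw [hpy]; exact (hφ1.continuous_fderiv one_ne_zero).clm_apply continuous_const
    obtain ⟨B₀, hB₀⟩ := hφc.exists_bound_of_continuous hφ.continuous
    obtain ⟨B₁, hB₁⟩ := HasCompactSupport.exists_bound_of_continuous
      (f := fun p => partialX φ p) (by
        rw [hpx]
        exact hφc.of_isClosed_subset (isClosed_tsupport _) (tsupport_fderiv_apply_subset ℝ _)) hpxc
    obtain ⟨B₂, hB₂⟩ := HasCompactSupport.exists_bound_of_continuous
      (f := fun p => partialY φ p) (by
        rw [hpy]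
        exact hφc.of_isClosed_subset (isClosed_tsupport _) (tsupport_fderiv_apply_subset ℝ _)) hpyc
    simp only [Real.norm_eq_abs] at hB₀ hB₁ hB₂
    -- Cutting off the test function moves its support off the axes, where the flux is `C¹` and
    -- classically divergence free; the weak equation for `φ` is the limit.
    set ψ : ℕ → ℝ × ℝ → ℝ := fun n p => φ p * (axisCutoff n p.1 * axisCutoff n p.2) with hψ
    have hψ1 : ∀ n, ContDiff ℝ 1 (ψ n) := fun n =>
      hφ1.mul ((((contDiff_axisCutoff n).of_le (by exact_mod_cast le_top)).comp contDiff_fst).mul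
        (((contDiff_axisCutoff n).of_le (by exact_mod_cast le_top)).comp contDiff_snd))
    have hψs : ∀ n, tsupport (ψ n) ⊆ tsupport φ := fun n => tsupport_mul_subset_left
    have hψc : ∀ n, HasCompactSupport (ψ n) := fun n =>
      hφc.of_isClosed_subset (isClosed_tsupport _) (hψs n)
    have hψU : ∀ n, tsupport (ψ n) ⊆ U := by
      intro n p hp
      have hcl : IsClosed {q : ℝ × ℝ | 0 ≤ (n : ℝ) ^ 2 * q.1 ^ 2 - 1 ∧
          0 ≤ (n : ℝ) ^ 2 * q.2 ^ 2 - 1} :=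
        (isClosed_le continuous_const
          ((continuous_const.mul (continuous_fst.pow 2)).sub continuous_const)).inter
          (isClosed_le continuous_const
            ((continuous_const.mul (continuous_snd.pow 2)).sub continuous_const))
      have hsub : Function.support (ψ n) ⊆ {q : ℝ × ℝ | 0 ≤ (n : ℝ) ^ 2 * q.1 ^ 2 - 1 ∧
          0 ≤ (n : ℝ) ^ 2 * q.2 ^ 2 - 1} := by
        intro q hq
        constructor
        · by_contra hcon
          exact hq (by simp [hψ, axisCutoff,
            Real.smoothTransition.zero_of_nonpos (not_le.1 hcon).le])
        · by_contra hcon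
          exact hq (by simp [hψ, axisCutoff,
            Real.smoothTransition.zero_of_nonpos (not_le.1 hcon).le])
      have h3 := closure_minimal hsub hcl hp
      refine (hUmem p).2 ⟨hφs (hψs n hp), fun e => ?_, fun e => ?_⟩
      · have := h3.1
        rw [e] at this
        norm_num at this
      · have := h3.2
        rw [e] at this
        norm_num at this
    have hψx : ∀ n p, partialX (ψ n) p = partialX φ p * (axisCutoff n p.1 * axisCutoff n p.2)
        + φ p * (deriv (axisCutoff n) p.1 * axisCutoff n p.2) := fun n p =>
      ((hasDerivAt_partialX (hφd p)).mul
        ((hasDerivAt_axisCutoff n p.1).differentiableAt.hasDerivAt.mul_const (axisCutoff n p.2))).deriv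
    have hψy : ∀ n p, partialY (ψ n) p = partialY φ p * (axisCutoff n p.1 * axisCutoff n p.2)
        + φ p * (axisCutoff n p.1 * deriv (axisCutoff n) p.2) := fun n p =>
      ((hasDerivAt_partialY (hφd p)).mul
        ((hasDerivAt_axisCutoff n p.2).differentiableAt.hasDerivAt.const_mul (axisCutoff n p.1))).deriv
    have hux : ∀ p ∈ U, partialX (sepPotential f (fun t => -k t)) p = der1 α f p.1 := fun p hp =>
      partialX_sepPotential Pf _ (mem_interior_squareK.1 ((hUmem p).1 hp).1.1).1
    have huy : ∀ p ∈ U, partialY (sepPotential f (fun t => -k t)) p = -der1 α k p.2 := fun p hp =>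
      partialY_sepPotential Pk _ (mem_interior_squareK.1 ((hUmem p).1 hp).1.1).2
    have hA : ContDiffOn ℝ 1 (fun q => Real.exp (hitWeight α f k q) * der1 α f q.1) U :=
      hσ1.mul ((Pf.contDiffOn_der1 hα).comp contDiff_fst.contDiffOn fun p hp => (hQK hp.1).1)
    have hB : ContDiffOn ℝ 1 (fun q => Real.exp (hitWeight α f k q) * -der1 α k q.2) U :=
      hσ1.mul ((Pk.contDiffOn_der1 hα).comp contDiff_snd.contDiffOn
        fun p hp => (hQK hp.1).2).neg
    have hzero : ∀ n, ∫ p in Q, Real.exp (hitWeight α f k p) *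
        (partialX (sepPotential f (fun t => -k t)) p * partialX (ψ n) p
          + partialY (sepPotential f (fun t => -k t)) p * partialY (ψ n) p) = 0 := by
      intro n
      rw [setIntegral_flux_eq (u := sepPotential f (fun t => -k t))
        (σ := fun p => Real.exp (hitWeight α f k p)) hUo sdiff_subset hA hB
        (fun p hp => by rw [hux p hp]) (fun p hp => by rw [huy p hp]) (hψ1 n) (hψc n) (hψU n),
        neg_eq_zero]
      refine integral_eq_zero_of_ae (Eventually.of_forall fun p => ?_)
      by_cases hp : p ∈ U
      · have h3 := (hUmem p).1 hp
        simp only [fderiv_flux_hitWeight hα Pf Pk h3.1 h3.2.1 h3.2.2, mul_zero, Pi.zero_apply]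
      · simp only [image_eq_zero_of_notMem_tsupport (fun h => hp (hψU n h)), zero_mul,
          Pi.zero_apply]
    have hmeas : ∀ a b : ℝ × ℝ → ℝ, Continuous a → Continuous b →
        AEStronglyMeasurable (fun p => Real.exp (hitWeight α f k p) *
        (partialX (sepPotential f (fun t => -k t)) p * a p
          + partialY (sepPotential f (fun t => -k t)) p * b p)) (volume.restrict Q) := by
      intro a b ha hb
      rw [← hres]
      refine ContinuousOn.aestronglyMeasurable ?_ hUo.measurableSet
      refine ((hA.continuousOn.mul ha.continuousOn).add
        (hB.continuousOn.mul hb.continuousOn)).congr fun p hp => ?_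
      simp only [hux p hp, huy p hp, Pi.add_apply, Pi.mul_apply]
      ring
    have hlim : Tendsto (fun n => ∫ p in Q, Real.exp (hitWeight α f k p) *
        (partialX (sepPotential f (fun t => -k t)) p * partialX (ψ n) p
          + partialY (sepPotential f (fun t => -k t)) p * partialY (ψ n) p)) atTop
        (𝓝 (∫ p in Q, Real.exp (hitWeight α f k p) *
        (partialX (sepPotential f (fun t => -k t)) p * partialX φ p
          + partialY (sepPotential f (fun t => -k t)) p * partialY φ p))) := by
      -- Each product gives two terms. Those with `∇φ` are bounded since `|x|, |y| ≤ α`. The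
      -- singular ones carry `f'(x) χₙ'(x)` or `k'(y) χₙ'(y)`, bounded by `M D` or `M' D` uniformly
      -- in `n`: the normal component of `∇u` vanishes linearly on each axis.
      refine tendsto_integral_of_dominated_convergence (fun _ => Real.exp C *
        ((M * (α * B₁) + M * (B₀ * D)) + (M' * (α * B₂) + M' * (B₀ * D)))) ?_ ?_ ?_ ?_
      · intro n
        refine hmeas _ _ ?_ ?_
        · rw [show partialX (ψ n) = fun p => fderiv ℝ (ψ n) p (1, 0) from
            funext fun p => partialX_eq_fderiv ((hψ1 n).differentiable one_ne_zero p)]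
          exact ((hψ1 n).continuous_fderiv one_ne_zero).clm_apply continuous_const
        · rw [show partialY (ψ n) = fun p => fderiv ℝ (ψ n) p (0, 1) from
            funext fun p => partialY_eq_fderiv ((hψ1 n).differentiable one_ne_zero p)]
          exact ((hψ1 n).continuous_fderiv one_ne_zero).clm_apply continuous_const
      · exact integrable_const _
      · intro n
        filter_upwards [haeU] with p hp
        have hpK := hQK hp.1
        have hc1 := axisCutoff_mem_Icc n p.1
        have hc2 := axisCutoff_mem_Icc n p.2
        have hB₀' := (abs_nonneg _).trans (hB₀ p)
        have hB₁' := (abs_nonneg _).trans (hB₁ p)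
        have hB₂' := (abs_nonneg _).trans (hB₂ p)
        have hcc : |axisCutoff n p.1 * axisCutoff n p.2| ≤ 1 := by
          rw [abs_of_nonneg (mul_nonneg hc1.1 hc2.1)]
          exact mul_le_one₀ hc1.2 hc2.1 hc2.2
        rw [Real.norm_eq_abs, abs_mul, Real.abs_exp, hux p hp, huy p hp, hψx, hψy]
        refine mul_le_mul (Real.exp_le_exp.2 (abs_le.1 (hwC p hp)).2) ?_ (abs_nonneg _)
          (Real.exp_pos _).le
        have hbx := (hbf p.1 hpK.1).2
        have hby := (hbk p.2 hpK.2).2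
        have hx1 : |p.1| ≤ α := abs_le.2 hpK.1
        have hy1 : |p.2| ≤ α := abs_le.2 hpK.2
        refine (abs_add_le _ _).trans (add_le_add ?_ ?_)
        · rw [mul_add]
          refine (abs_add_le _ _).trans (add_le_add ?_ ?_)
          · rw [abs_mul, abs_mul]
            calc |der1 α f p.1| * (|partialX φ p| * |axisCutoff n p.1 * axisCutoff n p.2|)
                ≤ (M * |p.1|) * (B₁ * 1) := by
                  gcongr
                  exact hB₁ p
              _ ≤ M * (α * B₁) := by
                  rw [mul_one, mul_assoc]
                  gcongr
          · rw [abs_mul, abs_mul, abs_mul, abs_of_nonneg hc2.1]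
            calc |der1 α f p.1| * (|φ p| * (|deriv (axisCutoff n) p.1| * axisCutoff n p.2))
                ≤ (M * |p.1|) * (B₀ * (|deriv (axisCutoff n) p.1| * 1)) := by
                  gcongr
                  · exact mul_nonneg (abs_nonneg _) (mul_nonneg (abs_nonneg _) hc2.1)
                  · exact mul_nonneg (abs_nonneg _) hc2.1
                  · exact hB₀ p
                  · exact hc2.2
              _ = M * (B₀ * |p.1 * deriv (axisCutoff n) p.1|) := by rw [abs_mul]; ring
              _ ≤ M * (B₀ * D) := by
                  gcongr
                  exact hD n p.1
        · rw [mul_add]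
          refine (abs_add_le _ _).trans (add_le_add ?_ ?_)
          · rw [abs_mul, abs_mul, abs_neg]
            calc |der1 α k p.2| * (|partialY φ p| * |axisCutoff n p.1 * axisCutoff n p.2|)
                ≤ (M' * |p.2|) * (B₂ * 1) := by
                  gcongr
                  exact hB₂ p
              _ ≤ M' * (α * B₂) := by
                  rw [mul_one, mul_assoc]
                  gcongr
          · rw [abs_mul, abs_mul, abs_mul, abs_neg, abs_of_nonneg hc1.1]
            calc |der1 α k p.2| * (|φ p| * (axisCutoff n p.1 * |deriv (axisCutoff n) p.2|))
                ≤ (M' * |p.2|) * (B₀ * (1 * |deriv (axisCutoff n) p.2|)) := by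
                  gcongr
                  · exact mul_nonneg (abs_nonneg _) (mul_nonneg hc1.1 (abs_nonneg _))
                  · exact mul_nonneg hc1.1 (abs_nonneg _)
                  · exact hB₀ p
                  · exact hc1.2
              _ = M' * (B₀ * |p.2 * deriv (axisCutoff n) p.2|) := by rw [abs_mul]; ring
              _ ≤ M' * (B₀ * D) := by
                  gcongr
                  exact hD n p.2
      · filter_upwards [haeU] with p hp
        refine tendsto_const_nhds.congr' ?_
        filter_upwards [eventually_axisCutoff ((hUmem p).1 hp).2.1,
          eventually_axisCutoff ((hUmem p).1 hp).2.2] with n h1 h2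
        rw [hψx, hψy, h1.1, h1.2, h2.1, h2.2]
        ring
    simp only [hzero] at hlim
    exact tendsto_nhds_unique hlim tendsto_const_nhds
  · intro K _ hK
    exact hL.mono_measure (Measure.restrict_mono hK le_rfl)
  · intro K _ hK
    exact hL'.mono_measure (Measure.restrict_mono hK le_rfl)

end Realize

/-! ### Necessary conditions from a bounded conductivity -/

section Converse

variable {α : ℝ} {f k h : ℝ → ℝ}

/-- A `C¹` conductivity satisfies the transport equation pointwise. -/
lemma fderiv_conductivity (hα : 0 < α) (Pf : IsProfile α f) (Pk : IsProfile α k)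
    {U V : Set (ℝ × ℝ)} {σ : ℝ × ℝ → ℝ} (hU : IsOpen U) (hUV : U ⊆ V)
    (hUK : U ⊆ interior (squareK α)) (hσ : ContDiffOn ℝ 1 σ U)
    (hweak : ∀ φ : ℝ × ℝ → ℝ, ContDiff ℝ ∞ φ → HasCompactSupport φ → tsupport φ ⊆ V →
      ∫ p in V, σ p * (partialX (sepPotential f (fun t => -k t)) p * partialX φ p
        + partialY (sepPotential f (fun t => -k t)) p * partialY φ p) = 0) :
    ∀ p ∈ U, fderiv ℝ σ p (der1 α f p.1, -der1 α k p.2)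
      + σ p * (der2 α f p.1 - der2 α k p.2) = 0 := by
  have hUI : ∀ p ∈ U, p.1 ∈ Ioo (-α) α ∧ p.2 ∈ Ioo (-α) α := fun p hp =>
    mem_interior_squareK.1 (hUK hp)
  have hA : ContDiffOn ℝ 1 (fun q => σ q * der1 α f q.1) U :=
    hσ.mul ((Pf.contDiffOn_der1 hα).comp contDiff_fst.contDiffOn
      fun p hp => Ioo_subset_Icc_self (hUI p hp).1)
  have hB : ContDiffOn ℝ 1 (fun q => σ q * -der1 α k q.2) U :=
    hσ.mul ((Pk.contDiffOn_der1 hα).comp contDiff_snd.contDiffOn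
      fun p hp => Ioo_subset_Icc_self (hUI p hp).2).neg
  set D : ℝ × ℝ → ℝ := fun p => fderiv ℝ (fun q => σ q * der1 α f q.1) p (1, 0)
    + fderiv ℝ (fun q => σ q * -der1 α k q.2) p (0, 1) with hD
  have hDc : ContinuousOn D U :=
    ((hA.continuousOn_fderiv_of_isOpen hU le_rfl).clm_apply continuousOn_const).add
      ((hB.continuousOn_fderiv_of_isOpen hU le_rfl).clm_apply continuousOn_const)
  -- The weak equation only gives `D = 0` almost everywhere; continuity of `D` on the open set makes
  -- it hold everywhere.
  have hae : ∀ᵐ p, p ∈ U → D p = 0 := by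
    refine hU.ae_eq_zero_of_integral_contDiff_smul_eq_zero
      (hDc.locallyIntegrableOn hU.measurableSet) fun φ hφ hφc hφs => ?_
    have h1 := hweak φ hφ hφc (hφs.trans hUV)
    rw [setIntegral_flux_eq (u := sepPotential f (fun t => -k t)) hU hUV hA hB
      (fun p hp => by rw [partialX_sepPotential Pf _ (hUI p hp).1])
      (fun p hp => by rw [partialY_sepPotential Pk _ (hUI p hp).2])
      (hφ.of_le (by exact_mod_cast le_top)) hφc hφs, neg_eq_zero] at h1
    exact h1
  have hzero : EqOn D (fun _ => 0) U :=
    Measure.eqOn_open_of_ae_eq ((ae_restrict_iff' hU.measurableSet).2 hae) hU hDc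
      continuousOn_const
  intro p hp
  have key : D p = 0 := hzero hp
  have hs := ((hσ.contDiffAt (hU.mem_nhds hp)).differentiableAt one_ne_zero).hasFDerivAt
  have d1 := (Pf.hasDerivAt_der1 hα (hUI p hp).1).comp_hasFDerivAt p
    (hasFDerivAt_fst (𝕜 := ℝ) (E := ℝ) (F := ℝ))
  have d2 := (Pk.hasDerivAt_der1 hα (hUI p hp).2).comp_hasFDerivAt p
    (hasFDerivAt_snd (𝕜 := ℝ) (E := ℝ) (F := ℝ))
  have eA := (hs.mul d1).fderiv
  have eB := (hs.mul d2.neg).fderiv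
  have hsplit : ((der1 α f p.1, -der1 α k p.2) : ℝ × ℝ)
      = der1 α f p.1 • (1, 0) + (-der1 α k p.2) • (0, 1) := by
    ext <;> simp
  rw [hsplit, map_add, map_smul, map_smul, smul_eq_mul, smul_eq_mul]
  simp only [hD] at key
  rw [show fderiv ℝ (fun q => σ q * der1 α f q.1) p = _ from eA,
    show fderiv ℝ (fun q => σ q * -der1 α k q.2) p = _ from eB] at key
  simp only [add_apply, smul_apply, neg_apply, ContinuousLinearMap.coe_fst',
    ContinuousLinearMap.coe_snd', smul_eq_mul, Pi.neg_apply, Function.comp, mul_one] at key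
  linear_combination key

/-- `σ f' g'` takes the same value at two points of a trajectory in the positive quadrant. -/
lemma conductivity_mul_eq (hα : 0 < α) (Pf : IsProfile α f) (Pk : IsProfile α k) {r r₀ ε δ : ℝ}
    {σ : ℝ × ℝ → ℝ} (hr : r ≤ α) (hσ : ContDiffOn ℝ 1 σ (Ioo 0 r ×ˢ Ioo 0 r))
    (htr : ∀ p ∈ Ioo 0 r ×ˢ Ioo 0 r, fderiv ℝ σ p (der1 α f p.1, -der1 α k p.2)
      + σ p * (der2 α f p.1 - der2 α k p.2) = 0)
    (hr₀ : r₀ < r) (hε : ε ∈ Ioc 0 r₀) (hδ : δ ∈ Ioc 0 r₀)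
    (heq : timePrimitive α f r₀ - timePrimitive α f ε
      = timePrimitive α k r₀ - timePrimitive α k δ) :
    σ (ε, r₀) * (der1 α f ε * der1 α k r₀) = σ (r₀, δ) * (der1 α f r₀ * der1 α k δ) := by
  have hr0 : 0 < r₀ := hε.1.trans_le hε.2
  have hm : ∀ {x}, x ∈ Ioc 0 r₀ → x ∈ Ioc 0 α := fun hx => ⟨hx.1, by linarith [hx.2]⟩
  have hI : ∀ {x}, x ∈ Ioc 0 r₀ → x ∈ Icc (-α) α := fun hx =>
    ⟨by linarith [hx.1], by linarith [hx.2]⟩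
  have hr0m : r₀ ∈ Ioc 0 r₀ := ⟨hr0, le_rfl⟩
  have hF0 : timePrimitive α f r₀ < 0 :=
    Pf.timePrimitive_neg_of_mem hα ⟨by linarith, by linarith⟩ hr0.ne'
  have hK0 : timePrimitive α k r₀ < 0 :=
    Pk.timePrimitive_neg_of_mem hα ⟨by linarith, by linarith⟩ hr0.ne'
  have hFε := (Pf.strictMonoOn_timePrimitive hα).monotoneOn (hm hε) (hm hr0m) hε.2
  set d := timePrimitive α f ε + timePrimitive α k r₀ with hd
  -- The trajectory parametrized by `F`: it starts at `(ε, r₀)`, and `heq` says that it reaches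
  -- `(r₀, δ)`. Both coordinates stay at most `r₀ < r`.
  set γ : ℝ → ℝ × ℝ := fun s => (sideInverse α f α s, sideInverse α k α (d - s)) with hγ
  have hmem : ∀ s ∈ Icc (timePrimitive α f ε) (timePrimitive α f r₀),
      γ s ∈ Ioo 0 r ×ˢ Ioo 0 r := by
    have key : ∀ {h : ℝ → ℝ}, IsProfile α h → timePrimitive α h r₀ < 0 →
        ∀ s ≤ timePrimitive α h r₀, sideInverse α h α s ∈ Ioo 0 r := by
      intro h P hneg s hs
      obtain ⟨a1, a2, a3⟩ := P.sideInverse_spec hα hα.ne' (hs.trans hneg.le)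
      have hpos := pos_of_mul_pos_left a2 hα.le
      refine ⟨hpos, lt_of_le_of_lt ?_ hr₀⟩
      exact ((P.strictMonoOn_timePrimitive hα).le_iff_le ⟨hpos, a1.2⟩ (hm hr0m)).1 (by rwa [a3])
    intro s hs
    exact ⟨key Pf hF0 s hs.2, key Pk hK0 _ (by linarith [hs.1])⟩
  have hder : ∀ s ∈ Icc (timePrimitive α f ε) (timePrimitive α f r₀),
      HasDerivWithinAt (fun s => σ (γ s) * (der1 α f (γ s).1 * der1 α k (γ s).2)) 0
        (Icc (timePrimitive α f ε) (timePrimitive α f r₀)) s := by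
    intro s hs
    have hU := hmem s hs
    have hs0 : s < 0 := hs.2.trans_lt hF0
    have hs1 : d - s < 0 := by linarith [hs.1]
    have hg : HasDerivAt γ _ s := hasDerivAt_flow hα Pf Pk hα.ne' hα.ne' hs0 hs1
    have h1 := (((hσ.contDiffAt ((isOpen_Ioo.prod isOpen_Ioo).mem_nhds hU)).differentiableAt
      one_ne_zero).hasFDerivAt).comp_hasDerivAt s hg
    have h2 := (Pf.hasDerivAt_der1 hα (Pf.sideInverse_mem_Ioo hα hα.ne' hs0)).comp s hg.fst
    have h3 := (Pk.hasDerivAt_der1 hα (Pk.sideInverse_mem_Ioo hα hα.ne' hs1)).comp s hg.snd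
    refine HasDerivAt.hasDerivWithinAt ((h1.mul (h2.mul h3)).congr_deriv ?_)
    have := htr _ hU
    simp only [Function.comp, hγ, Pi.mul_apply] at this ⊢
    -- The derivative of `σ f' k'` is `f' k' (∇σ · ∇u + σ Δu)`, zero by the transport equation.
    linear_combination (der1 α f (sideInverse α f α s)
      * der1 α k (sideInverse α k α (d - s))) * this
  have hconst := (convex_Icc (timePrimitive α f ε)
    (timePrimitive α f r₀)).norm_image_sub_le_of_norm_hasDerivWithin_le (C := 0) hder
    (fun _ _ => by simp) (left_mem_Icc.2 hFε) (right_mem_Icc.2 hFε)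
  simp only [zero_mul, norm_le_zero_iff] at hconst
  have hinv : ∀ {h : ℝ → ℝ}, IsProfile α h → ∀ {x}, x ∈ Ioc 0 r₀ →
      sideInverse α h α (timePrimitive α h x) = x := fun P x hx =>
    P.sideInverse_timePrimitive hα (hI hx) (mul_pos hx.1 hα)
  have e1 : γ (timePrimitive α f ε) = (ε, r₀) := by
    simp only [hγ, hd, add_sub_cancel_left, hinv Pf hε, hinv Pk hr0m]
  have e2 : γ (timePrimitive α f r₀) = (r₀, δ) := by
    have : d - timePrimitive α f r₀ = timePrimitive α k δ := by rw [hd]; linarith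
    simp only [hγ, this, hinv Pf hr0m, hinv Pk hδ]
  rw [e1, e2] at hconst
  linarith

lemma ae_norm_le_of_memLp_top {X : Type*} [MeasurableSpace X] {μ : Measure X} {σ : X → ℝ}
    (h : MemLp σ ⊤ μ) : ∃ C, 0 < C ∧ ∀ᵐ x ∂μ, |σ x| ≤ C := by
  refine ⟨(eLpNorm σ ⊤ μ).toReal + 1, by positivity, ?_⟩
  rw [eLpNorm_exponent_top]
  filter_upwards [enorm_ae_le_eLpNormEssSup σ μ] with x hx
  have hfin : eLpNormEssSup σ μ ≠ ⊤ := by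
    rw [← eLpNorm_exponent_top]; exact h.2.ne
  have := ENNReal.toReal_mono hfin hx
  rw [toReal_enorm, Real.norm_eq_abs] at this
  linarith

/-- Almost everywhere `max a b = b`, and two continuous functions equal almost everywhere on an open
set are equal on it. -/
lemma forall_le_of_ae_le {U : Set (ℝ × ℝ)} (hU : IsOpen U) {a b : ℝ × ℝ → ℝ}
    (ha : ContinuousOn a U) (hb : ContinuousOn b U)
    (h : ∀ᵐ p ∂(volume.restrict U), a p ≤ b p) : ∀ p ∈ U, a p ≤ b p := by
  have h1 : (fun p => max (a p) (b p)) =ᵐ[volume.restrict U] b := by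
    filter_upwards [h] with p hp
    exact max_eq_right hp
  intro p hp
  exact max_eq_right_iff.1 (Measure.eqOn_open_of_ae_eq h1 hU (ha.sup hb) hb hp)

lemma exists_conductivity_bounds {U : Set (ℝ × ℝ)} (hU : IsOpen U) {σ : ℝ × ℝ → ℝ}
    (hσ : ContinuousOn σ U) (hpos : ∀ᵐ p ∂(volume.restrict U), 0 < σ p)
    (h1 : MemLinf U σ) (h2 : MemLinf U (fun p => (σ p)⁻¹)) :
    ∃ c C : ℝ, 0 < c ∧ 0 < C ∧ ∀ p ∈ U, c ≤ σ p ∧ σ p ≤ C := by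
  obtain ⟨C₁, hC₁, b1⟩ := ae_norm_le_of_memLp_top h1
  obtain ⟨C₂, hC₂, b2⟩ := ae_norm_le_of_memLp_top h2
  refine ⟨C₂⁻¹, C₁, inv_pos.2 hC₂, hC₁, fun p hp => ⟨?_, ?_⟩⟩
  · refine forall_le_of_ae_le hU continuousOn_const hσ ?_ p hp
    filter_upwards [hpos, b2] with q q1 q2
    exact inv_le_of_inv_le₀ q1 ((le_abs_self _).trans q2)
  · refine forall_le_of_ae_le hU hσ continuousOn_const ?_ p hp
    filter_upwards [b1] with q q1
    exact (le_abs_self _).trans q1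

/-- Points at equal times from `r₀` on the two half axes are at comparable distances to `0`. -/
def TimeComparable (α : ℝ) (f k : ℝ → ℝ) : Prop :=
  ∃ r₀ C : ℝ, 0 < r₀ ∧ r₀ < α ∧ ∀ ε ∈ Ioc 0 r₀, ∀ δ ∈ Ioc 0 r₀,
    timePrimitive α f r₀ - timePrimitive α f ε = timePrimitive α k r₀ - timePrimitive α k δ →
    |Real.log ε - Real.log δ| ≤ C

lemma TimeComparable.symm (h : TimeComparable α f k) : TimeComparable α k f := by
  obtain ⟨r₀, C, h1, h2, h3⟩ := h
  exact ⟨r₀, C, h1, h2, fun ε hε δ hδ e => by rw [abs_sub_comm]; exact h3 δ hδ ε hε e.symm⟩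

/-- Take logarithms in `conductivity_mul_eq`: `σ` lies between two positive constants, the factors
at `r₀` are fixed, and `f'(ε)`, `k'(δ)` are comparable to `ε`, `δ`. Only one open quadrant is
needed. -/
lemma timeComparable_of_conductivity (hα : 0 < α) (Pf : IsProfile α f) (Pk : IsProfile α k)
    {r : ℝ} {V : Set (ℝ × ℝ)} {σ : ℝ × ℝ → ℝ} (hr0 : 0 < r) (hr : r ≤ α)
    (hUV : Ioo 0 r ×ˢ Ioo 0 r ⊆ V) (hσ : ContDiffOn ℝ 1 σ (Ioo 0 r ×ˢ Ioo 0 r))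
    (hreal : IsRealizableWith (sepPotential f (fun t => -k t)) V σ)
    (h1 : MemLinf (Ioo 0 r ×ˢ Ioo 0 r) σ) (h2 : MemLinf (Ioo 0 r ×ˢ Ioo 0 r) (fun p => (σ p)⁻¹)) :
    TimeComparable α f k := by
  have hU : IsOpen (Ioo 0 r ×ˢ Ioo 0 r) := isOpen_Ioo.prod isOpen_Ioo
  obtain ⟨hpos, -, hweak⟩ := hreal
  have htr := fderiv_conductivity hα Pf Pk hU hUV (fun p hp => mem_interior_squareK.2
    ⟨⟨by linarith [hp.1.1], by linarith [hp.1.2]⟩, ⟨by linarith [hp.2.1], by linarith [hp.2.2]⟩⟩)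
    hσ hweak
  obtain ⟨c, C, hc, hC, hb⟩ := exists_conductivity_bounds hU hσ.continuousOn
    (ae_restrict_of_ae_restrict_of_subset hUV hpos) h1 h2
  obtain ⟨m, M, hm, hM, hbf⟩ := Pf.exists_der1_bounds hα
  obtain ⟨m', M', hm', hM', hbk⟩ := Pk.exists_der1_bounds hα
  set r₀ := r / 2 with hr₀
  have hr₀0 : 0 < r₀ := by linarith
  have hr₀r : r₀ < r := by linarith
  have hbd : ∀ {h : ℝ → ℝ}, IsProfile α h → ∀ {m M : ℝ}, 0 < m →
      (∀ x ∈ Icc (-α) α, m * |x| ≤ |der1 α h x| ∧ |der1 α h x| ≤ M * |x|) → ∀ x ∈ Ioc 0 r₀,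
      0 < der1 α h x ∧ Real.log m + Real.log x ≤ Real.log (der1 α h x) ∧
        Real.log (der1 α h x) ≤ Real.log M + Real.log x := by
    intro h P m M hm hb x hx
    have hp := P.right x ⟨hx.1, by linarith [hx.2]⟩
    obtain ⟨l1, l2⟩ := hb x ⟨by linarith [hx.1], by linarith [hx.2]⟩
    rw [abs_of_pos hx.1, abs_of_pos hp] at l1 l2
    have hM : M ≠ 0 := by
      rintro rfl
      linarith
    refine ⟨hp, ?_, ?_⟩
    · rw [← Real.log_mul hm.ne' hx.1.ne']
      exact Real.log_le_log (mul_pos hm hx.1) l1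
    · rw [← Real.log_mul hM hx.1.ne']
      exact Real.log_le_log hp l2
  refine ⟨r₀, (Real.log C - Real.log c) + |Real.log (der1 α f r₀) - Real.log (der1 α k r₀)|
    + (|Real.log m| + |Real.log M| + |Real.log m'| + |Real.log M'|), hr₀0, by linarith, ?_⟩
  intro ε hε δ hδ heq
  have key := conductivity_mul_eq hα Pf Pk hr hσ htr hr₀r hε hδ heq
  obtain ⟨fε, fε1, fε2⟩ := hbd Pf hm hbf ε hε
  obtain ⟨kδ, kδ1, kδ2⟩ := hbd Pk hm' hbk δ hδ
  have fr := (hbd Pf hm hbf r₀ ⟨hr₀0, le_rfl⟩).1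
  have kr := (hbd Pk hm' hbk r₀ ⟨hr₀0, le_rfl⟩).1
  have s1 := hb (ε, r₀) ⟨⟨hε.1, by linarith [hε.2]⟩, ⟨hr₀0, hr₀r⟩⟩
  have s2 := hb (r₀, δ) ⟨⟨hr₀0, hr₀r⟩, ⟨hδ.1, by linarith [hδ.2]⟩⟩
  have p1 := hc.trans_le s1.1
  have p2 := hc.trans_le s2.1
  have hlog := congrArg Real.log key
  rw [Real.log_mul p1.ne' (mul_pos fε kr).ne', Real.log_mul p2.ne' (mul_pos fr kδ).ne',
    Real.log_mul fε.ne' kr.ne', Real.log_mul fr.ne' kδ.ne'] at hlog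
  have t1 := Real.log_le_log hc s1.1
  have t2 := Real.log_le_log p1 s1.2
  have t3 := Real.log_le_log hc s2.1
  have t4 := Real.log_le_log p2 s2.2
  have q := abs_le.1 (le_refl |Real.log (der1 α f r₀) - Real.log (der1 α k r₀)|)
  have q1 := abs_le.1 (le_refl |Real.log m|)
  have q2 := abs_le.1 (le_refl |Real.log M|)
  have q3 := abs_le.1 (le_refl |Real.log m'|)
  have q4 := abs_le.1 (le_refl |Real.log M'|)
  rw [abs_le]
  constructor
  · linarith [q.1, q.2, q1.1, q2.1, q3.1, q4.1, q1.2, q2.2, q3.2, q4.2]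
  · linarith [q.1, q.2, q1.1, q2.1, q3.1, q4.1, q1.2, q2.2, q3.2, q4.2]

lemma IsProfile.tendsto_slope (hα : 0 < α) (P : IsProfile α h) :
    Tendsto (fun x => der1 α h x / x) (𝓝[≠] 0) (𝓝 (der2 α h 0)) := by
  have h1 := hasDerivAt_iff_tendsto_slope.1 (P.hasDerivAt_der1 hα (x := 0) ⟨by linarith, hα⟩)
  refine h1.congr fun x => ?_
  rw [slope_def_field, P.der_zero, sub_zero, sub_zero]

/-- Near `0` one has `h'(x) > a x`, so the time primitive minus `ln x / a` is decreasing there. On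
the rest of the interval everything is bounded and goes into `C`. -/
lemma IsProfile.exists_log_div_sub_le (hα : 0 < α) (P : IsProfile α h) {a : ℝ} (ha : 0 < a)
    (hlt : a < der2 α h 0) :
    ∃ C, ∀ x ∈ Ioc 0 α, Real.log x / a - C ≤ timePrimitive α h x := by
  obtain ⟨ε, hε, hb⟩ := Metric.eventually_nhds_iff.1
    (eventually_nhdsWithin_iff.1 ((P.tendsto_slope hα).eventually (lt_mem_nhds hlt)))
  set r := min (ε / 2) (α / 2) with hr
  have hr0 : 0 < r := lt_min (by linarith) (by linarith)
  have hrε : r < ε := (min_le_left _ _).trans_lt (by linarith)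
  have hrα : r < α := (min_le_right _ _).trans_lt (by linarith)
  have hanti : AntitoneOn (fun x => timePrimitive α h x - Real.log x / a) (Ioc 0 r) := by
    have hd : ∀ x ∈ Ioc 0 r, HasDerivAt (fun x => timePrimitive α h x - Real.log x / a)
        (1 / der1 α h x - x⁻¹ / a) x := fun x hx =>
      (P.hasDerivAt_timePrimitive_of_pos hα ⟨hx.1, by linarith [hx.2]⟩).sub
        ((Real.hasDerivAt_log hx.1.ne').div_const a)
    refine antitoneOn_of_deriv_nonpos (convex_Ioc 0 r)
      (fun x hx => (hd x hx).continuousAt.continuousWithinAt)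
      (fun x hx => (hd x (interior_subset hx)).differentiableAt.differentiableWithinAt) ?_
    intro x hx
    replace hx := interior_subset hx
    rw [(hd x hx).deriv, sub_nonpos]
    have h1 : a < der1 α h x / x :=
      hb (by rw [Real.dist_eq, sub_zero, abs_of_pos hx.1]; linarith [hx.2]) hx.1.ne'
    rw [lt_div_iff₀ hx.1] at h1
    have : x⁻¹ / a = 1 / (a * x) := by field_simp
    rw [this]
    exact one_div_le_one_div_of_le (mul_pos ha hx.1) h1.le
  refine ⟨max (Real.log r / a - timePrimitive α h r) (Real.log α / a - timePrimitive α h r),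
    fun x hx => ?_⟩
  rcases le_total x r with hxr | hxr
  · have := hanti ⟨hx.1, hxr⟩ ⟨hr0, le_rfl⟩ hxr
    simp only at this
    linarith [le_max_left (Real.log r / a - timePrimitive α h r)
      (Real.log α / a - timePrimitive α h r)]
  · have h1 := (P.strictMonoOn_timePrimitive hα).monotoneOn ⟨hr0, hrα.le⟩ hx hxr
    have h2 := div_le_div_of_nonneg_right (Real.log_le_log hx.1 hx.2) ha.le
    linarith [le_max_right (Real.log r / a - timePrimitive α h r)
      (Real.log α / a - timePrimitive α h r)]

/-- The mirror estimate, from `h'(x) < b x` near `0`; away from `0` the time primitive is at most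
zero. -/
lemma IsProfile.exists_le_log_div_add (hα : 0 < α) (P : IsProfile α h) {b : ℝ}
    (hlt : der2 α h 0 < b) :
    ∃ C, ∀ x ∈ Ioc 0 α, timePrimitive α h x ≤ Real.log x / b + C := by
  have hb0 : 0 < b := P.der2_pos.trans hlt
  obtain ⟨ε, hε, hb⟩ := Metric.eventually_nhds_iff.1
    (eventually_nhdsWithin_iff.1 ((P.tendsto_slope hα).eventually (gt_mem_nhds hlt)))
  set r := min (ε / 2) (α / 2) with hr
  have hr0 : 0 < r := lt_min (by linarith) (by linarith)
  have hrε : r < ε := (min_le_left _ _).trans_lt (by linarith)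
  have hrα : r < α := (min_le_right _ _).trans_lt (by linarith)
  have hmono : MonotoneOn (fun x => timePrimitive α h x - Real.log x / b) (Ioc 0 r) := by
    have hd : ∀ x ∈ Ioc 0 r, HasDerivAt (fun x => timePrimitive α h x - Real.log x / b)
        (1 / der1 α h x - x⁻¹ / b) x := fun x hx =>
      (P.hasDerivAt_timePrimitive_of_pos hα ⟨hx.1, by linarith [hx.2]⟩).sub
        ((Real.hasDerivAt_log hx.1.ne').div_const b)
    refine monotoneOn_of_deriv_nonneg (convex_Ioc 0 r)
      (fun x hx => (hd x hx).continuousAt.continuousWithinAt)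
      (fun x hx => (hd x (interior_subset hx)).differentiableAt.differentiableWithinAt) ?_
    intro x hx
    replace hx := interior_subset hx
    rw [(hd x hx).deriv, sub_nonneg]
    have h1 : der1 α h x / x < b :=
      hb (by rw [Real.dist_eq, sub_zero, abs_of_pos hx.1]; linarith [hx.2]) hx.1.ne'
    rw [div_lt_iff₀ hx.1] at h1
    have : x⁻¹ / b = 1 / (b * x) := by field_simp
    rw [this]
    exact one_div_le_one_div_of_le (P.right x ⟨hx.1, by linarith [hx.2]⟩) h1.le
  refine ⟨max (timePrimitive α h r - Real.log r / b) (-(Real.log r / b)), fun x hx => ?_⟩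
  rcases le_total x r with hxr | hxr
  · have := hmono ⟨hx.1, hxr⟩ ⟨hr0, le_rfl⟩ hxr
    simp only at this
    linarith [le_max_left (timePrimitive α h r - Real.log r / b) (-(Real.log r / b))]
  · have h1 := P.timePrimitive_nonpos hα (x := x) ⟨by linarith [hx.1], hx.2⟩ hx.1.ne'
    have h2 := div_le_div_of_nonneg_right (Real.log_le_log hr0 hxr) hb0.le
    linarith [le_max_right (timePrimitive α h r - Real.log r / b) (-(Real.log r / b))]

/-- The required value of `K` is at most `K(r₀) < 0`, hence in the range of `K` and attained at or
before `r₀`. -/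
lemma IsProfile.exists_same_time (hα : 0 < α) (Pf : IsProfile α f) (Pk : IsProfile α k) {r₀ ε : ℝ}
    (hr₀ : r₀ < α) (hε : ε ∈ Ioc 0 r₀) :
    ∃ δ ∈ Ioc 0 r₀, timePrimitive α f r₀ - timePrimitive α f ε
      = timePrimitive α k r₀ - timePrimitive α k δ := by
  have hr0 : 0 < r₀ := hε.1.trans_le hε.2
  have h1 := (Pf.strictMonoOn_timePrimitive hα).monotoneOn ⟨hε.1, by linarith [hε.2]⟩
    ⟨hr0, hr₀.le⟩ hε.2
  have h2 := Pk.timePrimitive_neg_of_mem hα (x := r₀) ⟨by linarith, hr₀⟩ hr0.ne'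
  obtain ⟨a1, a2, a3⟩ := Pk.sideInverse_spec hα hα.ne'
    (s := timePrimitive α k r₀ - (timePrimitive α f r₀ - timePrimitive α f ε)) (by linarith)
  have hpos := pos_of_mul_pos_left a2 hα.le
  refine ⟨_, ⟨hpos, ?_⟩, by rw [a3]; ring⟩
  exact ((Pk.strictMonoOn_timePrimitive hα).le_iff_le ⟨hpos, a1.2⟩ ⟨hr0, hr₀.le⟩).1
    (by rw [a3]; linarith)

/-- If `k''(0) < b < a < f''(0)`, then `F(ε)` is at least `ln ε / a` and `K(δ)` at most `ln δ / b`,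
up to constants. Equal times and comparability would then bound `|ln ε| (1/b - 1/a)` as `ε → 0`. -/
lemma der2_le_of_timeComparable (hα : 0 < α) (Pf : IsProfile α f) (Pk : IsProfile α k)
    (hT : TimeComparable α f k) : der2 α f 0 ≤ der2 α k 0 := by
  obtain ⟨r₀, C, hr0, hr₀, hcmp⟩ := hT
  by_contra! hlt
  obtain ⟨b, hb1, hb2⟩ := exists_between hlt
  obtain ⟨a, ha1, ha2⟩ := exists_between hb2
  have hb0 : 0 < b := Pk.der2_pos.trans hb1
  have ha0 : 0 < a := hb0.trans ha1
  obtain ⟨C₁, h1⟩ := Pf.exists_log_div_sub_le hα ha0 ha2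
  obtain ⟨C₂, h2⟩ := Pk.exists_le_log_div_add hα hb1
  have hθ : 0 < 1 / b - 1 / a := sub_pos.2 (one_div_lt_one_div_of_lt hb0 ha1)
  set N := C₁ + C₂ + C / b + (timePrimitive α f r₀ - timePrimitive α k r₀) with hN
  -- The exponent makes `-ln ε · (1/b - 1/a)` exceed `N`, contradicting `l6`.
  have hε0 : 0 < min r₀ (Real.exp (-(N / (1 / b - 1 / a)) - 1)) := lt_min hr0 (Real.exp_pos _)
  set ε := min r₀ (Real.exp (-(N / (1 / b - 1 / a)) - 1)) with hε
  have hεm : ε ∈ Ioc 0 r₀ := ⟨hε0, min_le_left _ _⟩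
  obtain ⟨δ, hδ, heq⟩ := Pf.exists_same_time hα Pk hr₀ hεm
  have l1 := h1 ε ⟨hε0, by linarith [hεm.2]⟩
  have l2 := h2 δ ⟨hδ.1, by linarith [hδ.2]⟩
  have l3 := (abs_le.1 (hcmp ε hεm δ hδ heq)).1
  have l4 : Real.log δ / b ≤ (Real.log ε + C) / b :=
    div_le_div_of_nonneg_right (by linarith) hb0.le
  have l5 : Real.log ε ≤ -(N / (1 / b - 1 / a)) - 1 := by
    have := Real.log_le_log hε0 (min_le_right r₀ (Real.exp (-(N / (1 / b - 1 / a)) - 1)))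
    rwa [Real.log_exp] at this
  have l6 : -Real.log ε * (1 / b - 1 / a) ≤ N := by
    have e1 : -Real.log ε * (1 / b - 1 / a) = Real.log ε / a - Real.log ε / b := by ring
    rw [add_div] at l4
    linarith
  have l7 : (N / (1 / b - 1 / a) + 1) * (1 / b - 1 / a) ≤ -Real.log ε * (1 / b - 1 / a) :=
    mul_le_mul_of_nonneg_right (by linarith) hθ.le
  rw [add_mul, div_mul_cancel₀ _ hθ.ne'] at l7
  linarith

lemma exists_square_subset {V : Set (ℝ × ℝ)} (hα : 0 < α) (hV : IsOpen V)
    (h0 : ((0 : ℝ), (0 : ℝ)) ∈ V) : ∃ r, 0 < r ∧ r ≤ α ∧ Icc 0 r ×ˢ Icc 0 r ⊆ V := by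
  obtain ⟨ε, hε, hb⟩ := Metric.isOpen_iff.1 hV _ h0
  refine ⟨min α (ε / 2), lt_min hα (by linarith), min_le_left _ _, fun p hp => hb ?_⟩
  have h2 : min α (ε / 2) < ε := (min_le_right _ _).trans_lt (by linarith)
  rw [Metric.mem_ball, Prod.dist_eq, Real.dist_eq, Real.dist_eq, max_lt_iff, sub_zero, sub_zero,
    abs_of_nonneg hp.1.1, abs_of_nonneg hp.2.1]
  exact ⟨hp.1.2.trans_lt h2, hp.2.2.trans_lt h2⟩

/-- A locally bounded `C¹` conductivity forces the times on the two axes to be comparable. -/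
lemma timeComparable_of_isRealizableWith (hα : 0 < α) (Pf : IsProfile α f) (Pk : IsProfile α k)
    {V : Set (ℝ × ℝ)} {σ : ℝ × ℝ → ℝ} (hV : IsOpen V) (h0 : (0, 0) ∈ V) (hVK : V ⊆ squareK α)
    (hreal : IsRealizableWith (sepPotential f (fun t => -k t)) V σ)
    (h1 : MemLinfLoc V σ) (h2 : MemLinfLoc V (fun p => (σ p)⁻¹))
    (hσ : ContDiffOn ℝ 1 σ (V \ (stableCurve α ∪ unstableCurve α))) :
    TimeComparable α f k := by
  obtain ⟨r, hr0, hr, hsub⟩ := exists_square_subset hα hV h0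
  have hIoo : Ioo 0 r ×ˢ Ioo 0 r ⊆ Icc 0 r ×ˢ Icc 0 r :=
    prod_mono Ioo_subset_Icc_self Ioo_subset_Icc_self
  -- Local boundedness is used on this closed square with a corner at the origin; its interior
  -- avoids the axes.
  have hcomp : IsCompact (Icc (0 : ℝ) r ×ˢ Icc (0 : ℝ) r) := isCompact_Icc.prod isCompact_Icc
  refine timeComparable_of_conductivity hα Pf Pk hr0 hr (hIoo.trans hsub) (hσ.mono fun p hp => ?_)
    hreal ((h1 _ hcomp hsub).mono_measure (Measure.restrict_mono hIoo le_rfl))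
    ((h2 _ hcomp hsub).mono_measure (Measure.restrict_mono hIoo le_rfl))
  exact (mem_diff_axes_iff hVK).2 ⟨hsub (hIoo hp), hp.1.1.ne', hp.2.1.ne'⟩

end Converse

/-! ### From saddle pairs to profiles and back -/

section Conversion

variable {α : ℝ} {f k h : ℝ → ℝ}

/-- The saddle condition fixes only the sign of a product. The sign of each factor comes from the
difference quotients of `h'` at `0` on the right. -/
lemma der2_nonneg_of_der1_pos (hα : 0 < α) (hc : ContDiffOn ℝ 2 h (Icc (-α) α))
    (h0 : der1 α h 0 = 0) (hpos : ∀ x ∈ Ioc 0 α, 0 < der1 α h x) : 0 ≤ der2 α h 0 := by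
  have hd : HasDerivWithinAt (der1 α h) (der2 α h 0) (Icc (-α) α) 0 :=
    ((hc.derivWithin (m := 1) (uniqueDiffOn_Icc (by linarith)) (by norm_num)).differentiableOn
      (by norm_num) 0 ⟨by linarith, hα.le⟩).hasDerivWithinAt
  have hd2 := hasDerivWithinAt_iff_tendsto_slope.1 (hd.mono
    (show Ioo 0 α ⊆ Icc (-α) α from fun x hx => ⟨by linarith [hx.1], hx.2.le⟩))
  have hset : Ioo 0 α \ {0} = Ioo 0 α := by
    ext x
    simp only [Set.mem_sdiff, mem_Ioo, mem_singleton_iff]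
    exact ⟨fun h => h.1, fun h => ⟨h, h.1.ne'⟩⟩
  rw [hset] at hd2
  have : (𝓝[Ioo 0 α] (0 : ℝ)).NeBot := left_nhdsWithin_Ioo_neBot hα
  refine ge_of_tendsto hd2 ?_
  filter_upwards [self_mem_nhdsWithin] with x hx
  rw [slope_def_field, h0, sub_zero, sub_zero]
  exact (div_pos (hpos x ⟨hx.1, hx.2.le⟩) hx.1).le

/-- Smoothness of `f` and `k` separately is read off by restricting `u` to the two axes, where the
other term vanishes. -/
lemma IsSaddlePair.isProfile (hα : 0 < α) (H : IsSaddlePair α f (fun t => -k t)) :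
    IsProfile α f ∧ IsProfile α k := by
  have h00 : (0 : ℝ) ∈ Icc (-α) α := ⟨by linarith, hα.le⟩
  have k0 : k 0 = 0 := by simpa using H.g_zero
  have cf : ContDiffOn ℝ 2 f (Icc (-α) α) := by
    have h1 := H.contDiffOn.comp (contDiff_id.prodMk contDiff_const).contDiffOn
      (s := Icc (-α) α) (f := fun x : ℝ => (x, (0 : ℝ))) (fun x hx => ⟨hx, h00⟩)
    refine h1.congr fun x _ => ?_
    simp [sepPotential, k0]
  have ck : ContDiffOn ℝ 2 k (Icc (-α) α) := by
    have h1 := H.contDiffOn.comp (contDiff_const.prodMk contDiff_id).contDiffOn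
      (s := Icc (-α) α) (f := fun x : ℝ => ((0 : ℝ), x)) (fun x hx => ⟨h00, hx⟩)
    refine h1.neg.congr fun x _ => ?_
    simp [sepPotential, H.f_zero]
  have hright := H.right
  have hleft := H.left
  have hs := H.saddle
  have hk0 := H.g_der_zero
  simp only [der1_neg] at hright hleft hk0
  rw [der2_neg] at hs
  rw [neg_eq_zero] at hk0
  have hf2 := der2_nonneg_of_der1_pos hα cf H.f_der_zero fun x hx => (hright x hx).1
  have hk2 := der2_nonneg_of_der1_pos hα ck hk0 fun x hx => by linarith [(hright x hx).2]
  refine ⟨⟨cf, H.f_zero, H.f_der_zero, lt_of_le_of_ne hf2 fun e => ?_, fun x hx => (hright x hx).1,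
    fun x hx => (hleft x hx).1⟩, ⟨ck, k0, hk0, lt_of_le_of_ne hk2 fun e => ?_,
    fun x hx => by linarith [(hright x hx).2], fun x hx => by linarith [(hleft x hx).2]⟩⟩
  · rw [← e] at hs
    simp at hs
  · rw [← e] at hs
    simp at hs

lemma IsProfile.isSaddlePair (Pf : IsProfile α f) (Pk : IsProfile α k) :
    IsSaddlePair α f (fun t => -k t) where
  contDiffOn := (Pf.contDiffOn.comp contDiff_fst.contDiffOn fun _ hp => hp.1).add
    (Pk.contDiffOn.comp contDiff_snd.contDiffOn fun _ hp => hp.2).neg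
  f_zero := Pf.zero
  g_zero := by simp [Pk.zero]
  f_der_zero := Pf.der_zero
  g_der_zero := by rw [der1_neg, Pk.der_zero, neg_zero]
  saddle := by
    rw [der2_neg]
    nlinarith [mul_pos Pf.der2_pos Pk.der2_pos]
  right x hx := by
    rw [der1_neg]
    exact ⟨Pf.right x hx, neg_lt_zero.2 (Pk.right x hx)⟩
  left x hx := by
    rw [der1_neg]
    exact ⟨Pf.left x hx, neg_pos.2 (Pk.left x hx)⟩

lemma logBounded_neg_iff : LogBounded α (fun t => -h t) ↔ LogBounded α h := by
  unfold LogBounded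
  have : ∀ x, timePrimitive α (fun t => -h t) x - Real.log |x| / der2 α (fun t => -h t) 0
      = -(timePrimitive α h x - Real.log |x| / der2 α h 0) := by
    intro x
    rw [timePrimitive_neg, der2_neg, div_neg]
    ring
  simp only [this, abs_neg]

variable {ρ ρ' : ℝ → ℝ} {W : Set ℝ}

lemma der1_eq_of_hasDerivAt (hα : 0 < α) (hW : Icc (-α) α ⊆ W)
    (hρ : ∀ x ∈ W, HasDerivAt h (ρ x) x) : EqOn (der1 α h) ρ (Icc (-α) α) := fun x hx =>
  (hρ x (hW hx)).hasDerivWithinAt.derivWithin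
    (uniqueDiffOn_Icc (by linarith : -α < α) x hx)

lemma der2_eq_of_hasDerivAt (hα : 0 < α) (hW : Icc (-α) α ⊆ W)
    (hρ : ∀ x ∈ W, HasDerivAt h (ρ x) x) (hρ' : ∀ x ∈ W, HasDerivAt ρ (ρ' x) x) {x : ℝ}
    (hx : x ∈ Icc (-α) α) : der2 α h x = ρ' x := by
  have e := der1_eq_of_hasDerivAt hα hW hρ
  unfold der2
  rw [derivWithin_congr e (e hx)]
  exact (hρ' x (hW hx)).hasDerivWithinAt.derivWithin
    (uniqueDiffOn_Icc (by linarith : -α < α) x hx)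

/-- Derivatives given on an open neighborhood `W` of the interval are two-sided, so they agree with
the one-sided ones at the end points. -/
lemma isProfile_of_hasDerivAt (hα : 0 < α) (hWo : IsOpen W) (hW : Icc (-α) α ⊆ W)
    (hρ : ∀ x ∈ W, HasDerivAt h (ρ x) x) (hρ' : ∀ x ∈ W, HasDerivAt ρ (ρ' x) x)
    (hc : ContinuousOn ρ' W) (h0 : h 0 = 0) (hρ0 : ρ 0 = 0) (hρ0' : 0 < ρ' 0)
    (hr : ∀ x ∈ Ioc 0 α, 0 < ρ x) (hl : ∀ x ∈ Ico (-α) 0, ρ x < 0) : IsProfile α h := by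
  have e := der1_eq_of_hasDerivAt hα hW hρ
  have h00 : (0 : ℝ) ∈ Icc (-α) α := ⟨by linarith, hα.le⟩
  have c1 : ContDiffOn ℝ 1 ρ W := by
    rw [show (1 : ℕ∞ω) = 0 + 1 by norm_num, contDiffOn_succ_iff_deriv_of_isOpen hWo]
    refine ⟨fun x hx => (hρ' x hx).differentiableAt.differentiableWithinAt, by simp, ?_⟩
    exact contDiffOn_zero.2 (hc.congr fun x hx => (hρ' x hx).deriv)
  have c2 : ContDiffOn ℝ 2 h W := by
    rw [show (2 : ℕ∞ω) = 1 + 1 by norm_num, contDiffOn_succ_iff_deriv_of_isOpen hWo]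
    refine ⟨fun x hx => (hρ x hx).differentiableAt.differentiableWithinAt, by simp, ?_⟩
    exact c1.congr fun x hx => (hρ x hx).deriv
  refine ⟨c2.mono hW, h0, by rw [e h00, hρ0], by rwa [der2_eq_of_hasDerivAt hα hW hρ hρ' h00],
    fun x hx => ?_, fun x hx => ?_⟩
  · rw [e ⟨by linarith [hx.1], hx.2⟩]
    exact hr x hx
  · rw [e ⟨hx.1, by linarith [hx.2]⟩]
    exact hl x hx

end Conversion

/-! ### The counterexample with an iterated logarithm -/

section Example

variable {α : ℝ}

lemma hasDerivAt_half_sq (x : ℝ) : HasDerivAt (fun t : ℝ => t ^ 2 / 2) x x :=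
  ((hasDerivAt_pow 2 x).div_const 2).congr_deriv (by simp)

lemma isProfile_half_sq (hα : 0 < α) : IsProfile α (fun t => t ^ 2 / 2) :=
  isProfile_of_hasDerivAt hα isOpen_univ (subset_univ _) (fun x _ => hasDerivAt_half_sq x)
    (fun x _ => hasDerivAt_id x) continuousOn_const (by simp) rfl one_pos (fun _ hx => hx.1)
    (fun _ hx => hx.2)

lemma timePrimitive_half_sq (hα : 0 < α) {x : ℝ} (hx : x ∈ Ioc 0 α) :
    timePrimitive α (fun t => t ^ 2 / 2) x = Real.log x - Real.log α := by
  have e := der1_eq_of_hasDerivAt hα (subset_univ _) (fun x _ => hasDerivAt_half_sq x)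
  have hmem : ∀ t ∈ uIcc α x, 0 < t ∧ t ∈ Icc (-α) α := by
    intro t ht
    rw [uIcc_of_ge hx.2] at ht
    exact ⟨hx.1.trans_le ht.1, by linarith [hx.1.trans_le ht.1], ht.2⟩
  rw [timePrimitive, if_pos hx.1, intervalIntegral.integral_congr (g := fun t => t⁻¹)
    (fun t ht => by simp only [e (hmem t ht).2, one_div])]
  rw [integral_inv_of_pos hα hx.1, Real.log_div hx.1.ne' hα.ne']

/-- The slowly varying factor `2 + ln (α / |x|)`. -/
def slowLog (α x : ℝ) : ℝ := 2 + Real.log α - Real.log x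

/-- The derivative of the slow profile: `x (1 - 1 / (2 + ln (α / |x|)))`. -/
def slowDer (α x : ℝ) : ℝ := x * (1 - (slowLog α x)⁻¹)

/-- The second derivative of the slow profile. -/
def slowDer2 (α x : ℝ) : ℝ :=
  if x = 0 then 1 else 1 - (slowLog α x)⁻¹ - ((slowLog α x)⁻¹) ^ 2

/-- A profile whose time primitive is not within a bounded distance of a logarithm. -/
def slowProfile (α x : ℝ) : ℝ := ∫ t in (0 : ℝ)..x, slowDer α t

/-- The constant `2` is there for this: `ln |x| < ln 2 + ln α` on the doubled interval and `ln 2 <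
1`. Hence `1 - 1/slowLog` is positive off `0`. `Real.log` already carries the absolute value. -/
lemma one_lt_slowLog (hα : 0 < α) {x : ℝ} (hx : x ∈ Ioo (-(2 * α)) (2 * α)) (h0 : x ≠ 0) :
    1 < slowLog α x := by
  have h1 : Real.log x < Real.log 2 + Real.log α := by
    rw [← Real.log_abs, ← Real.log_mul two_ne_zero hα.ne']
    exact Real.log_lt_log (abs_pos.2 h0) (abs_lt.2 hx)
  have h2 : Real.log 2 < 1 := by linarith [Real.log_two_lt_d9]
  unfold slowLog
  linarith

lemma tendsto_inv_slowLog (α : ℝ) : Tendsto (fun x => (slowLog α x)⁻¹) (𝓝[≠] 0) (𝓝 0) := by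
  have h1 : Tendsto (fun x => slowLog α x) (𝓝[≠] 0) atTop :=
    tendsto_atTop_add_const_left _ _ (tendsto_neg_atBot_atTop.comp Real.tendsto_log_nhdsNE_zero)
  exact tendsto_inv_atTop_zero.comp h1

lemma hasDerivAt_slowLog {x : ℝ} (h0 : x ≠ 0) : HasDerivAt (slowLog α) (-x⁻¹) x :=
  (Real.hasDerivAt_log h0).const_sub _

lemma hasDerivAt_slowDer (hα : 0 < α) {x : ℝ} (hx : x ∈ Ioo (-(2 * α)) (2 * α)) :
    HasDerivAt (slowDer α) (slowDer2 α x) x := by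
  by_cases h0 : x = 0
  · rw [h0, hasDerivAt_iff_tendsto_slope, slowDer2, if_pos rfl]
    have h1 : Tendsto (fun x => 1 - (slowLog α x)⁻¹) (𝓝[≠] 0) (𝓝 1) := by
      simpa using (tendsto_inv_slowLog α).const_sub 1
    refine h1.congr' ?_
    filter_upwards [self_mem_nhdsWithin] with t ht
    have ht0 : t ≠ 0 := ht
    rw [slope_def_field]
    simp only [slowDer, zero_mul, sub_zero]
    field_simp
  · have hL := one_lt_slowLog hα hx h0
    have h1 := (hasDerivAt_id x).mul
      (((hasDerivAt_slowLog (α := α) h0).inv (by linarith)).const_sub 1)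
    refine h1.congr_deriv ?_
    have : slowLog α x ≠ 0 := by linarith
    rw [slowDer2, if_neg h0]
    simp only [id, Pi.inv_apply]
    field_simp
    ring

lemma continuousOn_slowDer2 (hα : 0 < α) :
    ContinuousOn (slowDer2 α) (Ioo (-(2 * α)) (2 * α)) := by
  intro x hx
  refine ContinuousAt.continuousWithinAt ?_
  by_cases h0 : x = 0
  · rw [h0, continuousAt_iff_punctured_nhds, slowDer2, if_pos rfl]
    have h1 : Tendsto (fun x => 1 - (slowLog α x)⁻¹ - ((slowLog α x)⁻¹) ^ 2) (𝓝[≠] 0) (𝓝 1) := by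
      simpa using ((tendsto_inv_slowLog α).const_sub 1).sub ((tendsto_inv_slowLog α).pow 2)
    refine h1.congr' ?_
    filter_upwards [self_mem_nhdsWithin] with t ht
    have ht0 : t ≠ 0 := ht
    rw [slowDer2, if_neg ht0]
  · have hL := one_lt_slowLog hα hx h0
    have hc : ContinuousAt (fun x => (slowLog α x)⁻¹) x :=
      (hasDerivAt_slowLog h0).continuousAt.inv₀ (by linarith)
    refine (((continuousAt_const (y := (1 : ℝ))).sub hc).sub (hc.pow 2)).congr ?_
    filter_upwards [isOpen_ne.mem_nhds h0] with t ht
    have ht0 : t ≠ 0 := ht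
    rw [slowDer2, if_neg ht0]
    rfl

lemma hasDerivAt_slowProfile (hα : 0 < α) {x : ℝ} (hx : x ∈ Ioo (-(2 * α)) (2 * α)) :
    HasDerivAt (slowProfile α) (slowDer α x) x := by
  have hc : ContinuousOn (slowDer α) (Ioo (-(2 * α)) (2 * α)) := fun t ht =>
    (hasDerivAt_slowDer hα ht).continuousAt.continuousWithinAt
  refine intervalIntegral.integral_hasDerivAt_right ?_
    (hc.stronglyMeasurableAtFilter isOpen_Ioo x hx) (hasDerivAt_slowDer hα hx).continuousAt
  refine (hc.mono ?_).intervalIntegrable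
  have h0 : (0 : ℝ) ∈ Ioo (-(2 * α)) (2 * α) := ⟨by linarith, by linarith⟩
  exact ordConnected_Ioo.uIcc_subset h0 hx

lemma Icc_subset_Ioo_double (hα : 0 < α) : Icc (-α) α ⊆ Ioo (-(2 * α)) (2 * α) :=
  fun x hx => ⟨by linarith [hx.1], by linarith [hx.2]⟩

lemma isProfile_slowProfile (hα : 0 < α) : IsProfile α (slowProfile α) := by
  have hfac : ∀ x ∈ Icc (-α) α, x ≠ 0 → 0 < 1 - (slowLog α x)⁻¹ := fun x hx h0 =>
    sub_pos.2 (inv_lt_one_of_one_lt₀ (one_lt_slowLog hα (Icc_subset_Ioo_double hα hx) h0))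
  refine isProfile_of_hasDerivAt hα isOpen_Ioo (Icc_subset_Ioo_double hα)
    (fun x hx => hasDerivAt_slowProfile hα hx) (fun x hx => hasDerivAt_slowDer hα hx)
    (continuousOn_slowDer2 hα) (by simp [slowProfile]) (by simp [slowDer]) (by simp [slowDer2]) ?_ ?_
  · intro x hx
    exact mul_pos hx.1 (hfac x ⟨by linarith [hx.1], hx.2⟩ hx.1.ne')
  · intro x hx
    exact mul_neg_of_neg_of_pos hx.2 (hfac x ⟨hx.1, by linarith [hx.2]⟩ hx.2.ne)

/-- With `L = slowLog`, one has `1/(x (1 - 1/L)) = 1/x + 1/(x (L - 1))`, and the last term is the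
derivative of `-ln (L - 1)` because `L' = -1/x`. At `α`, `L - 1 = 1`. -/
lemma timePrimitive_slowProfile (hα : 0 < α) {x : ℝ} (hx : x ∈ Ioc 0 α) :
    timePrimitive α (slowProfile α) x
      = Real.log x - Real.log (slowLog α x - 1) - Real.log α := by
  have hmem : ∀ t ∈ uIcc α x, 0 < t ∧ t ∈ Icc (-α) α := by
    intro t ht
    rw [uIcc_of_ge hx.2] at ht
    exact ⟨hx.1.trans_le ht.1, by linarith [hx.1.trans_le ht.1], ht.2⟩
  have e := der1_eq_of_hasDerivAt hα (Icc_subset_Ioo_double hα)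
    (fun x hx => hasDerivAt_slowProfile hα hx)
  have hlog : ∀ t ∈ uIcc α x, 1 < slowLog α t := fun t ht =>
    one_lt_slowLog hα (Icc_subset_Ioo_double hα (hmem t ht).2) (hmem t ht).1.ne'
  have hd : ∀ t ∈ uIcc α x, HasDerivAt (fun t => Real.log t - Real.log (slowLog α t - 1))
      (1 / der1 α (slowProfile α) t) t := by
    intro t ht
    have ht0 := (hmem t ht).1.ne'
    have hL := hlog t ht
    have h1 := (Real.hasDerivAt_log ht0).sub
      (((hasDerivAt_slowLog (α := α) ht0).sub_const 1).log (by linarith))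
    refine h1.congr_deriv ?_
    have n1 : slowLog α t ≠ 0 := by linarith
    have n2 : slowLog α t - 1 ≠ 0 := by linarith
    rw [e (hmem t ht).2]
    simp only [slowDer]
    have n3 : 1 - (slowLog α t)⁻¹ = (slowLog α t - 1) / slowLog α t := by field_simp
    rw [n3]
    field_simp
    ring
  have hint : IntervalIntegrable (fun t => 1 / der1 α (slowProfile α) t) volume α x := by
    refine ContinuousOn.intervalIntegrable (continuousOn_const.div
      (((isProfile_slowProfile hα).contDiffOn_der1 hα).continuousOn.mono
        fun t ht => (hmem t ht).2) fun t ht => ?_)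
    exact (isProfile_slowProfile hα).der1_ne_zero (hmem t ht).2 (hmem t ht).1.ne'
  rw [timePrimitive, if_pos hx.1, intervalIntegral.integral_eq_sub_of_hasDerivAt hd hint]
  have : slowLog α α - 1 = 1 := by unfold slowLog; ring
  rw [this, Real.log_one]
  ring

/-- For `k = y²/2` equal times mean `ln ε - ln δ = ln (L(ε) - 1) - ln (L(r₀) - 1)` with `L =
slowLog`, which is unbounded as `ε → 0`. -/
lemma not_timeComparable_slowProfile (hα : 0 < α) :
    ¬ TimeComparable α (slowProfile α) (fun t => t ^ 2 / 2) := by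
  rintro ⟨r₀, C, hr0, hr₀, hcmp⟩
  set N := C + Real.log (slowLog α r₀ - 1) with hN
  -- For this `ε`, `slowLog α ε - 1 ≥ 1 + exp N`, so its logarithm exceeds `N`.
  have hε0 : 0 < min r₀ (Real.exp (Real.log α - Real.exp N)) := lt_min hr0 (Real.exp_pos _)
  set ε := min r₀ (Real.exp (Real.log α - Real.exp N)) with hε
  have hεm : ε ∈ Ioc 0 r₀ := ⟨hε0, min_le_left _ _⟩
  obtain ⟨δ, hδ, heq⟩ :=
    (isProfile_slowProfile hα).exists_same_time hα (isProfile_half_sq hα) hr₀ hεm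
  have l := (abs_le.1 (hcmp ε hεm δ hδ heq)).2
  rw [timePrimitive_slowProfile hα ⟨hr0, hr₀.le⟩,
    timePrimitive_slowProfile hα ⟨hε0, by linarith [hεm.2]⟩,
    timePrimitive_half_sq hα ⟨hr0, hr₀.le⟩,
    timePrimitive_half_sq hα ⟨hδ.1, by linarith [hδ.2]⟩] at heq
  have l2 : Real.log (slowLog α ε - 1) ≤ N := by linarith
  have l3 : Real.log ε ≤ Real.log α - Real.exp N := by
    have := Real.log_le_log hε0 (min_le_right r₀ (Real.exp (Real.log α - Real.exp N)))
    rwa [Real.log_exp] at this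
  have l4 : Real.exp N < slowLog α ε - 1 := by unfold slowLog; linarith
  have l5 := Real.log_lt_log (Real.exp_pos N) l4
  rw [Real.log_exp] at l5
  linarith

end Example

end

/-! ### Assembly -/

theorem mainTheorem4 (α : ℝ) (hα : 0 < α) :
    (∀ f g : ℝ → ℝ, IsSaddlePair α f g →
      -- the function `w` is well defined and of class `C¹` off the axes
      (IsOpen (regionQ α f g) ∧ (0, 0) ∈ regionQ α f g ∧
        ∃ τ w : ℝ × ℝ → ℝ,
          IsHittingIntegral (sepPotential f g) (interior (squareK α))
            (regionQ α f g \ (stableCurve α ∪ unstableCurve α)) τ w ∧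
          ContDiffOn ℝ 1 w (regionQ α f g \ (stableCurve α ∪ unstableCurve α))) ∧
      -- i)
      ((∃ σ : ℝ × ℝ → ℝ,
          IsRealizableWith (sepPotential f g) (regionQ α f g) σ ∧
          MemLinfLoc (regionQ α f g) σ ∧ MemLinfLoc (regionQ α f g) (fun p => (σ p)⁻¹) ∧
          ContDiffOn ℝ 1 σ (regionQ α f g \ (stableCurve α ∪ unstableCurve α)) ∧
          ContDiffOn ℝ 1 (fun p => (σ p)⁻¹)
            (regionQ α f g \ (stableCurve α ∪ unstableCurve α))) →
        planeLaplacian (sepPotential f g) (0, 0) = 0) ∧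
      -- ii)
      (planeLaplacian (sepPotential f g) (0, 0) = 0 → LogBounded α f → LogBounded α g →
        ∃ σ : ℝ × ℝ → ℝ,
          IsRealizableWith (sepPotential f g) (regionQ α f g) σ ∧
          MemLinfLoc (regionQ α f g) σ ∧ MemLinfLoc (regionQ α f g) (fun p => (σ p)⁻¹) ∧
          ContDiffOn ℝ 1 σ (regionQ α f g \ (stableCurve α ∪ unstableCurve α)) ∧
          ContDiffOn ℝ 1 (fun p => (σ p)⁻¹)
            (regionQ α f g \ (stableCurve α ∪ unstableCurve α)))) ∧
    -- iii)
    (∃ f g : ℝ → ℝ, IsSaddlePair α f g ∧ planeLaplacian (sepPotential f g) (0, 0) = 0 ∧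
      ∀ V : Set (ℝ × ℝ), IsOpen V → (0, 0) ∈ V → V ⊆ squareK α →
        ¬ ∃ σ : ℝ × ℝ → ℝ,
          IsRealizableWith (sepPotential f g) V σ ∧
          MemLinf V σ ∧ MemLinf V (fun p => (σ p)⁻¹) ∧
          ContDiffOn ℝ 1 σ (V \ (stableCurve α ∪ unstableCurve α)) ∧
          ContDiffOn ℝ 1 (fun p => (σ p)⁻¹) (V \ (stableCurve α ∪ unstableCurve α))) := by
  have h00 : ((0 : ℝ), (0 : ℝ)) ∈ interior (squareK α) :=
    mem_interior_squareK.2 ⟨⟨by linarith, hα⟩, ⟨by linarith, hα⟩⟩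
  constructor
  · intro f g H
    obtain ⟨k, rfl⟩ : ∃ k : ℝ → ℝ, g = fun t => -k t := ⟨fun t => -g t, by simp⟩
    obtain ⟨Pf, Pk⟩ := H.isProfile hα
    have hlap := planeLaplacian_sepPotential hα Pf Pk h00
    refine ⟨⟨isOpen_regionQ hα Pf Pk, zero_mem_regionQ hα _ _, hitTime α f k, hitWeight α f k,
      isHittingIntegral_hitTime hα Pf Pk, contDiffOn_hitWeight hα Pf Pk⟩, ?_, ?_⟩
    · rintro ⟨σ, hreal, h1, h2, hσ, -⟩
      have hT := timeComparable_of_isRealizableWith hα Pf Pk (isOpen_regionQ hα Pf Pk)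
        (zero_mem_regionQ hα _ _) ((regionQ_subset α _ _).trans interior_subset) hreal h1 h2 hσ
      -- Comparability is symmetric in `f` and `k`, so both inequalities hold and `f''(0) = k''(0)`.
      have a := der2_le_of_timeComparable hα Pf Pk hT
      have b := der2_le_of_timeComparable hα Pk Pf hT.symm
      rw [hlap]
      linarith
    · intro h0 hf hg
      rw [hlap] at h0
      obtain ⟨C, hC⟩ := exists_abs_hitWeight_le hα Pf Pk hf (logBounded_neg_iff.1 hg)
        (sub_eq_zero.1 h0)
      exact exists_isRealizableWith hα Pf Pk hC
  · have Pf := isProfile_slowProfile hα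
    have Pk := isProfile_half_sq hα
    refine ⟨slowProfile α, fun t => -(t ^ 2 / 2), Pf.isSaddlePair Pk, ?_, ?_⟩
    · have hz : (0 : ℝ) ∈ Icc (-α) α := ⟨by linarith, hα.le⟩
      rw [planeLaplacian_sepPotential hα Pf Pk h00,
        der2_eq_of_hasDerivAt hα (Icc_subset_Ioo_double hα)
          (fun x hx => hasDerivAt_slowProfile hα hx) (fun x hx => hasDerivAt_slowDer hα hx) hz,
        der2_eq_of_hasDerivAt hα (subset_univ _) (fun x _ => hasDerivAt_half_sq x)
          (fun x _ => hasDerivAt_id x) hz]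
      simp [slowDer2]
    · rintro V hV h0 hVK ⟨σ, hreal, h1, h2, hσ, -⟩
      exact not_timeComparable_slowProfile hα (timeComparable_of_isRealizableWith hα Pf Pk hV h0
        hVK hreal (fun C _ hC => h1.mono_measure (Measure.restrict_mono hC le_rfl))
        (fun C _ hC => h2.mono_measure (Measure.restrict_mono hC le_rfl)) hσ)
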